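/- **Theorem 1.** Let $F\in\mathbb{C}[x_1,x_2,x_3]$ be of degree at most two in each variable, and for $\{i,j,k\}=\{1,2,3\}$ let $\mathcal{D}_{x_i}F(x_j,x_k)=b^2-4ac$ be the discriminant of $F=a x_i^2+b x_i+c$ regarded as a quadratic polynomial in $x_i$. Call $F$ *strongly discriminantly separable with polynomial* $P\in\mathbb{C}[x]$ if $$\mathcal{D}_{x_i}F(x_j,x_k)=P(x_j)P(x_k)\qquad\text{for every cyclic permutation }(i,j,k)\text{ of }(1,2,3).$$ If $P\neq0$, then $\deg P\le 4$; the zeros of a nonzero $P$ with $\deg P\le4$ are counted on $\mathbb{CP}^1$ with total multiplicity four, $\infty$ being a zero of multiplicity $4-\deg P$. A matrix $M=\begin{pmatrix}a&b\\c&d\end{pmatrix}\in GL_2(\mathbb{C})$ acts on such $F$ and $P$ by the simultaneous fractional-linear substitution $x_i\mapsto\frac{ax_i+b}{cx_i+d}$, $i=1,2,3$, with denominators cleared: $$(M\cdot F)(x_1,x_2,x_3)=\prod_{i=1}^3(cx_i+d)^2\;F\Big(\tfrac{ax_1+b}{cx_1+d},\tfrac{ax_2+b}{cx_2+d},\tfrac{ax_3+b}{cx_3+d}\Big),\qquad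 (M\cdot P)(x)=(ad-bc)(cx+d)^4P\Big(\tfrac{ax+b}{cx+d}\Big).$$ If $F$ is strongly discriminantly separable with $P$, then $M\cdot F$ is strongly discriminantly separable with $M\cdot P$. Suppose that $F$ is strongly discriminantly separable with a nonzero polynomial $P$. Then $P$ has one of the five root structures (A)–(E) below, and in the respective case there are an $M\in GL_2(\mathbb{C})$ and parameters as indicated such that $M\cdot P=\pm P_\ast$ and $M\cdot F$ is one of the listed polynomials. (By its definition, $P$ is determined by $F$ only up to sign.) (A) $P$ has four simple zeros; $P_A(x)=(k^2x^2-1)(x^2-1)$, $k\in\mathbb{C}$, $k\ne0$, $k^2\neq1$; $$F_A=\tfrac12(-k^2x_1^2-k^2x_2^2+1+k^2x_1^2x_2^2)x_3^2+(1-k^2)x_1x_2x_3+\tfrac12(x_1^2+x_2^2-k^2x_1^2x_2^2-1).$$ (B) $P$ has two simple zeros and one double zero; $P_B(x)=x^2-e^2$, $e\in\mathbb{C}$, $e\neq0$; $$F_B=x_1x_2x_3+\tfrac e2(x_1^2+x_2^2+x_3^2-e^2).$$ (C) $P$ has two double zeros; $P_C(x)=x^2$; with $\lambda,\mu,\nu\in\mathbb{C}$,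 $\mu^2-4\lambda\nu=1$, one of $$F_{C_1}=\lambda x_1^2x_2^2+\mu x_1x_2x_3+\nu x_3^2,\qquad F_{C_2}=\lambda x_1^2x_3^2+\mu x_1x_2x_3+\nu x_2^2,$$ $$F_{C_3}=\lambda x_2^2x_3^2+\mu x_1x_2x_3+\nu x_1^2,\qquad F_{C_4}=\lambda x_1^2x_2^2x_3^2+\mu x_1x_2x_3+\nu.$$ (D) $P$ has one simple and one triple zero; $P_D(x)=x$; $$F_D=-\tfrac12(x_1x_2+x_2x_3+x_1x_3)+\tfrac14(x_1^2+x_2^2+x_3^2).$$ (E) $P$ has one quadruple zero; $P_E(x)=1$; with $\lambda,\mu,\nu\in\mathbb{C}$, $\mu^2-4\lambda\nu=1$, one of $$F_{E_1}=\lambda(x_1+x_2+x_3)^2+\mu(x_1+x_2+x_3)+\nu,\qquad F_{E_2}=\lambda(x_2+x_3-x_1)^2+\mu(x_2+x_3-x_1)+\nu,$$ $$F_{E_3}=\lambda(x_1+x_3-x_2)^2+\mu(x_1+x_3-x_2)+\nu,\qquad F_{E_4}=\lambda(x_1+x_2-x_3)^2+\mu(x_1+x_2-x_3)+\nu.$$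 Moreover, every nonzero $P$ of degree at most four with the root structure (A), …, (E) is carried by some $M\in GL_2(\mathbb{C})$ to the respective canonical form ($M\cdot P=P_\ast$, for some admissible value of $k$ or $e$ in the cases (A) and (B)). Conversely, each $P_\ast$ with admissible parameters has the stated root structure, and each listed polynomial is strongly discriminantly separable with the respective $P_\ast$. -/

import Mathlib

noncomputable section

namespace DiscSep

/-- Complex polynomials in three variables `x₁ = X 0`, `x₂ = X 1`, `x₃ = X 2`. -/
abbrev Poly3 : Type := MvPolynomial (Fin 3) ℂ

/-- `F` regarded as a polynomial in the single variable `xᵢ`, with coefficients that are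
polynomials in the other variables. -/
def asPolyIn (i : Fin 3) (F : Poly3) : Polynomial Poly3 :=
  MvPolynomial.aeval
    (fun j : Fin 3 => if j = i then Polynomial.X else Polynomial.C (MvPolynomial.X j : Poly3)) F

/-- The discriminant `b ^ 2 - 4 * a * c` of `F`, regarded as a quadratic polynomial
`a * xᵢ ^ 2 + b * xᵢ + c` in `xᵢ`. -/
def discrIn (i : Fin 3) (F : Poly3) : Poly3 :=
  discrim ((asPolyIn i F).coeff 2) ((asPolyIn i F).coeff 1) ((asPolyIn i F).coeff 0)

/-- The polynomial `P(xⱼ)` in three variables. -/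
def inVar (j : Fin 3) (P : Polynomial ℂ) : Poly3 :=
  Polynomial.aeval (MvPolynomial.X j : Poly3) P

/-- `F` has degree at most two in each variable and is strongly discriminantly separable with
polynomial `P`: for `(i, j, k)` a cyclic permutation of the three indices, the discriminant of
`F` in `xᵢ` is `P(xⱼ) * P(xₖ)`. -/
structure IsStronglySeparable (F : Poly3) (P : Polynomial ℂ) : Prop where
  degree_le : ∀ i : Fin 3, F.degreeOf i ≤ 2
  discr_eq : ∀ i : Fin 3, discrIn i F = inVar (i + 1) P * inVar (i + 2) P

/-- The fractional-linear substitution `xᵢ ↦ (a xᵢ + b) / (c xᵢ + d)`, `i = 1, 2, 3`, with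
`M = !![a, b; c, d]`, on polynomials of degree at most two in each variable:
`∏ᵢ (c xᵢ + d) ^ 2 * F ((a x₁ + b) / (c x₁ + d), …)`. -/
def mobius3 (M : GL (Fin 2) ℂ) (F : Poly3) : Poly3 :=
  ∑ s ∈ F.support, MvPolynomial.C (F.coeff s) * ∏ i : Fin 3,
    ((MvPolynomial.C (M 0 0) * MvPolynomial.X i + MvPolynomial.C (M 0 1)) ^ (s i) *
      (MvPolynomial.C (M 1 0) * MvPolynomial.X i + MvPolynomial.C (M 1 1)) ^ (2 - s i))

/-- The corresponding action on polynomials `P` of degree at most four in one variable: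
`(a d - b c) * (c x + d) ^ 4 * P ((a x + b) / (c x + d))`. The determinant is the factor by
which discriminants of quadratic polynomials are transformed (one for each factor `P`). -/
def mobius1 (M : GL (Fin 2) ℂ) (P : Polynomial ℂ) : Polynomial ℂ :=
  Polynomial.C (M 0 0 * M 1 1 - M 0 1 * M 1 0) *
    ∑ n ∈ P.support, Polynomial.C (P.coeff n) *
      ((Polynomial.C (M 0 0) * Polynomial.X + Polynomial.C (M 0 1)) ^ n *
        (Polynomial.C (M 1 0) * Polynomial.X + Polynomial.C (M 1 1)) ^ (4 - n))

open Classical in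
/-- The multiset of the multiplicities of the distinct zeros on the projective line of a nonzero
polynomial `P` of degree at most four, regarded as a binary form of degree four: the finite roots
with their multiplicities, and the point at infinity with multiplicity `4 - deg P` if this is
positive. -/
def rootStructure (P : Polynomial ℂ) : Multiset ℕ :=
  P.roots.toFinset.val.map (fun z => P.rootMultiplicity z) +
    (if P.natDegree < 4 then {4 - P.natDegree} else 0)

section Canonical

open Polynomial in
/-- `(k² x² - 1) (x² - 1)` -/
def PA (k : ℂ) : Polynomial ℂ := (C (k ^ 2) * X ^ 2 - 1) * (X ^ 2 - 1)

open Polynomial in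
/-- `x² - e²` -/
def PB (e : ℂ) : Polynomial ℂ := X ^ 2 - C (e ^ 2)

open Polynomial in
/-- `x²` -/
def PC : Polynomial ℂ := X ^ 2

open Polynomial in
/-- `x` -/
def PD : Polynomial ℂ := X

/-- `1` -/
def PE : Polynomial ℂ := 1

open MvPolynomial in
/-- The canonical polynomial of the case of four simple zeros. -/
def FA (k : ℂ) : Poly3 :=
  C (1 / 2) * (-C (k ^ 2) * X 0 ^ 2 - C (k ^ 2) * X 1 ^ 2 + 1 + C (k ^ 2) * X 0 ^ 2 * X 1 ^ 2)
      * X 2 ^ 2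
    + C (1 - k ^ 2) * X 0 * X 1 * X 2
    + C (1 / 2) * (X 0 ^ 2 + X 1 ^ 2 - C (k ^ 2) * X 0 ^ 2 * X 1 ^ 2 - 1)

open MvPolynomial in
/-- The canonical polynomial of the case of two simple zeros and one double zero. -/
def FB (e : ℂ) : Poly3 :=
  X 0 * X 1 * X 2 + C (e / 2) * (X 0 ^ 2 + X 1 ^ 2 + X 2 ^ 2 - C (e ^ 2))

open MvPolynomial in
/-- The first family of the case of two double zeros. -/
def FC1 (l m n : ℂ) : Poly3 :=
  C l * X 0 ^ 2 * X 1 ^ 2 + C m * X 0 * X 1 * X 2 + C n * X 2 ^ 2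

open MvPolynomial in
/-- The second family of the case of two double zeros. -/
def FC2 (l m n : ℂ) : Poly3 :=
  C l * X 0 ^ 2 * X 2 ^ 2 + C m * X 0 * X 1 * X 2 + C n * X 1 ^ 2

open MvPolynomial in
/-- The third family of the case of two double zeros. -/
def FC3 (l m n : ℂ) : Poly3 :=
  C l * X 1 ^ 2 * X 2 ^ 2 + C m * X 0 * X 1 * X 2 + C n * X 0 ^ 2

open MvPolynomial in
/-- The fourth family of the case of two double zeros. -/
def FC4 (l m n : ℂ) : Poly3 :=
  C l * X 0 ^ 2 * X 1 ^ 2 * X 2 ^ 2 + C m * X 0 * X 1 * X 2 + C n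

open MvPolynomial in
/-- The canonical polynomial of the case of one simple and one triple zero. -/
def FD : Poly3 :=
  -C (1 / 2) * (X 0 * X 1 + X 1 * X 2 + X 0 * X 2) + C (1 / 4) * (X 0 ^ 2 + X 1 ^ 2 + X 2 ^ 2)

open MvPolynomial in
/-- The first family of the case of a quadruple zero. -/
def FE1 (l m n : ℂ) : Poly3 :=
  C l * (X 0 + X 1 + X 2) ^ 2 + C m * (X 0 + X 1 + X 2) + C n

open MvPolynomial in
/-- The second family of the case of a quadruple zero. -/
def FE2 (l m n : ℂ) : Poly3 :=
  C l * (X 1 + X 2 - X 0) ^ 2 + C m * (X 1 + X 2 - X 0) + C n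

open MvPolynomial in
/-- The third family of the case of a quadruple zero. -/
def FE3 (l m n : ℂ) : Poly3 :=
  C l * (X 0 + X 2 - X 1) ^ 2 + C m * (X 0 + X 2 - X 1) + C n

open MvPolynomial in
/-- The fourth family of the case of a quadruple zero. -/
def FE4 (l m n : ℂ) : Poly3 :=
  C l * (X 0 + X 1 - X 2) ^ 2 + C m * (X 0 + X 1 - X 2) + C n

end Canonical

/-- The fractional-linear transformation `M` carries `F` to `G` and `P` to `Q`, where `P` and `Q`
matter only up to sign (the discriminants of `F` determine `P` only up to sign). -/
def Carries (M : GL (Fin 2) ℂ) (F : Poly3) (P : Polynomial ℂ) (G : Poly3) (Q : Polynomial ℂ) :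
    Prop :=
  mobius3 M F = G ∧ (mobius1 M P = Q ∨ mobius1 M P = -Q)

end DiscSep

end

/-! ### Coefficient arrays, evaluation, and the fractional-linear action. -/

noncomputable section
namespace DiscSep

/-! Write F = A x² + B x + C with A, B, C biquadratic in y, z. F becomes an array of 27 coefficients
(`triq`) and separability (`Sep`) a system of coefficient equations (`DiscrCoeffs`). The
discriminants in y and z, expanded in x, restrict A: the x⁴-coefficient says that the discriminants
of A are p₄P, the x³-coefficient that the polarised discriminants of A and B are p₃P. Hence, once a
zero of P lies at ∞, both discriminants of A vanish and A is a square (αyz + βy + γz + δ)²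
(`Sep.top_sq`).

If ∞ is a multiple zero of P, then p₃ = 0 as well, so B vanishes along the zero of A and the square
of that zero divides P(y)P(z) (`Sep.double_zero_of_top_sq`). When P has no finite double zero, A is
therefore constant (`Sep.top_eq_zero`). If the constant is nonzero, completing the square leaves a
few parameters (`Sep.exists_of_top_const`); if it is zero, P is a square
(`Sep.sq_eq_of_top_eq_zero`). For P = x² the coefficient A is zero or a multiple of 1, y², z² or
y²z², which leads to the four families (`Sep.isTwoDouble`).

If all zeros are simple, one of them is moved to ∞ and P becomes a cubic. F then vanishes at some
(r, r, r) with r a zero of P, possibly ∞ (`Sep.exists_diagonal_zero`). When r = ∞, the leading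
coefficient in each variable is a multiple of the squared difference of the other two
(`eq_diagonal_sq`), and the other coefficients can be solved for one after another: F is ±
`cubicForm` (`Sep.eq_cubicForm`). Thus P and r determine F up to sign. Since F_A vanishes at (-1,
-1, -1), it suffices to find M that carries -1 to r and P to some P_A (`exists_mobius1_eq_PA`,
`eq_FA_of_diagonal_zero`).

A scalar matrix t multiplies both F and P by t⁶; this normalises constants in P, and t = i removes
signs of F. -/

theorem quartic_coeffs_eq_zero {a4 a3 a2 a1 a0 : ℂ}
    (h : ∀ x : ℂ, a4 * x ^ 4 + a3 * x ^ 3 + a2 * x ^ 2 + a1 * x + a0 = 0) :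
    a4 = 0 ∧ a3 = 0 ∧ a2 = 0 ∧ a1 = 0 ∧ a0 = 0 := by
  -- Five values determine a quartic; the rational weights below invert the Vandermonde matrix of
  -- the nodes 0, ±1, ±2.
  have h0 := h 0
  have h1 := h 1
  have h2 := h (-1)
  have h3 := h 2
  have h4 := h (-2)
  refine ⟨?_, ?_, ?_, ?_, ?_⟩
  · linear_combination (1/24) * (h3 + h4) - (1/6) * (h1 + h2) + (1/4) * h0
  · linear_combination (1/12) * (h3 - h4) - (1/6) * (h1 - h2)
  · linear_combination (-1/24) * (h3 + h4) + (2/3) * (h1 + h2) - (5/4) * h0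
  · linear_combination (-1/12) * (h3 - h4) + (2/3) * (h1 - h2)
  · linear_combination h0

theorem quadratic_coeffs_eq_zero {a2 a1 a0 : ℂ}
    (h : ∀ x : ℂ, a2 * x ^ 2 + a1 * x + a0 = 0) : a2 = 0 ∧ a1 = 0 ∧ a0 = 0 := by
  obtain ⟨-, -, h2, h1, h0⟩ := quartic_coeffs_eq_zero (a4 := 0) (a3 := 0) (a2 := a2) (a1 := a1)
    (a0 := a0) (fun x => by linear_combination h x)
  exact ⟨h2, h1, h0⟩

theorem infinite_setOf_eval_ne_zero {q : Polynomial ℂ} (hq : q ≠ 0) :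
    {t : ℂ | q.eval t ≠ 0}.Infinite := by
  have h : {t : ℂ | q.eval t = 0}.Finite := by
    refine q.roots.toFinset.finite_toSet.subset fun t ht => ?_
    simpa [hq] using ht
  exact h.infinite_compl

/-- A product of infinite sets is Zariski dense, so identities between cleared fractions need
checking only where the denominators, collected in `q`, are nonzero. -/
theorem mvPolynomial_ext_of_generic {q : Polynomial ℂ} (hq : q ≠ 0) {G H : Poly3}
    (h : ∀ v : Fin 3 → ℂ, (∀ i, q.eval (v i) ≠ 0) → MvPolynomial.eval v G = MvPolynomial.eval v H) :
    G = H :=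
  MvPolynomial.funext_set (fun _ => {t : ℂ | q.eval t ≠ 0})
    (fun _ => infinite_setOf_eval_ne_zero hq) fun v hv => h v fun i => hv i trivial

theorem polynomial_ext_of_generic {q : Polynomial ℂ} (hq : q ≠ 0) {G H : Polynomial ℂ}
    (h : ∀ t : ℂ, q.eval t ≠ 0 → G.eval t = H.eval t) : G = H :=
  Polynomial.eq_of_infinite_eval_eq G H
    ((infinite_setOf_eval_ne_zero hq).mono fun t ht => h t ht)

open Polynomial in
theorem quadratic_coeffs_eq_of_generic {q : Polynomial ℂ} (hq : q ≠ 0) {a b c a' b' c' : ℂ}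
    (h : ∀ t : ℂ, q.eval t ≠ 0 → a * t ^ 2 + b * t + c = a' * t ^ 2 + b' * t + c') :
    a = a' ∧ b = b' ∧ c = c' := by
  have key : C a * X ^ 2 + C b * X + C c = C a' * X ^ 2 + C b' * X + C c' :=
    polynomial_ext_of_generic hq fun t ht => by simpa using h t ht
  refine ⟨?_, ?_, ?_⟩
  · simpa [coeff_X, coeff_C] using congrArg (fun p => coeff p 2) key
  · simpa [coeff_X, coeff_C] using congrArg (fun p => coeff p 1) key
  · simpa [coeff_X, coeff_C] using congrArg (fun p => coeff p 0) key

/-- A polynomial in two variables of degree at most two in each, with given coefficients. -/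
def biq (g : Fin 3 → Fin 3 → ℂ) (y z : ℂ) : ℂ :=
  (g 2 2 * z ^ 2 + g 2 1 * z + g 2 0) * y ^ 2 + (g 1 2 * z ^ 2 + g 1 1 * z + g 1 0) * y
    + (g 0 2 * z ^ 2 + g 0 1 * z + g 0 0)

/-- A polynomial in three variables of degree at most two in each, with given coefficients. -/
def triq (f : Fin 3 → Fin 3 → Fin 3 → ℂ) (x y z : ℂ) : ℂ :=
  biq (f 2) y z * x ^ 2 + biq (f 1) y z * x + biq (f 0) y z

theorem exists_triq_of_degreeOf_le {F : Poly3} (hF : ∀ i, F.degreeOf i ≤ 2) :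
    ∃ f, ∀ v : Fin 3 → ℂ, MvPolynomial.eval v F = triq f (v 0) (v 1) (v 2) := by
  rw [F.as_sum]
  refine Finset.sum_induction _ (fun G : Poly3 =>
    ∃ f, ∀ v : Fin 3 → ℂ, MvPolynomial.eval v G = triq f (v 0) (v 1) (v 2)) ?_ ?_ ?_
  · rintro G H ⟨f, hf⟩ ⟨g, hg⟩
    refine ⟨fun i j k => f i j k + g i j k, fun v => ?_⟩
    rw [map_add, hf, hg]
    simp only [triq, biq]
    ring
  · exact ⟨fun _ _ _ => 0, fun v => by simp [triq, biq]⟩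
  · intro s hs
    have hpow : ∀ m ≤ 2, ∃ e : Fin 3 → ℂ, ∀ t : ℂ, t ^ m = e 2 * t ^ 2 + e 1 * t + e 0 := by
      intro m hm
      interval_cases m
      · exact ⟨![1, 0, 0], fun t => by simp⟩
      · exact ⟨![0, 1, 0], fun t => by simp⟩
      · exact ⟨![0, 0, 1], fun t => by simp⟩
    have hle : ∀ i, s i ≤ 2 := fun i => (MvPolynomial.monomial_le_degreeOf i hs).trans (hF i)
    obtain ⟨e0, h0⟩ := hpow _ (hle 0)
    obtain ⟨e1, h1⟩ := hpow _ (hle 1)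
    obtain ⟨e2, h2⟩ := hpow _ (hle 2)
    refine ⟨fun i j k => F.coeff s * e0 i * e1 j * e2 k, fun v => ?_⟩
    rw [MvPolynomial.eval_monomial, Finsupp.prod_fintype _ _ (by simp), Fin.prod_univ_three,
      h0, h1, h2]
    simp only [triq, biq]
    ring

open MvPolynomial in
theorem degreeOf_le_of_eval_eq_triq {F : Poly3} {f : Fin 3 → Fin 3 → Fin 3 → ℂ}
    (h : ∀ v : Fin 3 → ℂ, eval v F = triq f (v 0) (v 1) (v 2)) (i : Fin 3) :
    F.degreeOf i ≤ 2 := by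
  have hF : F = ∑ a : Fin 3, ∑ b : Fin 3, ∑ c : Fin 3,
      C (f a b c) * (X 0 ^ (a : ℕ) * X 1 ^ (b : ℕ) * X 2 ^ (c : ℕ)) := by
    refine MvPolynomial.funext fun v => ?_
    rw [h]
    simp only [triq, biq, Fin.sum_univ_three, map_add, map_mul, map_pow, eval_C, eval_X,
      Fin.val_zero, Fin.val_one, Fin.val_two]
    ring
  rw [hF]
  refine (degreeOf_sum_le _ _ _).trans (Finset.sup_le fun a _ => ?_)
  refine (degreeOf_sum_le _ _ _).trans (Finset.sup_le fun b _ => ?_)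
  refine (degreeOf_sum_le _ _ _).trans (Finset.sup_le fun c _ => ?_)
  refine (degreeOf_C_mul_le _ _ _).trans ?_
  refine (degreeOf_mul_le _ _ _).trans ((add_le_add (degreeOf_mul_le _ _ _) le_rfl).trans ?_)
  have hp : ∀ (j : Fin 3) (m : ℕ), degreeOf i (X j ^ m : Poly3) = if i = j then m else 0 := by
    intro j m
    split_ifs with hij
    · subst hij; simp
    · exact degreeOf_X_pow_of_ne m hij
  rw [hp, hp, hp]
  fin_cases i <;> simp <;> omega

theorem eval_asPolyIn (F : Poly3) (i : Fin 3) (v : Fin 3 → ℂ) (t : ℂ) :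
    ((asPolyIn i F).map (MvPolynomial.eval v)).eval t
      = MvPolynomial.eval (Function.update v i t) F := by
  unfold asPolyIn
  induction F using MvPolynomial.induction_on with
  | C a =>
    rw [MvPolynomial.aeval_C, MvPolynomial.eval_C]
    simp [Polynomial.algebraMap_apply, MvPolynomial.algebraMap_eq]
  | add p q hp hq => rw [map_add, Polynomial.map_add, Polynomial.eval_add, hp, hq, map_add]
  | mul_X p j hp =>
    rw [map_mul, Polynomial.map_mul, Polynomial.eval_mul, hp, map_mul, MvPolynomial.aeval_X,
      MvPolynomial.eval_X]
    congr 1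
    by_cases hj : j = i
    · subst hj; simp
    · simp [hj]

/-- Values on a line parallel to an axis determine the coefficients there, so discriminants can be
computed from values without touching `asPolyIn`. -/
theorem eval_discrIn {F : Poly3} {i : Fin 3} {v : Fin 3 → ℂ} {a b c : ℂ}
    (h : ∀ t : ℂ, MvPolynomial.eval (Function.update v i t) F = a * t ^ 2 + b * t + c) :
    MvPolynomial.eval v (discrIn i F) = b ^ 2 - 4 * a * c := by
  have key : (asPolyIn i F).map (MvPolynomial.eval v) =
      Polynomial.C a * Polynomial.X ^ 2 + Polynomial.C b * Polynomial.X + Polynomial.C c :=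
    Polynomial.funext fun t => by rw [eval_asPolyIn, h]; simp
  have hc : ∀ n, MvPolynomial.eval v ((asPolyIn i F).coeff n) =
      (Polynomial.C a * Polynomial.X ^ 2 + Polynomial.C b * Polynomial.X
        + Polynomial.C c).coeff n := fun n => by
    rw [← key, Polynomial.coeff_map]
  unfold discrIn discrim
  simp only [map_sub, map_mul, map_pow, hc, map_ofNat]
  simp [Polynomial.coeff_X, Polynomial.coeff_C]

theorem eval_inVar (P : Polynomial ℂ) (j : Fin 3) (v : Fin 3 → ℂ) :
    MvPolynomial.eval v (inVar j P) = P.eval (v j) := by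
  unfold inVar
  rw [Polynomial.aeval_def, Polynomial.hom_eval₂]
  have hid : (MvPolynomial.eval v).comp (algebraMap ℂ Poly3) = RingHom.id ℂ := by ext; simp
  rw [hid, Polynomial.eval₂_id, MvPolynomial.eval_X]

/-- Strong discriminant separability in terms of coefficients. -/
structure Sep (f : Fin 3 → Fin 3 → Fin 3 → ℂ) (P : ℂ → ℂ) : Prop where
  discr_x : ∀ y z, biq (f 1) y z ^ 2 - 4 * biq (f 2) y z * biq (f 0) y z = P y * P z
  discr_y : ∀ x z, biq (fun i k => f i 1 k) x z ^ 2
    - 4 * biq (fun i k => f i 2 k) x z * biq (fun i k => f i 0 k) x z = P x * P z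
  discr_z : ∀ x y, biq (fun i j => f i j 1) x y ^ 2
    - 4 * biq (fun i j => f i j 2) x y * biq (fun i j => f i j 0) x y = P x * P y

/-- The bridge from polynomials to coefficient arrays. For i = 1 the indices i + 1, i + 2 run
through z, x in this order, which accounts for the commuted products. -/
theorem isStronglySeparable_iff {F : Poly3} {f : Fin 3 → Fin 3 → Fin 3 → ℂ}
    (h : ∀ v : Fin 3 → ℂ, MvPolynomial.eval v F = triq f (v 0) (v 1) (v 2)) (P : Polynomial ℂ) :
    IsStronglySeparable F P ↔ Sep f (fun t => P.eval t) := by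
  have h0 : ∀ v, MvPolynomial.eval v (discrIn 0 F) = biq (f 1) (v 1) (v 2) ^ 2
      - 4 * biq (f 2) (v 1) (v 2) * biq (f 0) (v 1) (v 2) := fun v =>
    eval_discrIn fun t => by rw [h]; simp [triq]
  have h1 : ∀ v, MvPolynomial.eval v (discrIn 1 F) = biq (fun i k => f i 1 k) (v 0) (v 2) ^ 2
      - 4 * biq (fun i k => f i 2 k) (v 0) (v 2) * biq (fun i k => f i 0 k) (v 0) (v 2) :=
    fun v => eval_discrIn fun t => by rw [h]; simp [triq, biq]; ring
  have h2 : ∀ v, MvPolynomial.eval v (discrIn 2 F) = biq (fun i j => f i j 1) (v 0) (v 1) ^ 2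
      - 4 * biq (fun i j => f i j 2) (v 0) (v 1) * biq (fun i j => f i j 0) (v 0) (v 1) :=
    fun v => eval_discrIn fun t => by rw [h]; simp [triq, biq]; ring
  constructor
  · intro hs
    refine ⟨fun y z => ?_, fun x z => ?_, fun x y => ?_⟩
    · have := congrArg (MvPolynomial.eval ![0, y, z]) (hs.discr_eq 0)
      rw [h0, map_mul, eval_inVar, eval_inVar] at this
      simpa using this
    · have := congrArg (MvPolynomial.eval ![x, 0, z]) (hs.discr_eq 1)
      rw [h1, map_mul, eval_inVar, eval_inVar] at this
      rw [mul_comm (P.eval x)]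
      simpa using this
    · have := congrArg (MvPolynomial.eval ![x, y, 0]) (hs.discr_eq 2)
      rw [h2, map_mul, eval_inVar, eval_inVar] at this
      simpa using this
  · intro hs
    refine ⟨degreeOf_le_of_eval_eq_triq h, fun i => MvPolynomial.funext fun v => ?_⟩
    rw [map_mul, eval_inVar, eval_inVar]
    fin_cases i
    · exact (h0 v).trans (hs.discr_x _ _)
    · exact (h1 v).trans ((hs.discr_y _ _).trans (mul_comm _ _))
    · exact (h2 v).trans (hs.discr_z _ _)

/-- The condition is symmetric in the variables, and this transposition and `Sep.swap_yz` generate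
all permutations; statements about the leading coefficient in x thereby transfer to y and z. -/
theorem Sep.swap_xy {f : Fin 3 → Fin 3 → Fin 3 → ℂ} {P : ℂ → ℂ} (h : Sep f P) :
    Sep (fun i j k => f j i k) P where
  discr_x := h.discr_y
  discr_y := h.discr_x
  discr_z x y := by
    have := h.discr_z y x
    simp only [biq] at this ⊢
    linear_combination this

theorem Sep.swap_yz {f : Fin 3 → Fin 3 → Fin 3 → ℂ} {P : ℂ → ℂ} (h : Sep f P) :
    Sep (fun i j k => f i k j) P where
  discr_x y z := by
    have := h.discr_x z y
    simp only [biq] at this ⊢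
    linear_combination this
  discr_y := h.discr_z
  discr_z := h.discr_y

open Polynomial in
/-- A strong discriminant is a polynomial of degree at most four. -/
theorem Sep.natDegree_le {f : Fin 3 → Fin 3 → Fin 3 → ℂ} {P : Polynomial ℂ}
    (h : Sep f (fun t => P.eval t)) : P.natDegree ≤ 4 := by
  rcases eq_or_ne P 0 with rfl | hP
  · simp
  -- With z frozen where P(z) ≠ 0, the polynomial P(z)·P is B² - 4AC with A, B, C quadratic in y.
  obtain ⟨z, hz⟩ := (infinite_setOf_eval_ne_zero hP).nonempty
  have hz : P.eval z ≠ 0 := hz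
  let q : Fin 3 → Polynomial ℂ := fun i =>
    C (f i 2 2 * z ^ 2 + f i 2 1 * z + f i 2 0) * X ^ 2
      + C (f i 1 2 * z ^ 2 + f i 1 1 * z + f i 1 0) * X
      + C (f i 0 2 * z ^ 2 + f i 0 1 * z + f i 0 0)
  have hq : ∀ i, (q i).natDegree ≤ 2 := fun i => natDegree_quadratic_le
  have key : C (P.eval z) * P = q 1 ^ 2 - C 4 * (q 2 * q 0) := by
    refine Polynomial.funext fun y => ?_
    have := h.discr_x y z
    simp only [biq] at this
    simp only [q, eval_mul, eval_C, eval_sub, eval_add, eval_pow, eval_X]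
    linear_combination -this
  rw [← natDegree_C_mul hz, key]
  refine (natDegree_sub_le _ _).trans (max_le ?_ ?_)
  · refine natDegree_pow_le.trans ?_
    have := hq 1
    omega
  · refine (natDegree_C_mul_le _ _).trans (natDegree_mul_le.trans ?_)
    have := hq 2
    have := hq 0
    omega

/-! Fractional-linear transformations -/

/-- The denominator `c x + d`. -/
def den (M : GL (Fin 2) ℂ) : Polynomial ℂ :=
  Polynomial.C (M 1 0) * Polynomial.X + Polynomial.C (M 1 1)

theorem det_ne_zero (M : GL (Fin 2) ℂ) : M 0 0 * M 1 1 - M 0 1 * M 1 0 ≠ 0 := by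
  have h := M.det.ne_zero
  rwa [Matrix.GeneralLinearGroup.val_det_apply, Matrix.det_fin_two] at h

theorem eval_den (M : GL (Fin 2) ℂ) (t : ℂ) : (den M).eval t = M 1 0 * t + M 1 1 := by
  simp [den]

theorem den_ne_zero (M : GL (Fin 2) ℂ) : den M ≠ 0 := by
  intro h
  have h0 := congrArg (Polynomial.eval 0) h
  have h1 := congrArg (Polynomial.eval 1) h
  rw [eval_den] at h0 h1
  simp only [Polynomial.eval_zero, mul_zero, zero_add, mul_one] at h0 h1
  apply det_ne_zero M
  rw [h0, add_zero] at h1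
  rw [h0, h1]
  ring

/-- The fractional-linear map `t ↦ (a t + b) / (c t + d)`. -/
def moebius (M : GL (Fin 2) ℂ) (t : ℂ) : ℂ := (M 0 0 * t + M 0 1) / (M 1 0 * t + M 1 1)

/-- The degree bound is what makes the truncated exponent `2 - s i` a true difference, so that the
cleared sum is the substitution itself. -/
theorem eval_mobius3 {F : Poly3} (hF : ∀ i, F.degreeOf i ≤ 2) (M : GL (Fin 2) ℂ) {v : Fin 3 → ℂ}
    (hv : ∀ i, (den M).eval (v i) ≠ 0) :
    MvPolynomial.eval v (mobius3 M F) =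
      (∏ i, (den M).eval (v i)) ^ 2 * MvPolynomial.eval (fun i => moebius M (v i)) F := by
  have hfac : ∀ (i : Fin 3), ∀ m ≤ 2, (M 0 0 * v i + M 0 1) ^ m * (M 1 0 * v i + M 1 1) ^ (2 - m) =
      (den M).eval (v i) ^ 2 * moebius M (v i) ^ m := by
    intro i m hm
    have := hv i
    rw [eval_den] at this ⊢
    rw [moebius, div_pow, pow_sub₀ _ this hm]
    field_simp
  rw [mobius3, map_sum, MvPolynomial.eval_eq', Finset.mul_sum]
  refine Finset.sum_congr rfl fun s hs => ?_
  have hle : ∀ i, s i ≤ 2 := fun i => (MvPolynomial.monomial_le_degreeOf i hs).trans (hF i)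
  rw [map_mul, MvPolynomial.eval_C, map_prod]
  simp only [map_mul, map_pow, map_add, MvPolynomial.eval_C, MvPolynomial.eval_X]
  rw [Finset.prod_congr rfl fun i _ => hfac i (s i) (hle i), Finset.prod_mul_distrib,
    Finset.prod_pow]
  ring

theorem eval_mobius1 {P : Polynomial ℂ} (hP : P.natDegree ≤ 4) (M : GL (Fin 2) ℂ) {t : ℂ}
    (ht : (den M).eval t ≠ 0) :
    (mobius1 M P).eval t = (M 0 0 * M 1 1 - M 0 1 * M 1 0) * (den M).eval t ^ 4
      * P.eval (moebius M t) := by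
  rw [mobius1, Polynomial.eval_mul, Polynomial.eval_C, Polynomial.eval_finsetSum,
    Polynomial.eval_eq_sum (p := P), Polynomial.sum, mul_assoc]
  congr 1
  rw [Finset.mul_sum]
  refine Finset.sum_congr rfl fun n hn => ?_
  have hn4 : n ≤ 4 := (Polynomial.le_natDegree_of_mem_supp n hn).trans hP
  rw [eval_den] at ht ⊢
  simp only [Polynomial.eval_mul, Polynomial.eval_pow, Polynomial.eval_add, Polynomial.eval_C,
    Polynomial.eval_X]
  rw [moebius, div_pow, pow_sub₀ _ ht hn4]
  field_simp

open MvPolynomial in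
theorem degreeOf_mobius3_le {F : Poly3} (hF : ∀ i, F.degreeOf i ≤ 2) (M : GL (Fin 2) ℂ)
    (i : Fin 3) : (mobius3 M F).degreeOf i ≤ 2 := by
  refine (degreeOf_sum_le _ _ _).trans (Finset.sup_le fun s hs => ?_)
  have hle : s i ≤ 2 := (MvPolynomial.monomial_le_degreeOf i hs).trans (hF i)
  refine (degreeOf_C_mul_le _ _ _).trans ((degreeOf_prod_le _ _ _).trans ?_)
  have hlin : ∀ (a b : ℂ) (j : Fin 3), degreeOf i (C a * X j + C b) ≤ if i = j then 1 else 0 := by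
    intro a b j
    refine (degreeOf_add_le _ _ _).trans (max_le ?_ (by simp))
    refine (degreeOf_C_mul_le _ _ _).trans ?_
    rw [degreeOf_X]
  have hj : ∀ j : Fin 3, degreeOf i ((C (M 0 0) * X j + C (M 0 1)) ^ (s j) *
      (C (M 1 0) * X j + C (M 1 1)) ^ (2 - s j)) ≤ if i = j then 2 else 0 := by
    intro j
    refine (degreeOf_mul_le _ _ _).trans ((add_le_add (degreeOf_pow_le _ _ _)
      (degreeOf_pow_le _ _ _)).trans ((add_le_add (Nat.mul_le_mul_left _ (hlin _ _ _))
      (Nat.mul_le_mul_left _ (hlin _ _ _))).trans ?_))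
    split_ifs with hij
    · subst hij; omega
    · simp
  refine (Finset.sum_le_sum fun j _ => hj j).trans ?_
  simp

open Polynomial in
theorem natDegree_mobius1_le {P : Polynomial ℂ} (hP : P.natDegree ≤ 4) (M : GL (Fin 2) ℂ) :
    (mobius1 M P).natDegree ≤ 4 := by
  refine (natDegree_C_mul_le _ _).trans (natDegree_sum_le_of_forall_le _ _ fun n hn => ?_)
  have hn4 : n ≤ 4 := (le_natDegree_of_mem_supp n hn).trans hP
  refine (natDegree_C_mul_le _ _).trans (natDegree_mul_le.trans ?_)
  have h1 := natDegree_pow_le_of_le n (natDegree_linear_le (a := M 0 0) (b := M 0 1))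
  have h2 := natDegree_pow_le_of_le (4 - n) (natDegree_linear_le (a := M 1 0) (b := M 1 1))
  omega

theorem mul_entries (M N : GL (Fin 2) ℂ) (i j : Fin 2) :
    (M * N) i j = M i 0 * N 0 j + M i 1 * N 1 j := by
  rw [Matrix.GeneralLinearGroup.coe_mul, Matrix.mul_apply, Fin.sum_univ_two]

theorem eval_den_mul (M N : GL (Fin 2) ℂ) {t : ℂ} (ht : (den N).eval t ≠ 0) :
    (den (M * N)).eval t = (den N).eval t * (den M).eval (moebius N t) := by
  simp only [eval_den, moebius, mul_entries] at *
  field_simp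
  ring

theorem moebius_mul (M N : GL (Fin 2) ℂ) {t : ℂ} (ht : (den N).eval t ≠ 0)
    (ht' : (den (M * N)).eval t ≠ 0) : moebius (M * N) t = moebius M (moebius N t) := by
  have h := ht'
  rw [eval_den_mul _ _ ht] at h
  have h2 := right_ne_zero_of_mul h
  simp only [eval_den, moebius, mul_entries] at *
  rw [div_eq_div_iff ht' h2]
  field_simp
  ring

/-- Substitution acts from the right: the later matrix is the right factor. -/
theorem mobius3_mobius3 {F : Poly3} (hF : ∀ i, F.degreeOf i ≤ 2) (M N : GL (Fin 2) ℂ) :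
    mobius3 N (mobius3 M F) = mobius3 (M * N) F := by
  refine mvPolynomial_ext_of_generic (mul_ne_zero (den_ne_zero N) (den_ne_zero (M * N)))
    fun v hv => ?_
  simp only [Polynomial.eval_mul, mul_ne_zero_iff] at hv
  have hv1 : ∀ i, (den N).eval (v i) ≠ 0 := fun i => (hv i).1
  have hv2 : ∀ i, (den M).eval (moebius N (v i)) ≠ 0 := fun i => by
    have := (hv i).2
    rw [eval_den_mul _ _ (hv1 i)] at this
    exact right_ne_zero_of_mul this
  rw [eval_mobius3 (degreeOf_mobius3_le hF M) N hv1, eval_mobius3 hF M hv2,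
    eval_mobius3 hF (M * N) fun i => (hv i).2,
    Finset.prod_congr rfl fun i _ => eval_den_mul M N (hv1 i), Finset.prod_mul_distrib]
  simp only [moebius_mul M N (hv1 _) (hv _).2]
  ring

theorem mobius1_mobius1 {P : Polynomial ℂ} (hP : P.natDegree ≤ 4) (M N : GL (Fin 2) ℂ) :
    mobius1 N (mobius1 M P) = mobius1 (M * N) P := by
  refine polynomial_ext_of_generic (mul_ne_zero (den_ne_zero N) (den_ne_zero (M * N)))
    fun t ht => ?_
  simp only [Polynomial.eval_mul, mul_ne_zero_iff] at ht
  have h2 : (den M).eval (moebius N t) ≠ 0 := by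
    have := ht.2
    rw [eval_den_mul _ _ ht.1] at this
    exact right_ne_zero_of_mul this
  rw [eval_mobius1 (natDegree_mobius1_le hP M) N ht.1, eval_mobius1 hP M h2,
    eval_mobius1 hP (M * N) ht.2, eval_den_mul _ _ ht.1, moebius_mul M N ht.1 ht.2]
  simp only [mul_entries]
  ring

/-- In the variable xᵢ the action is a linear change of a binary quadratic form, which multiplies
the discriminant by det²: one determinant for each factor P. The other two variables only contribute
their denominators, as K² in F and K⁴ in the discriminant. -/
theorem sep_mobius {F : Poly3} {P : Polynomial ℂ} (h : IsStronglySeparable F P)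
    (M : GL (Fin 2) ℂ) : IsStronglySeparable (mobius3 M F) (mobius1 M P) := by
  obtain ⟨f, hf⟩ := exists_triq_of_degreeOf_le h.degree_le
  have hdeg := ((isStronglySeparable_iff hf P).1 h).natDegree_le
  refine ⟨degreeOf_mobius3_le h.degree_le M, fun i => ?_⟩
  refine mvPolynomial_ext_of_generic (den_ne_zero M) fun v hv => ?_
  have hquad : ∀ (G : Poly3), (∀ i, G.degreeOf i ≤ 2) → ∀ w : Fin 3 → ℂ, ∃ a b c : ℂ, ∀ t,
      MvPolynomial.eval (Function.update w i t) G = a * t ^ 2 + b * t + c := by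
    intro G hG w
    obtain ⟨g, hg⟩ := exists_triq_of_degreeOf_le hG
    fin_cases i
    · exact ⟨_, _, _, fun t => by rw [hg]; simp [triq]; rfl⟩
    · refine ⟨biq (fun i k => g i 2 k) (w 0) (w 2), biq (fun i k => g i 1 k) (w 0) (w 2),
        biq (fun i k => g i 0 k) (w 0) (w 2), fun t => ?_⟩
      rw [hg]; simp [triq, biq]; ring
    · refine ⟨biq (fun i k => g i k 2) (w 0) (w 1), biq (fun i k => g i k 1) (w 0) (w 1),
        biq (fun i k => g i k 0) (w 0) (w 1), fun t => ?_⟩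
      rw [hg]; simp [triq, biq]; ring
  obtain ⟨a, b, c, habc⟩ := hquad F h.degree_le fun j => moebius M (v j)
  obtain ⟨a', b', c', habc'⟩ := hquad _ (degreeOf_mobius3_le h.degree_le M) v
  set K : ℂ := (den M).eval (v (i + 1)) * (den M).eval (v (i + 2)) with hK
  have hprod : ∀ t, ∏ j, (den M).eval (Function.update v i t j) = (den M).eval t * K := by
    intro t
    rw [Fin.prod_univ_three]
    fin_cases i <;> simp [hK] <;> ring
  have hco : ∀ t, (den M).eval t ≠ 0 → a' * t ^ 2 + b' * t + c' =
      (K ^ 2 * (a * M 0 0 ^ 2 + b * M 0 0 * M 1 0 + c * M 1 0 ^ 2)) * t ^ 2 +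
      (K ^ 2 * (2 * a * M 0 0 * M 0 1 + b * (M 0 0 * M 1 1 + M 0 1 * M 1 0)
        + 2 * c * M 1 0 * M 1 1)) * t +
      (K ^ 2 * (a * M 0 1 ^ 2 + b * M 0 1 * M 1 1 + c * M 1 1 ^ 2)) := by
    intro t ht
    have hv' : ∀ j, (den M).eval (Function.update v i t j) ≠ 0 := by
      intro j
      by_cases hj : j = i
      · subst hj; simpa using ht
      · simpa [hj] using hv j
    have e : (fun j => moebius M (Function.update v i t j)) =
        Function.update (fun j => moebius M (v j)) i (moebius M t) := by
      funext j
      by_cases hj : j = i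
      · subst hj; simp
      · simp [hj]
    rw [← habc', eval_mobius3 h.degree_le M hv', e, habc, hprod, moebius]
    rw [eval_den] at ht ⊢
    field_simp
    ring
  obtain ⟨ha, hb, hc⟩ := quadratic_coeffs_eq_of_generic (den_ne_zero M) hco
  have hD := congrArg (MvPolynomial.eval fun j => moebius M (v j)) (h.discr_eq i)
  rw [eval_discrIn habc, map_mul, eval_inVar, eval_inVar] at hD
  rw [eval_discrIn habc', map_mul, eval_inVar, eval_inVar, eval_mobius1 hdeg M (hv _),
    eval_mobius1 hdeg M (hv _), ha, hb, hc]
  linear_combination (M 0 0 * M 1 1 - M 0 1 * M 1 0) ^ 2 * K ^ 4 * hD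

end DiscSep
end

/-! ### Coefficient equations and perfect squares. -/

noncomputable section
namespace DiscSep

/-- The coefficients in `B ^ 2 - 4 * A * C = P(y) * P(z)` for biquadratic `A`, `B`, `C` and
a quartic `P`. -/
structure DiscrCoeffs (A B C : Fin 3 → Fin 3 → ℂ) (p : Fin 5 → ℂ) : Prop where
  c00 : B 0 0 ^ 2 - 4 * (A 0 0 * C 0 0) = p 0 * p 0
  c01 : 2 * B 0 0 * B 0 1 - 4 * (A 0 0 * C 0 1 + A 0 1 * C 0 0) = p 0 * p 1
  c02 : 2 * B 0 0 * B 0 2 + B 0 1 ^ 2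
    - 4 * (A 0 0 * C 0 2 + A 0 1 * C 0 1 + A 0 2 * C 0 0) = p 0 * p 2
  c03 : 2 * B 0 1 * B 0 2 - 4 * (A 0 1 * C 0 2 + A 0 2 * C 0 1) = p 0 * p 3
  c04 : B 0 2 ^ 2 - 4 * (A 0 2 * C 0 2) = p 0 * p 4
  c10 : 2 * B 0 0 * B 1 0 - 4 * (A 0 0 * C 1 0 + A 1 0 * C 0 0) = p 1 * p 0
  c11 : 2 * B 0 0 * B 1 1 + 2 * B 0 1 * B 1 0
    - 4 * (A 0 0 * C 1 1 + A 0 1 * C 1 0 + A 1 0 * C 0 1 + A 1 1 * C 0 0) = p 1 * p 1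
  c12 : 2 * B 0 0 * B 1 2 + 2 * B 0 1 * B 1 1 + 2 * B 0 2 * B 1 0
    - 4 * (A 0 0 * C 1 2 + A 0 1 * C 1 1 + A 0 2 * C 1 0 + A 1 0 * C 0 2 
      + A 1 1 * C 0 1 + A 1 2 * C 0 0) = p 1 * p 2
  c13 : 2 * B 0 1 * B 1 2 + 2 * B 0 2 * B 1 1
    - 4 * (A 0 1 * C 1 2 + A 0 2 * C 1 1 + A 1 1 * C 0 2 + A 1 2 * C 0 1) = p 1 * p 3
  c14 : 2 * B 0 2 * B 1 2 - 4 * (A 0 2 * C 1 2 + A 1 2 * C 0 2) = p 1 * p 4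
  c20 : 2 * B 0 0 * B 2 0 + B 1 0 ^ 2
    - 4 * (A 0 0 * C 2 0 + A 1 0 * C 1 0 + A 2 0 * C 0 0) = p 2 * p 0
  c21 : 2 * B 0 0 * B 2 1 + 2 * B 0 1 * B 2 0 + 2 * B 1 0 * B 1 1
    - 4 * (A 0 0 * C 2 1 + A 0 1 * C 2 0 + A 1 0 * C 1 1 + A 1 1 * C 1 0 
      + A 2 0 * C 0 1 + A 2 1 * C 0 0) = p 2 * p 1
  c22 : 2 * B 0 0 * B 2 2 + 2 * B 0 1 * B 2 1 + 2 * B 0 2 * B 2 0 + 2 * B 1 0 * B 1 2 + B 1 1 ^ 2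
    - 4 * (A 0 0 * C 2 2 + A 0 1 * C 2 1 + A 0 2 * C 2 0 + A 1 0 * C 1 2 
      + A 1 1 * C 1 1 + A 1 2 * C 1 0 + A 2 0 * C 0 2 + A 2 1 * C 0 1 + A 2 2 * C 0 0) = p 2 * p 2
  c23 : 2 * B 0 1 * B 2 2 + 2 * B 0 2 * B 2 1 + 2 * B 1 1 * B 1 2
    - 4 * (A 0 1 * C 2 2 + A 0 2 * C 2 1 + A 1 1 * C 1 2 + A 1 2 * C 1 1 
      + A 2 1 * C 0 2 + A 2 2 * C 0 1) = p 2 * p 3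
  c24 : 2 * B 0 2 * B 2 2 + B 1 2 ^ 2
    - 4 * (A 0 2 * C 2 2 + A 1 2 * C 1 2 + A 2 2 * C 0 2) = p 2 * p 4
  c30 : 2 * B 1 0 * B 2 0 - 4 * (A 1 0 * C 2 0 + A 2 0 * C 1 0) = p 3 * p 0
  c31 : 2 * B 1 0 * B 2 1 + 2 * B 1 1 * B 2 0
    - 4 * (A 1 0 * C 2 1 + A 1 1 * C 2 0 + A 2 0 * C 1 1 + A 2 1 * C 1 0) = p 3 * p 1
  c32 : 2 * B 1 0 * B 2 2 + 2 * B 1 1 * B 2 1 + 2 * B 1 2 * B 2 0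
    - 4 * (A 1 0 * C 2 2 + A 1 1 * C 2 1 + A 1 2 * C 2 0 + A 2 0 * C 1 2 
      + A 2 1 * C 1 1 + A 2 2 * C 1 0) = p 3 * p 2
  c33 : 2 * B 1 1 * B 2 2 + 2 * B 1 2 * B 2 1
    - 4 * (A 1 1 * C 2 2 + A 1 2 * C 2 1 + A 2 1 * C 1 2 + A 2 2 * C 1 1) = p 3 * p 3
  c34 : 2 * B 1 2 * B 2 2 - 4 * (A 1 2 * C 2 2 + A 2 2 * C 1 2) = p 3 * p 4
  c40 : B 2 0 ^ 2 - 4 * (A 2 0 * C 2 0) = p 4 * p 0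
  c41 : 2 * B 2 0 * B 2 1 - 4 * (A 2 0 * C 2 1 + A 2 1 * C 2 0) = p 4 * p 1
  c42 : 2 * B 2 0 * B 2 2 + B 2 1 ^ 2
    - 4 * (A 2 0 * C 2 2 + A 2 1 * C 2 1 + A 2 2 * C 2 0) = p 4 * p 2
  c43 : 2 * B 2 1 * B 2 2 - 4 * (A 2 1 * C 2 2 + A 2 2 * C 2 1) = p 4 * p 3
  c44 : B 2 2 ^ 2 - 4 * (A 2 2 * C 2 2) = p 4 * p 4

/-- The quartic polynomial with given coefficients. -/
def quart (p : Fin 5 → ℂ) (t : ℂ) : ℂ :=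
  p 4 * t ^ 4 + p 3 * t ^ 3 + p 2 * t ^ 2 + p 1 * t + p 0

theorem discrCoeffs_of_forall {A B C : Fin 3 → Fin 3 → ℂ} {p : Fin 5 → ℂ}
    (h : ∀ y z, biq B y z ^ 2 - 4 * biq A y z * biq C y z = quart p y * quart p z) :
    DiscrCoeffs A B C p := by
  -- The coefficients of the powers of y, each a quartic in z; splitting these in turn gives the 25
  -- equations.
  have key : ∀ z, _ := fun z => quartic_coeffs_eq_zero
    (a4 := (B 2 2 * z ^ 2 + B 2 1 * z + B 2 0) ^ 2
      - 4 * (A 2 2 * z ^ 2 + A 2 1 * z + A 2 0) * (C 2 2 * z ^ 2 + C 2 1 * z + C 2 0)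
      - p 4 * quart p z)
    (a3 := 2 * (B 2 2 * z ^ 2 + B 2 1 * z + B 2 0) * (B 1 2 * z ^ 2 + B 1 1 * z + B 1 0)
      - 4 * ((A 2 2 * z ^ 2 + A 2 1 * z + A 2 0) * (C 1 2 * z ^ 2 + C 1 1 * z + C 1 0)
        + (A 1 2 * z ^ 2 + A 1 1 * z + A 1 0) * (C 2 2 * z ^ 2 + C 2 1 * z + C 2 0))
      - p 3 * quart p z)
    (a2 := (B 1 2 * z ^ 2 + B 1 1 * z + B 1 0) ^ 2
      + 2 * (B 2 2 * z ^ 2 + B 2 1 * z + B 2 0) * (B 0 2 * z ^ 2 + B 0 1 * z + B 0 0)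
      - 4 * ((A 2 2 * z ^ 2 + A 2 1 * z + A 2 0) * (C 0 2 * z ^ 2 + C 0 1 * z + C 0 0)
        + (A 1 2 * z ^ 2 + A 1 1 * z + A 1 0) * (C 1 2 * z ^ 2 + C 1 1 * z + C 1 0)
        + (A 0 2 * z ^ 2 + A 0 1 * z + A 0 0) * (C 2 2 * z ^ 2 + C 2 1 * z + C 2 0))
      - p 2 * quart p z)
    (a1 := 2 * (B 1 2 * z ^ 2 + B 1 1 * z + B 1 0) * (B 0 2 * z ^ 2 + B 0 1 * z + B 0 0)
      - 4 * ((A 1 2 * z ^ 2 + A 1 1 * z + A 1 0) * (C 0 2 * z ^ 2 + C 0 1 * z + C 0 0)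
        + (A 0 2 * z ^ 2 + A 0 1 * z + A 0 0) * (C 1 2 * z ^ 2 + C 1 1 * z + C 1 0))
      - p 1 * quart p z)
    (a0 := (B 0 2 * z ^ 2 + B 0 1 * z + B 0 0) ^ 2
      - 4 * (A 0 2 * z ^ 2 + A 0 1 * z + A 0 0) * (C 0 2 * z ^ 2 + C 0 1 * z + C 0 0)
      - p 0 * quart p z)
    (fun y => by have := h y z; simp only [biq, quart] at this ⊢; linear_combination this)
  obtain ⟨h44, h43, h42, h41, h40⟩ := quartic_coeffs_eq_zero
    (a4 := B 2 2 ^ 2 - 4 * (A 2 2 * C 2 2) - p 4 * p 4)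
    (a3 := 2 * B 2 1 * B 2 2 - 4 * (A 2 1 * C 2 2 + A 2 2 * C 2 1) - p 4 * p 3)
    (a2 := 2 * B 2 0 * B 2 2 + B 2 1 ^ 2 - 4 * (A 2 0 * C 2 2 + A 2 1 * C 2 1 + A 2 2 * C 2 0)
      - p 4 * p 2)
    (a1 := 2 * B 2 0 * B 2 1 - 4 * (A 2 0 * C 2 1 + A 2 1 * C 2 0) - p 4 * p 1)
    (a0 := B 2 0 ^ 2 - 4 * (A 2 0 * C 2 0) - p 4 * p 0)
    (fun z => by have := (key z).1; simp only [quart] at this; linear_combination this)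
  obtain ⟨h34, h33, h32, h31, h30⟩ := quartic_coeffs_eq_zero
    (a4 := 2 * B 1 2 * B 2 2 - 4 * (A 1 2 * C 2 2 + A 2 2 * C 1 2) - p 3 * p 4)
    (a3 := 2 * B 1 1 * B 2 2 + 2 * B 1 2 * B 2 1 - 4 * (A 1 1 * C 2 2 + A 1 2 * C 2 1 + A 2 1
      * C 1 2 + A 2 2 * C 1 1) - p 3 * p 3)
    (a2 := 2 * B 1 0 * B 2 2 + 2 * B 1 1 * B 2 1 + 2 * B 1 2 * B 2 0 - 4 * (A 1 0 * C 2 2 + A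
      1 1 * C 2 1 + A 1 2 * C 2 0 + A 2 0 * C 1 2 + A 2 1 * C 1 1 + A 2 2 * C 1 0) - p 3 * p 2)
    (a1 := 2 * B 1 0 * B 2 1 + 2 * B 1 1 * B 2 0 - 4 * (A 1 0 * C 2 1 + A 1 1 * C 2 0 + A 2 0
      * C 1 1 + A 2 1 * C 1 0) - p 3 * p 1)
    (a0 := 2 * B 1 0 * B 2 0 - 4 * (A 1 0 * C 2 0 + A 2 0 * C 1 0) - p 3 * p 0)
    (fun z => by have := (key z).2.1; simp only [quart] at this; linear_combination this)
  obtain ⟨h24, h23, h22, h21, h20⟩ := quartic_coeffs_eq_zero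
    (a4 := 2 * B 0 2 * B 2 2 + B 1 2 ^ 2 - 4 * (A 0 2 * C 2 2 + A 1 2 * C 1 2 + A 2 2 * C 0 2)
      - p 2 * p 4)
    (a3 := 2 * B 0 1 * B 2 2 + 2 * B 0 2 * B 2 1 + 2 * B 1 1 * B 1 2 - 4 * (A 0 1 * C 2 2 + A
      0 2 * C 2 1 + A 1 1 * C 1 2 + A 1 2 * C 1 1 + A 2 1 * C 0 2 + A 2 2 * C 0 1) - p 2 * p 3)
    (a2 := 2 * B 0 0 * B 2 2 + 2 * B 0 1 * B 2 1 + 2 * B 0 2 * B 2 0 + 2 * B 1 0 * B 1 2 + B 1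
      1 ^ 2 - 4 * (A 0 0 * C 2 2 + A 0 1 * C 2 1 + A 0 2 * C 2 0 + A 1 0 * C 1 2 + A 1 1 * C 1 1
      + A 1 2 * C 1 0 + A 2 0 * C 0 2 + A 2 1 * C 0 1 + A 2 2 * C 0 0) - p 2 * p 2)
    (a1 := 2 * B 0 0 * B 2 1 + 2 * B 0 1 * B 2 0 + 2 * B 1 0 * B 1 1 - 4 * (A 0 0 * C 2 1 + A
      0 1 * C 2 0 + A 1 0 * C 1 1 + A 1 1 * C 1 0 + A 2 0 * C 0 1 + A 2 1 * C 0 0) - p 2 * p 1)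
    (a0 := 2 * B 0 0 * B 2 0 + B 1 0 ^ 2 - 4 * (A 0 0 * C 2 0 + A 1 0 * C 1 0 + A 2 0 * C 0 0)
      - p 2 * p 0)
    (fun z => by have := (key z).2.2.1; simp only [quart] at this; linear_combination this)
  obtain ⟨h14, h13, h12, h11, h10⟩ := quartic_coeffs_eq_zero
    (a4 := 2 * B 0 2 * B 1 2 - 4 * (A 0 2 * C 1 2 + A 1 2 * C 0 2) - p 1 * p 4)
    (a3 := 2 * B 0 1 * B 1 2 + 2 * B 0 2 * B 1 1 - 4 * (A 0 1 * C 1 2 + A 0 2 * C 1 1 + A 1 1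
      * C 0 2 + A 1 2 * C 0 1) - p 1 * p 3)
    (a2 := 2 * B 0 0 * B 1 2 + 2 * B 0 1 * B 1 1 + 2 * B 0 2 * B 1 0 - 4 * (A 0 0 * C 1 2 + A
      0 1 * C 1 1 + A 0 2 * C 1 0 + A 1 0 * C 0 2 + A 1 1 * C 0 1 + A 1 2 * C 0 0) - p 1 * p 2)
    (a1 := 2 * B 0 0 * B 1 1 + 2 * B 0 1 * B 1 0 - 4 * (A 0 0 * C 1 1 + A 0 1 * C 1 0 + A 1 0
      * C 0 1 + A 1 1 * C 0 0) - p 1 * p 1)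
    (a0 := 2 * B 0 0 * B 1 0 - 4 * (A 0 0 * C 1 0 + A 1 0 * C 0 0) - p 1 * p 0)
    (fun z => by have := (key z).2.2.2.1; simp only [quart] at this; linear_combination this)
  obtain ⟨h04, h03, h02, h01, h00⟩ := quartic_coeffs_eq_zero
    (a4 := B 0 2 ^ 2 - 4 * (A 0 2 * C 0 2) - p 0 * p 4)
    (a3 := 2 * B 0 1 * B 0 2 - 4 * (A 0 1 * C 0 2 + A 0 2 * C 0 1) - p 0 * p 3)
    (a2 := 2 * B 0 0 * B 0 2 + B 0 1 ^ 2 - 4 * (A 0 0 * C 0 2 + A 0 1 * C 0 1 + A 0 2 * C 0 0)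
      - p 0 * p 2)
    (a1 := 2 * B 0 0 * B 0 1 - 4 * (A 0 0 * C 0 1 + A 0 1 * C 0 0) - p 0 * p 1)
    (a0 := B 0 0 ^ 2 - 4 * (A 0 0 * C 0 0) - p 0 * p 0)
    (fun z => by have := (key z).2.2.2.2; simp only [quart] at this; linear_combination this)
  constructor <;> rw [← sub_eq_zero] <;> assumption

/-- A biquadratic polynomial both of whose discriminants vanish is the square of a
polynomial `α y z + β y + γ z + δ`. -/
theorem exists_sq_of_discr_eq_zero {Q : Fin 3 → Fin 3 → ℂ}
    (hy : ∀ z, (Q 1 2 * z ^ 2 + Q 1 1 * z + Q 1 0) ^ 2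
      - 4 * (Q 2 2 * z ^ 2 + Q 2 1 * z + Q 2 0) * (Q 0 2 * z ^ 2 + Q 0 1 * z + Q 0 0) = 0)
    (hz : ∀ y, (Q 2 1 * y ^ 2 + Q 1 1 * y + Q 0 1) ^ 2
      - 4 * (Q 2 2 * y ^ 2 + Q 1 2 * y + Q 0 2) * (Q 2 0 * y ^ 2 + Q 1 0 * y + Q 0 0) = 0) :
    ∃ α β γ δ : ℂ, Q 2 2 = α ^ 2 ∧ Q 2 1 = 2 * α * β ∧ Q 1 2 = 2 * α * γ ∧
      Q 1 1 = 2 * α * δ + 2 * β * γ ∧ Q 2 0 = β ^ 2 ∧ Q 0 2 = γ ^ 2 ∧ Q 1 0 = 2 * β * δ ∧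
      Q 0 1 = 2 * γ * δ ∧ Q 0 0 = δ ^ 2 := by
  obtain ⟨y4, y3, y2, y1, y0⟩ := quartic_coeffs_eq_zero
    (a4 := Q 1 2 ^ 2 - 4 * Q 2 2 * Q 0 2)
    (a3 := 2 * Q 1 2 * Q 1 1 - 4 * (Q 2 2 * Q 0 1 + Q 2 1 * Q 0 2))
    (a2 := Q 1 1 ^ 2 + 2 * Q 1 2 * Q 1 0 - 4 * (Q 2 2 * Q 0 0 + Q 2 1 * Q 0 1 + Q 2 0 * Q 0 2))
    (a1 := 2 * Q 1 1 * Q 1 0 - 4 * (Q 2 1 * Q 0 0 + Q 2 0 * Q 0 1))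
    (a0 := Q 1 0 ^ 2 - 4 * Q 2 0 * Q 0 0)
    (fun z => by linear_combination hy z)
  obtain ⟨z4, z3, z2, z1, z0⟩ := quartic_coeffs_eq_zero
    (a4 := Q 2 1 ^ 2 - 4 * Q 2 2 * Q 2 0)
    (a3 := 2 * Q 2 1 * Q 1 1 - 4 * (Q 2 2 * Q 1 0 + Q 1 2 * Q 2 0))
    (a2 := Q 1 1 ^ 2 + 2 * Q 2 1 * Q 0 1 - 4 * (Q 2 2 * Q 0 0 + Q 1 2 * Q 1 0 + Q 0 2 * Q 2 0))
    (a1 := 2 * Q 1 1 * Q 0 1 - 4 * (Q 1 2 * Q 0 0 + Q 0 2 * Q 1 0))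
    (a0 := Q 0 1 ^ 2 - 4 * Q 0 2 * Q 0 0)
    (fun y => by linear_combination hz y)
  have hroot : ∀ w : ℂ, ∃ r, w = r ^ 2 := fun w =>
    ⟨_, (Complex.cpow_nat_inv_pow w two_ne_zero).symm⟩
  -- The square root is extracted from a leading coefficient that does not vanish; division by it
  -- then gives the other coefficients of the root, and the vanishing discriminants confirm the
  -- rest.
  by_cases h22 : Q 2 2 = 0
  · have h21 : Q 2 1 = 0 := by simpa [h22] using z4
    have h12 : Q 1 2 = 0 := by simpa [h22] using y4
    by_cases h20 : Q 2 0 = 0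
    · have h11 : Q 1 1 = 0 := by simpa [h22, h21, h12, h20] using y2
      have h10 : Q 1 0 = 0 := by simpa [h20] using y0
      by_cases h02 : Q 0 2 = 0
      · have h01 : Q 0 1 = 0 := by simpa [h02] using z0
        obtain ⟨δ, hδ⟩ := hroot (Q 0 0)
        exact ⟨0, 0, 0, δ, by simp [*]⟩
      · obtain ⟨γ, hγ⟩ := hroot (Q 0 2)
        have hγ0 : γ ≠ 0 := by rintro rfl; simp [hγ] at h02
        refine ⟨0, 0, γ, Q 0 1 / (2 * γ), by simp [*], by simp [*], by simp [*], by simp [*],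
          by simp [*], hγ, by simp [*], by field_simp, ?_⟩
        field_simp
        rw [hγ] at z0
        linear_combination -z0
    · obtain ⟨β, hβ⟩ := hroot (Q 2 0)
      have hβ0 : β ≠ 0 := by rintro rfl; simp [hβ] at h20
      simp only [hβ, h22, h21, h12] at z2 y1 y0
      refine ⟨0, β, Q 1 1 / (2 * β), Q 1 0 / (2 * β), by simp [h22], by simp [h21], by simp [h12],
        by field_simp; ring, hβ, ?_, by field_simp, ?_, ?_⟩
      · field_simp; linear_combination -z2
      · field_simp; linear_combination (-1/2) * y1
      · field_simp; linear_combination -y0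
  · obtain ⟨α, hα⟩ := hroot (Q 2 2)
    have hα0 : α ≠ 0 := by rintro rfl; simp [hα] at h22
    obtain ⟨β, hβ⟩ : ∃ β, Q 2 1 = 2 * α * β := ⟨Q 2 1 / (2 * α), by field_simp⟩
    obtain ⟨γ, hγ⟩ : ∃ γ, Q 1 2 = 2 * α * γ := ⟨Q 1 2 / (2 * α), by field_simp⟩
    obtain ⟨δ, hδ⟩ : ∃ δ, Q 1 1 = 2 * α * δ + 2 * β * γ :=
      ⟨(Q 1 1 - 2 * β * γ) / (2 * α), by field_simp; ring⟩
    have hα2 : α ^ 2 ≠ 0 := pow_ne_zero 2 hα0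
    have h20 : Q 2 0 = β ^ 2 := mul_left_cancel₀ hα2 (by
      rw [hα, hβ] at z4; linear_combination (-1/4) * z4)
    have h02 : Q 0 2 = γ ^ 2 := mul_left_cancel₀ hα2 (by
      rw [hα, hγ] at y4; linear_combination (-1/4) * y4)
    have h10 : Q 1 0 = 2 * β * δ := mul_left_cancel₀ hα2 (by
      rw [hα, hβ, hγ, hδ, h20] at z3; linear_combination (-1/4) * z3)
    have h01 : Q 0 1 = 2 * γ * δ := mul_left_cancel₀ hα2 (by
      rw [hα, hβ, hγ, hδ, h02] at y3; linear_combination (-1/4) * y3)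
    refine ⟨α, β, γ, δ, hα, hβ, hγ, hδ, h20, h02, h10, h01, mul_left_cancel₀ hα2 ?_⟩
    rw [hα, hβ, hγ, hδ, h20, h02, h10, h01] at z2
    linear_combination (-1/4) * z2

variable {f : Fin 3 → Fin 3 → Fin 3 → ℂ} {p : Fin 5 → ℂ}

theorem Sep.coeffs_x (h : Sep f (quart p)) : DiscrCoeffs (f 2) (f 1) (f 0) p :=
  discrCoeffs_of_forall h.discr_x

theorem Sep.coeffs_y (h : Sep f (quart p)) :
    DiscrCoeffs (fun i k => f i 2 k) (fun i k => f i 1 k) (fun i k => f i 0 k) p :=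
  discrCoeffs_of_forall h.discr_y

theorem Sep.coeffs_z (h : Sep f (quart p)) :
    DiscrCoeffs (fun i j => f i j 2) (fun i j => f i j 1) (fun i j => f i j 0) p :=
  discrCoeffs_of_forall h.discr_z

/-- If `P` vanishes at infinity, the leading coefficient of `f` in `x` is a square. -/
theorem Sep.top_sq (h : Sep f (quart p)) (hp : p 4 = 0) :
    ∃ α β γ δ : ℂ, f 2 2 2 = α ^ 2 ∧ f 2 2 1 = 2 * α * β ∧ f 2 1 2 = 2 * α * γ ∧
      f 2 1 1 = 2 * α * δ + 2 * β * γ ∧ f 2 2 0 = β ^ 2 ∧ f 2 0 2 = γ ^ 2 ∧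
      f 2 1 0 = 2 * β * δ ∧ f 2 0 1 = 2 * γ * δ ∧ f 2 0 0 = δ ^ 2 := by
  have hy := h.coeffs_y
  have hz := h.coeffs_z
  -- The x⁴-coefficients of the discriminants of F in y and z are the discriminants of its
  -- x²-coefficient, and they equal p₄P = 0.
  apply exists_sq_of_discr_eq_zero
  · intro z
    have h4 := hy.c44; have h3 := hy.c43; have h2 := hy.c42; have h1 := hy.c41; have h0 := hy.c40
    rw [hp, zero_mul] at h4 h3 h2 h1 h0
    linear_combination z ^ 4 * h4 + z ^ 3 * h3 + z ^ 2 * h2 + z * h1 + h0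
  · intro z
    have h4 := hz.c44; have h3 := hz.c43; have h2 := hz.c42; have h1 := hz.c41; have h0 := hz.c40
    rw [hp, zero_mul] at h4 h3 h2 h1 h0
    linear_combination z ^ 4 * h4 + z ^ 3 * h3 + z ^ 2 * h2 + z * h1 + h0

end DiscSep
end

/-! ### P of degree at most two: the leading coefficient in x. -/

noncomputable section
namespace DiscSep

variable {f : Fin 3 → Fin 3 → Fin 3 → ℂ} {p : Fin 5 → ℂ}

/-- If `P` has a double zero at infinity and the leading coefficient of `f` in `x` is
`(l y + m) ^ 2`, then `P` has a double zero at `-m / l`. -/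
theorem Sep.double_zero_of_top_sq (h : Sep f (quart p)) (h4 : p 4 = 0) (h3 : p 3 = 0)
    {α β γ δ : ℂ} (q22 : f 2 2 2 = α ^ 2) (q21 : f 2 2 1 = 2 * α * β) (q12 : f 2 1 2 = 2 * α * γ)
    (q11 : f 2 1 1 = 2 * α * δ + 2 * β * γ) (q20 : f 2 2 0 = β ^ 2) (q02 : f 2 0 2 = γ ^ 2)
    (q10 : f 2 1 0 = 2 * β * δ) (q01 : f 2 0 1 = 2 * γ * δ) (q00 : f 2 0 0 = δ ^ 2)
    {z : ℂ} (hl : α * z + β ≠ 0) (hP : quart p z ≠ 0) :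
    p 1 = 2 * p 2 * ((γ * z + δ) / (α * z + β)) ∧
      p 0 = p 2 * ((γ * z + δ) / (α * z + β)) ^ 2 := by
  have hy := h.coeffs_y
  obtain ⟨r, hr⟩ : ∃ r, γ * z + δ = r * (α * z + β) :=
    ⟨(γ * z + δ) / (α * z + β), (div_mul_cancel₀ _ hl).symm⟩
  have hr' : (γ * z + δ) / (α * z + β) = r := by rw [hr]; field_simp
  rw [hr']
  set b2 := f 1 2 2 * z ^ 2 + f 1 2 1 * z + f 1 2 0 with hb2
  set b1 := f 1 1 2 * z ^ 2 + f 1 1 1 * z + f 1 1 0 with hb1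
  set b0 := f 1 0 2 * z ^ 2 + f 1 0 1 * z + f 1 0 0 with hb0
  -- At this z the leading coefficient is (αz + β)²(y + r)². Its polarised discriminant with B is
  -- p₃P(z) = 0, and for a square this says that B also vanishes at y = -r.
  have hB : b0 = r * b1 - r ^ 2 * b2 := by
    refine mul_left_cancel₀ (pow_ne_zero 2 hl) ?_
    have e4 := hy.c34; have e3 := hy.c33; have e2 := hy.c32; have e1 := hy.c31; have e0 := hy.c30
    simp only [h3, zero_mul, q22, q21, q12, q11, q20, q02, q10, q01, q00] at e4 e3 e2 e1 e0
    have key : (α * z + β) ^ 2 * b0 - (α * z + β) * (γ * z + δ) * b1 + (γ * z + δ) ^ 2 * b2 = 0 := by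
      rw [hb0, hb1, hb2]
      linear_combination (-1/4) * (z ^ 4 * e4 + z ^ 3 * e3 + z ^ 2 * e2 + z * e1 + e0)
    rw [hr] at key
    linear_combination key
  have hx : ∀ y, (y + r) ^ 2 * ((b2 * y + (b1 - r * b2)) ^ 2 - 4 * (α * z + β) ^ 2 *
      ((f 0 2 2 * z ^ 2 + f 0 2 1 * z + f 0 2 0) * y ^ 2
        + (f 0 1 2 * z ^ 2 + f 0 1 1 * z + f 0 1 0) * y + (f 0 0 2 * z ^ 2 + f 0 0 1 * z + f 0 0 0)))
      = quart p y * quart p z := by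
    intro y
    rw [← h.discr_x y z]
    have hA : biq (f 2) y z = (α * z + β) ^ 2 * (y + r) ^ 2 := by
      have : (α * z + β) * (y + r) = (α * z + β) * y + (γ * z + δ) := by rw [hr]; ring
      rw [← mul_pow, this]
      simp only [biq, q22, q21, q12, q11, q20, q02, q10, q01, q00]
      ring
    have hB' : biq (f 1) y z = (y + r) * (b2 * y + (b1 - r * b2)) := by
      have : biq (f 1) y z = b2 * y ^ 2 + b1 * y + b0 := rfl
      rw [this, hB]
      ring
    rw [hA, hB']
    simp only [biq]
    ring
  set c2 := f 0 2 2 * z ^ 2 + f 0 2 1 * z + f 0 2 0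
  set c1 := f 0 1 2 * z ^ 2 + f 0 1 1 * z + f 0 1 0
  set c0 := f 0 0 2 * z ^ 2 + f 0 0 1 * z + f 0 0 0
  set s := b1 - r * b2
  set w := quart p z
  set L := α * z + β
  -- Now (y + r)² divides P(y)P(z). As P has degree at most two, `k4` and `k3` reduce the cofactor
  -- to a constant, so P is a multiple of (y + r)².
  obtain ⟨k4, k3, k2, k1, k0⟩ := quartic_coeffs_eq_zero
    (a4 := b2 ^ 2 - 4 * L ^ 2 * c2)
    (a3 := (2 * b2 * s - 4 * L ^ 2 * c1) + 2 * r * (b2 ^ 2 - 4 * L ^ 2 * c2))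
    (a2 := (s ^ 2 - 4 * L ^ 2 * c0) + 2 * r * (2 * b2 * s - 4 * L ^ 2 * c1)
      + r ^ 2 * (b2 ^ 2 - 4 * L ^ 2 * c2) - p 2 * w)
    (a1 := 2 * r * (s ^ 2 - 4 * L ^ 2 * c0) + r ^ 2 * (2 * b2 * s - 4 * L ^ 2 * c1) - p 1 * w)
    (a0 := r ^ 2 * (s ^ 2 - 4 * L ^ 2 * c0) - p 0 * w)
    (fun y => by
      have := hx y
      rw [quart, h4, h3] at this
      linear_combination this)
  constructor
  · refine mul_right_cancel₀ hP ?_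
    linear_combination 2 * r * k2 - k1 - 3 * r ^ 2 * k3 + 4 * r ^ 3 * k4
  · refine mul_right_cancel₀ hP ?_
    linear_combination r ^ 2 * k2 - k0 - 2 * r ^ 3 * k3 + 3 * r ^ 4 * k4

/-- A z with αz + β ≠ 0 and P(z) ≠ 0 would create a finite double zero, so (αz + β)P(z) vanishes
identically. The condition `hp` also excludes P = 0, by r = 0. -/
theorem Sep.top_left_eq_zero (h : Sep f (quart p)) (h4 : p 4 = 0) (h3 : p 3 = 0)
    (hp : ∀ r : ℂ, ¬ (p 1 = 2 * p 2 * r ∧ p 0 = p 2 * r ^ 2)) :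
    f 2 2 2 = 0 ∧ f 2 2 1 = 0 ∧ f 2 2 0 = 0 := by
  obtain ⟨α, β, γ, δ, q22, q21, q12, q11, q20, q02, q10, q01, q00⟩ := h.top_sq h4
  have key : ∀ z, (α * z + β) * quart p z = 0 := by
    intro z
    by_contra hz
    rw [mul_eq_zero, not_or] at hz
    exact hp _ (h.double_zero_of_top_sq h4 h3 q22 q21 q12 q11 q20 q02 q10 q01 q00 hz.1 hz.2)
  obtain ⟨-, k3, k2, k1, k0⟩ := quartic_coeffs_eq_zero (a4 := 0) (a3 := α * p 2)
    (a2 := α * p 1 + β * p 2) (a1 := α * p 0 + β * p 1) (a0 := β * p 0)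
    (fun z => by have := key z; rw [quart, h4, h3] at this; linear_combination this)
  have hpne : ¬ (p 2 = 0 ∧ p 1 = 0 ∧ p 0 = 0) := fun ⟨e2, e1, e0⟩ =>
    hp 0 ⟨by simp [e1], by simp [e0]⟩
  have hα : α = 0 := by
    by_contra hα
    have e2 : p 2 = 0 := by simpa [hα] using k3
    have e1 : p 1 = 0 := by simpa [hα, e2] using k2
    have e0 : p 0 = 0 := by simpa [hα, e1] using k1
    exact hpne ⟨e2, e1, e0⟩
  have hβ : β = 0 := by
    by_contra hβ
    rw [hα] at k2 k1
    exact hpne ⟨by simpa [hβ] using k2, by simpa [hβ] using k1, by simpa [hβ] using k0⟩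
  simp [q22, q21, q20, hα, hβ]

/-- If `P` has a double zero at infinity and no finite double zero, the leading coefficients
of `f` are constants. -/
theorem Sep.top_eq_zero (h : Sep f (quart p)) (h4 : p 4 = 0) (h3 : p 3 = 0)
    (hp : ∀ r : ℂ, ¬ (p 1 = 2 * p 2 * r ∧ p 0 = p 2 * r ^ 2)) :
    f 2 2 2 = 0 ∧ f 2 2 1 = 0 ∧ f 2 2 0 = 0 ∧ f 2 1 2 = 0 ∧ f 2 1 1 = 0 ∧ f 2 1 0 = 0 ∧
      f 2 0 2 = 0 ∧ f 2 0 1 = 0 := by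
  obtain ⟨a1, a2, a3⟩ := h.top_left_eq_zero h4 h3 hp
  obtain ⟨-, b2, b3⟩ := h.swap_yz.top_left_eq_zero h4 h3 hp
  obtain ⟨α, β, γ, δ, q22, q21, q12, q11, q20, q02, q10, q01, q00⟩ := h.top_sq h4
  have hα : α = 0 := by simpa [q22] using a1
  have hβ : β = 0 := by simpa [q20] using a3
  have hγ : γ = 0 := by simpa [q02] using b3
  simp [*]

/-- The shape of `f` when its leading coefficient in `x` is a nonzero constant and `P` has
degree at most two. -/
theorem Sep.exists_of_top_const (h : Sep f (quart p)) (h4 : p 4 = 0) (h3 : p 3 = 0)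
    (t22 : f 2 2 2 = 0) (t21 : f 2 2 1 = 0) (t20 : f 2 2 0 = 0) (t12 : f 2 1 2 = 0)
    (t11 : f 2 1 1 = 0) (t10 : f 2 1 0 = 0) (t02 : f 2 0 2 = 0) (t01 : f 2 0 1 = 0)
    {a : ℂ} (t00 : f 2 0 0 = a) :
    ∃ m n o q : ℂ,
      (∀ x y z, 4 * a * triq f x y z =
        (2 * a * x + m * y * z + n * y + o * z + q) ^ 2 - quart p y * quart p z) ∧
      (∀ x z, quart p z * ((p 1 ^ 2 - 4 * p 0 * p 2) * quart p z
        + 4 * (p 2 * (2 * a * x + o * z + q) ^ 2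
          - p 1 * (2 * a * x + o * z + q) * (m * z + n) + p 0 * (m * z + n) ^ 2)
        - 16 * a ^ 2 * quart p x) = 0) ∧
      (∀ x y, quart p y * ((p 1 ^ 2 - 4 * p 0 * p 2) * quart p y
        + 4 * (p 2 * (2 * a * x + n * y + q) ^ 2
          - p 1 * (2 * a * x + n * y + q) * (m * y + o) + p 0 * (m * y + o) ^ 2)
        - 16 * a ^ 2 * quart p x) = 0) := by
  have hx := h.coeffs_x
  have b22 : f 1 2 2 = 0 := by simpa [t22, h4] using hx.c44
  have b21 : f 1 2 1 = 0 := by simpa [t22, t21, t20, h4, b22] using hx.c42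
  have b20 : f 1 2 0 = 0 := by simpa [t20, h4] using hx.c40
  have b12 : f 1 1 2 = 0 := by simpa [t22, t12, t02, h4, b22] using hx.c24
  have b02 : f 1 0 2 = 0 := by simpa [t02, h4] using hx.c04
  have hB : ∀ y z, biq (f 1) y z = f 1 1 1 * y * z + f 1 1 0 * y + f 1 0 1 * z + f 1 0 0 := by
    intro y z; simp only [biq, *]; ring
  have hA : ∀ y z, biq (f 2) y z = a := by intro y z; simp only [biq, *]; ring
  -- Completing the square in x: the discriminant eliminates the constant term C of F.
  have hF : ∀ x y z, 4 * a * triq f x y z = (2 * a * x + f 1 1 1 * y * z + f 1 1 0 * y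
      + f 1 0 1 * z + f 1 0 0) ^ 2 - quart p y * quart p z := by
    intro x y z
    have := h.discr_x y z
    rw [hB, hA] at this
    rw [triq, hB, hA]
    linear_combination -this
  have hquad : ∀ {u v w a b c : ℂ}, (∀ t : ℂ, u * t ^ 2 + v * t + w = a * t ^ 2 + b * t + c) →
      v ^ 2 - 4 * u * w = b ^ 2 - 4 * a * c := by
    intro u v w a b c ht
    obtain ⟨e2, e1, e0⟩ := quadratic_coeffs_eq_zero (a2 := u - a) (a1 := v - b) (a0 := w - c)
      fun t => by linear_combination ht t
    rw [sub_eq_zero.1 e2, sub_eq_zero.1 e1, sub_eq_zero.1 e0]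
  refine ⟨f 1 1 1, f 1 1 0, f 1 0 1, f 1 0 0, hF, fun x z => ?_, fun x y => ?_⟩
  -- The completed square is reread as a quadratic in y. Its discriminant must be 16a²P(x)P(z), and
  -- the difference has P(z) as a factor.
  · have e := hquad (u := 4 * a * biq (fun i k => f i 2 k) x z)
      (v := 4 * a * biq (fun i k => f i 1 k) x z) (w := 4 * a * biq (fun i k => f i 0 k) x z)
      (a := (f 1 1 1 * z + f 1 1 0) ^ 2 - p 2 * quart p z)
      (b := 2 * (f 1 1 1 * z + f 1 1 0) * (2 * a * x + f 1 0 1 * z + f 1 0 0) - p 1 * quart p z)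
      (c := (2 * a * x + f 1 0 1 * z + f 1 0 0) ^ 2 - p 0 * quart p z) fun y => by
        have := hF x y z
        simp only [triq, biq] at this ⊢
        rw [show quart p y = p 2 * y ^ 2 + p 1 * y + p 0 by rw [quart, h4, h3]; ring] at this
        linear_combination this
    have := h.discr_y x z
    linear_combination 16 * a ^ 2 * this - e
  · have e := hquad (u := 4 * a * biq (fun i j => f i j 2) x y)
      (v := 4 * a * biq (fun i j => f i j 1) x y) (w := 4 * a * biq (fun i j => f i j 0) x y)
      (a := (f 1 1 1 * y + f 1 0 1) ^ 2 - p 2 * quart p y)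
      (b := 2 * (f 1 1 1 * y + f 1 0 1) * (2 * a * x + f 1 1 0 * y + f 1 0 0) - p 1 * quart p y)
      (c := (2 * a * x + f 1 1 0 * y + f 1 0 0) ^ 2 - p 0 * quart p y) fun z => by
        have := hF x y z
        simp only [triq, biq] at this ⊢
        rw [show quart p z = p 2 * z ^ 2 + p 1 * z + p 0 by rw [quart, h4, h3]; ring] at this
        linear_combination this
    have := h.discr_z x y
    linear_combination 16 * a ^ 2 * this - e

/-- If `P` has degree at most two and the leading coefficient of `f` in `x` vanishes, `P` is
a square. -/
theorem Sep.sq_eq_of_top_eq_zero (h : Sep f (quart p)) (h4 : p 4 = 0) (h3 : p 3 = 0)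
    (ht : ∀ j k, f 2 j k = 0) (hp : p 2 ≠ 0 ∨ p 1 ≠ 0 ∨ p 0 ≠ 0) :
    p 1 ^ 2 = 4 * p 2 * p 0 := by
  -- Without a leading coefficient, B² = P(y)P(z). At a z with P(z) ≠ 0 this makes P a constant
  -- times a square.
  have key : ∀ w, (∃ z, quart p z = w) → w ≠ 0 → p 1 ^ 2 = 4 * p 2 * p 0 := by
    rintro w ⟨z, rfl⟩ hw
    set b2 := f 1 2 2 * z ^ 2 + f 1 2 1 * z + f 1 2 0 with hb2
    set b1 := f 1 1 2 * z ^ 2 + f 1 1 1 * z + f 1 1 0 with hb1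
    set b0 := f 1 0 2 * z ^ 2 + f 1 0 1 * z + f 1 0 0 with hb0
    obtain ⟨k4, k3, k2, k1, k0⟩ := quartic_coeffs_eq_zero (a4 := b2 ^ 2) (a3 := 2 * b2 * b1)
      (a2 := b1 ^ 2 + 2 * b2 * b0 - p 2 * quart p z) (a1 := 2 * b1 * b0 - p 1 * quart p z)
      (a0 := b0 ^ 2 - p 0 * quart p z)
      (fun y => by
        have := h.discr_x y z
        rw [show biq (f 2) y z = 0 by simp [biq, ht],
          show biq (f 1) y z = b2 * y ^ 2 + b1 * y + b0 from rfl] at this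
        rw [show quart p y = p 2 * y ^ 2 + p 1 * y + p 0 by rw [quart, h4, h3]; ring] at this
        linear_combination this)
    have hb : b2 = 0 := by simpa using k4
    rw [hb] at k2
    refine mul_right_cancel₀ (pow_ne_zero 2 hw) ?_
    linear_combination (p 1 * quart p z + 2 * b1 * b0) * (-k1) + 4 * p 0 * quart p z * k2
      + 4 * b1 ^ 2 * k0
  by_contra hne
  have hall : ∀ z, quart p z = 0 := fun z => by
    by_contra hz
    exact hne (key _ ⟨z, rfl⟩ hz)
  obtain ⟨-, -, e2, e1, e0⟩ := quartic_coeffs_eq_zero hall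
  simp [e2, e1, e0] at hp

end DiscSep
end

/-! ### Solutions for P = x² - e², x, 1 and x². -/

noncomputable section
namespace DiscSep

variable {f : Fin 3 → Fin 3 → Fin 3 → ℂ}

/-- P has no finite double zero and is not a square, so the leading coefficient is a nonzero
constant and the completed square applies. P knows e only up to sign, hence `e'`; the overall sign
is `s`. -/
theorem Sep.eq_of_two_simple {e : ℂ} (he : e ≠ 0) (h : Sep f (fun t => t ^ 2 - e ^ 2)) :
    ∃ e' s : ℂ, e' ^ 2 = e ^ 2 ∧ s ^ 2 = 1 ∧ ∀ x y z, triq f x y z =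
      s * (x * y * z + e' / 2 * (x ^ 2 + y ^ 2 + z ^ 2 - e' ^ 2)) := by
  have hq : ∀ t, quart ![-e ^ 2, 0, 1, 0, 0] t = t ^ 2 - e ^ 2 := fun t => by
    simp [quart]; ring
  have h' : Sep f (quart ![-e ^ 2, 0, 1, 0, 0]) := by rwa [funext hq]
  obtain ⟨t22, t21, t20, t12, t11, t10, t02, t01⟩ := h'.top_eq_zero rfl rfl (by
    rintro r ⟨h1, h0⟩
    have hr : r = 0 := by simpa using h1
    simp [hr, he] at h0)
  have ha : f 2 0 0 ≠ 0 := by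
    intro t00
    have := h'.sq_eq_of_top_eq_zero rfl rfl (by
      intro j k; fin_cases j <;> fin_cases k <;> assumption) (by simp)
    simp [he] at this
  obtain ⟨m, n, o, q, hF, hxz, -⟩ := h'.exists_of_top_const rfl rfl t22 t21 t20 t12 t11 t10 t02
    t01 rfl
  set a := f 2 0 0
  simp only [hq] at hF hxz
  replace hxz : ∀ x z, (z ^ 2 - e ^ 2) * (e ^ 2 * (z ^ 2 - e ^ 2) + 4 * a * x * (o * z + q)
      + (o * z + q) ^ 2 - e ^ 2 * (m * z + n) ^ 2 + 4 * a ^ 2 * e ^ 2) = 0 := fun x z => by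
    have := hxz x z
    simp at this
    rw [← mul_eq_zero] at this
    linear_combination (1/4) * this
  obtain ⟨-, ho, hq0, -, -⟩ := quartic_coeffs_eq_zero (a4 := 0) (a3 := 4 * a * o)
    (a2 := 4 * a * q) (a1 := -4 * a * o * e ^ 2) (a0 := -4 * a * q * e ^ 2)
    (fun z => by linear_combination hxz 1 z - hxz 0 z)
  have ho : o = 0 := by simpa [ha] using ho
  have hq0 : q = 0 := by simpa [ha] using hq0
  subst ho hq0
  obtain ⟨hm, hn, hc, -, -⟩ := quartic_coeffs_eq_zero (a4 := e ^ 2 * (1 - m ^ 2))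
    (a3 := -2 * e ^ 2 * m * n)
    (a2 := e ^ 2 * (-e ^ 2 - n ^ 2 + 4 * a ^ 2) - e ^ 4 * (1 - m ^ 2)) (a1 := 2 * e ^ 4 * m * n)
    (a0 := -e ^ 4 * (-e ^ 2 - n ^ 2 + 4 * a ^ 2))
    (fun z => by linear_combination hxz 0 z)
  have hm : m ^ 2 = 1 := by
    have : 1 - m ^ 2 = 0 := by simpa [he] using hm
    linear_combination -this
  have hm0 : m ≠ 0 := by rintro rfl; simp at hm
  have hn : n = 0 := by simpa [he, hm0] using hn
  have hc : 4 * a ^ 2 = e ^ 2 := by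
    refine mul_left_cancel₀ (pow_ne_zero 2 he) ?_
    rw [hn, hm] at hc
    linear_combination hc
  -- The coefficient of xyz is s = m, and that of x² requires s·e'/2 = a, so e' = 2ma because m² =
  -- 1.
  refine ⟨2 * m * a, m, by linear_combination 4 * a ^ 2 * hm + hc, hm, fun x y z => ?_⟩
  refine mul_left_cancel₀ (mul_ne_zero (by norm_num : (4 : ℂ) ≠ 0) ha) ?_
  rw [hF, hn]
  linear_combination (y ^ 2 * z ^ 2 - 4 * a ^ 2 * (x ^ 2 + y ^ 2 + z ^ 2)
    + 16 * a ^ 4 * (1 + m ^ 2)) * hm - (y ^ 2 + z ^ 2 - e ^ 2 - 4 * a ^ 2) * hc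

theorem Sep.eq_of_triple (h : Sep f (fun t => t)) :
    ∃ s : ℂ, s ^ 2 = 1 ∧ ∀ x y z, triq f x y z =
      s * (-(1 / 2) * (x * y + y * z + x * z) + 1 / 4 * (x ^ 2 + y ^ 2 + z ^ 2)) := by
  have hq : ∀ t, quart ![0, 1, 0, 0, 0] t = t := fun t => by simp [quart]
  have h' : Sep f (quart ![0, 1, 0, 0, 0]) := by rwa [funext hq]
  obtain ⟨t22, t21, t20, t12, t11, t10, t02, t01⟩ := h'.top_eq_zero rfl rfl (by simp)
  have ha : f 2 0 0 ≠ 0 := by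
    intro t00
    have := h'.sq_eq_of_top_eq_zero rfl rfl (by
      intro j k; fin_cases j <;> fin_cases k <;> assumption) (by simp)
    simp at this
  obtain ⟨m, n, o, q, hF, hxz, hxy⟩ := h'.exists_of_top_const rfl rfl t22 t21 t20 t12 t11 t10 t02
    t01 rfl
  set a := f 2 0 0
  simp only [hq] at hF hxz hxy
  replace hxz : ∀ x z, z * (z - 4 * (2 * a * x + o * z + q) * (m * z + n) - 16 * a ^ 2 * x) = 0 :=
    fun x z => by
      have := hxz x z
      simp at this
      rw [← mul_eq_zero] at this
      linear_combination this
  replace hxy : ∀ x y, y * (y - 4 * (2 * a * x + n * y + q) * (m * y + o) - 16 * a ^ 2 * x) = 0 :=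
    fun x y => by
      have := hxy x y
      simp at this
      rw [← mul_eq_zero] at this
      linear_combination this
  obtain ⟨hm, hn, -⟩ := quadratic_coeffs_eq_zero (a2 := -8 * a * m)
    (a1 := -8 * a * (n + 2 * a)) (a0 := 0) (fun z => by linear_combination hxz 1 z - hxz 0 z)
  obtain ⟨-, ho, -⟩ := quadratic_coeffs_eq_zero (a2 := -8 * a * m)
    (a1 := -8 * a * (o + 2 * a)) (a0 := 0) (fun z => by linear_combination hxy 1 z - hxy 0 z)
  have hm : m = 0 := by simpa [ha] using hm
  have hn : n + 2 * a = 0 := by simpa [ha] using hn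
  have ho : o + 2 * a = 0 := by simpa [ha] using ho
  obtain rfl := eq_neg_of_add_eq_zero_left hn
  obtain rfl := eq_neg_of_add_eq_zero_left ho
  subst hm
  obtain ⟨h2, h1, -⟩ := quadratic_coeffs_eq_zero (a2 := 1 - 16 * a ^ 2)
    (a1 := 8 * a * q) (a0 := 0) (fun z => by linear_combination hxz 0 z)
  have hq0 : q = 0 := by simpa [ha] using h1
  -- The x²-coefficient a has to be s/4.
  refine ⟨4 * a, by linear_combination -h2, fun x y z => ?_⟩
  refine mul_left_cancel₀ (mul_ne_zero (by norm_num : (4 : ℂ) ≠ 0) ha) ?_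
  rw [hF, hq0]
  linear_combination -y * z * h2

/-- If the constant leading coefficient a vanishes, F is linear and l = 0. Otherwise 4aF = (2ax + ny
+ oz + q)² - 1 with n² = o² = 4a². -/
theorem Sep.eq_of_quadruple (h : Sep f (fun _ => 1)) :
    ∃ l m n s t : ℂ, m ^ 2 - 4 * l * n = 1 ∧ s ^ 2 = 1 ∧ t ^ 2 = 1 ∧ ∀ x y z, triq f x y z =
      l * (x + s * y + t * z) ^ 2 + m * (x + s * y + t * z) + n := by
  have hq : ∀ t, quart ![1, 0, 0, 0, 0] t = 1 := fun t => by simp [quart]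
  have h' : Sep f (quart ![1, 0, 0, 0, 0]) := by rwa [funext hq]
  obtain ⟨t22, t21, t20, t12, t11, t10, t02, t01⟩ := h'.top_eq_zero rfl rfl (by simp)
  by_cases ha : f 2 0 0 = 0
  · have hx := h'.coeffs_x
    have hy := h'.coeffs_y
    have hz := h'.coeffs_z
    have b22 : f 1 2 2 = 0 := by simpa [t22] using hx.c44
    have b21 : f 1 2 1 = 0 := by simpa [t22, t21, t20, b22] using hx.c42
    have b12 : f 1 1 2 = 0 := by simpa [t22, t12, t02, b22] using hx.c24
    have b20 : f 1 2 0 = 0 := by simpa [t20] using hx.c40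
    have b02 : f 1 0 2 = 0 := by simpa [t02] using hx.c04
    have b11 : f 1 1 1 = 0 := by simpa [b22, b21, b12, b20, b02, t22, t21, t20, t12, t11, t10, t02,
      t01, ha] using hx.c22
    have b10 : f 1 1 0 = 0 := by simpa [b20, t20, t10, ha] using hx.c20
    have b01 : f 1 0 1 = 0 := by simpa [b02, t02, t01, ha] using hx.c02
    have b00 : f 1 0 0 ^ 2 = 1 := by simpa [ha] using hx.c00
    have hne : f 1 0 0 ≠ 0 := by intro h0; simp [h0] at b00
    have c22 : f 0 2 2 = 0 := by simpa [b11, b10, b12, b22, b21, b20, b01, b02, hne, t22, t21, t20,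
      t02, t01, ha] using hy.c12
    have c21 : f 0 2 1 = 0 := by simpa [b11, b10, b12, b22, b21, b20, b01, b02, hne, t22, t21, t20,
      t02, t01, ha] using hy.c11
    have c20 : f 0 2 0 = 0 := by simpa [b11, b10, b12, b22, b21, b20, b01, b02, hne, t22, t21, t20,
      t02, t01, ha] using hy.c10
    have c12 : f 0 1 2 = 0 := by simpa [b11, b10, b12, b22, b21, b20, b01, b02, hne, t22, t12, t20,
      t02, t10, ha] using hz.c11
    have c02 : f 0 0 2 = 0 := by simpa [b11, b10, b12, b22, b21, b20, b01, b02, hne, t22, t12, t20,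
      t02, t10, ha] using hz.c10
    have c11 : f 0 1 1 = 0 := by simpa [c12, c22, c21, c20] using hy.c02
    have c10 : f 0 1 0 ^ 2 = 1 := by simpa [c20] using hy.c00
    have c01 : f 0 0 1 ^ 2 = 1 := by simpa [c02] using hz.c00
    -- The coefficient `f 1 0 0` squares to 1 and is its own inverse, so these products are the
    -- ratios to the coefficient of x.
    refine ⟨0, f 1 0 0, f 0 0 0, f 1 0 0 * f 0 1 0, f 1 0 0 * f 0 0 1, by rw [b00]; ring,
      by rw [mul_pow, b00, c10, one_mul], by rw [mul_pow, b00, c01, one_mul], fun x y z => ?_⟩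
    simp only [triq, biq, *]
    linear_combination -(f 0 1 0 * y + f 0 0 1 * z) * b00
  · obtain ⟨m, n, o, q, hF, hxz, hxy⟩ := h'.exists_of_top_const rfl rfl t22 t21 t20 t12 t11 t10
      t02 t01 rfl
    set a := f 2 0 0
    simp only [hq] at hF hxz hxy
    obtain ⟨hm, -, hn⟩ := quadratic_coeffs_eq_zero (a2 := m ^ 2) (a1 := 2 * m * n)
      (a0 := n ^ 2 - 4 * a ^ 2) (fun z => by
        have := hxz 0 z
        simp at this
        linear_combination (1/4) * this)
    obtain ⟨-, -, ho⟩ := quadratic_coeffs_eq_zero (a2 := m ^ 2) (a1 := 2 * m * o)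
      (a0 := o ^ 2 - 4 * a ^ 2) (fun z => by
        have := hxy 0 z
        simp at this
        linear_combination (1/4) * this)
    have hm : m = 0 := by simpa using hm
    refine ⟨a, q, (q ^ 2 - 1) / (4 * a), n / (2 * a), o / (2 * a), by field_simp; ring, ?_, ?_,
      fun x y z => ?_⟩
    · field_simp; linear_combination hn
    · field_simp; linear_combination ho
    · refine mul_left_cancel₀ (mul_ne_zero (by norm_num : (4 : ℂ) ≠ 0) ha) ?_
      rw [hF, hm]
      field_simp
      ring

/-- The polynomials in the four families of the case of two double zeros. -/
def IsTwoDouble (f : Fin 3 → Fin 3 → Fin 3 → ℂ) : Prop :=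
  ∃ l m n : ℂ, m ^ 2 - 4 * l * n = 1 ∧
    ((∀ x y z, triq f x y z = l * x ^ 2 * y ^ 2 + m * x * y * z + n * z ^ 2) ∨
     (∀ x y z, triq f x y z = l * x ^ 2 * z ^ 2 + m * x * y * z + n * y ^ 2) ∨
     (∀ x y z, triq f x y z = l * y ^ 2 * z ^ 2 + m * x * y * z + n * x ^ 2) ∨
     (∀ x y z, triq f x y z = l * x ^ 2 * y ^ 2 * z ^ 2 + m * x * y * z + n))

theorem IsTwoDouble.of_swap_yz (h : IsTwoDouble (fun i j k => f i k j)) : IsTwoDouble f := by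
  obtain ⟨l, m, n, hlmn, h⟩ := h
  have e : ∀ x y z, triq f x y z = triq (fun i j k => f i k j) x z y := fun x y z => by
    simp only [triq, biq]; ring
  refine ⟨l, m, n, hlmn, ?_⟩
  rcases h with h | h | h | h
  · exact Or.inr (Or.inl fun x y z => by rw [e, h]; ring)
  · exact Or.inl fun x y z => by rw [e, h]; ring
  · exact Or.inr (Or.inr (Or.inl fun x y z => by rw [e, h]; ring))
  · exact Or.inr (Or.inr (Or.inr fun x y z => by rw [e, h]; ring))

theorem quart_sq (t : ℂ) : quart ![0, 0, 1, 0, 0] t = t ^ 2 := by simp [quart]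

/-- The third family, with n the constant leading coefficient: the completed square reduces to (2ax
+ myz)² - y²z². -/
theorem Sep.isTwoDouble_of_top_const (h : Sep f (quart ![0, 0, 1, 0, 0]))
    (t22 : f 2 2 2 = 0) (t21 : f 2 2 1 = 0) (t20 : f 2 2 0 = 0) (t12 : f 2 1 2 = 0)
    (t11 : f 2 1 1 = 0) (t10 : f 2 1 0 = 0) (t02 : f 2 0 2 = 0) (t01 : f 2 0 1 = 0)
    (ha : f 2 0 0 ≠ 0) : IsTwoDouble f := by
  obtain ⟨m, n, o, q, hF, hxz, hxy⟩ := h.exists_of_top_const rfl rfl t22 t21 t20 t12 t11 t10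
      t02 t01 rfl
  set a := f 2 0 0
  simp only [quart_sq] at hF hxz hxy
  obtain ⟨-, ho, hq, -, -⟩ := quartic_coeffs_eq_zero (a4 := 0) (a3 := 32 * a * o)
    (a2 := 32 * a * q) (a1 := 0) (a0 := 0) (fun z => by
      have h1 := hxz 1 z
      have h2 := hxz (-1) z
      simp only [Matrix.cons_val] at h1 h2
      linear_combination h1 - h2)
  obtain ⟨-, hn, -, -, -⟩ := quartic_coeffs_eq_zero (a4 := 0) (a3 := 32 * a * n)
    (a2 := 32 * a * q) (a1 := 0) (a0 := 0) (fun z => by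
      have h1 := hxy 1 z
      have h2 := hxy (-1) z
      simp only [Matrix.cons_val] at h1 h2
      linear_combination h1 - h2)
  have ho : o = 0 := by simpa [ha] using ho
  have hq : q = 0 := by simpa [ha] using hq
  have hn : n = 0 := by simpa [ha] using hn
  refine ⟨(m ^ 2 - 1) / (4 * a), m, a, by field_simp; ring, Or.inr (Or.inr (Or.inl
    fun x y z => ?_))⟩
  refine mul_left_cancel₀ (mul_ne_zero (by norm_num : (4 : ℂ) ≠ 0) ha) ?_
  rw [hF, ho, hq, hn]
  field_simp
  ring

/-- Here B = ±yz, and C can contain only y²z², y², z² and 1. The discriminants in y and z allow at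
most one of these monomials, so F is a degenerate member (l = 0 or n = 0) of one of the families. -/
theorem Sep.isTwoDouble_of_top_eq_zero (h : Sep f (quart ![0, 0, 1, 0, 0]))
    (t : ∀ j k, f 2 j k = 0) : IsTwoDouble f := by
  have hx := h.coeffs_x
  have hy := h.coeffs_y
  have hz := h.coeffs_z
  have b22 : f 1 2 2 = 0 := by simpa [t] using hx.c44
  have b21 : f 1 2 1 = 0 := by simpa [t, b22] using hx.c42
  have b12 : f 1 1 2 = 0 := by simpa [t, b22] using hx.c24
  have b20 : f 1 2 0 = 0 := by simpa [t] using hx.c40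
  have b02 : f 1 0 2 = 0 := by simpa [t] using hx.c04
  have b10 : f 1 1 0 = 0 := by simpa [t, b20] using hx.c20
  have b01 : f 1 0 1 = 0 := by simpa [t, b02] using hx.c02
  have b00 : f 1 0 0 = 0 := by simpa [t] using hx.c00
  have b11 : f 1 1 1 ^ 2 = 1 := by
    simpa [t, b22, b21, b12, b20, b02, b10, b01, b00] using hx.c22
  have hne : f 1 1 1 ≠ 0 := by intro h0; simp [h0] at b11
  have c12 : f 0 1 2 = 0 := by simpa [t, b22, b21, b12, b20, b02, b10, b01, b00, hne] using hy.c13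
  have c11 : f 0 1 1 = 0 := by simpa [t, b22, b21, b12, b20, b02, b10, b01, b00, hne] using hy.c12
  have c10 : f 0 1 0 = 0 := by simpa [t, b22, b21, b12, b20, b02, b10, b01, b00, hne] using hy.c11
  have c21 : f 0 2 1 = 0 := by simpa [t, b22, b21, b12, b20, b02, b10, b01, b00, hne] using hz.c13
  have c01 : f 0 0 1 = 0 := by simpa [t, b22, b21, b12, b20, b02, b10, b01, b00, hne] using hz.c11
  have e1 : f 0 2 2 = 0 ∨ f 0 0 2 = 0 := by simpa [c12] using hy.c04
  have e2 : f 0 2 0 = 0 ∨ f 0 0 0 = 0 := by simpa [c10] using hy.c00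
  -- The other four equations exclude the pairs of monomials that share a power of y or z; this one
  -- excludes the remaining pairs y², z² and y²z², 1.
  have e3 : f 0 2 0 * f 0 0 2 + f 0 2 2 * f 0 0 0 = 0 := by
    simpa [c10, c11, c12, c01, c21] using hy.c02
  have e4 : f 0 2 2 = 0 ∨ f 0 2 0 = 0 := by simpa [c21] using hz.c04
  have e5 : f 0 0 2 = 0 ∨ f 0 0 0 = 0 := by simpa [c01] using hz.c00
  have hF : ∀ x y z, triq f x y z = f 0 2 2 * y ^ 2 * z ^ 2 + f 0 2 0 * y ^ 2 + f 0 0 2 * z ^ 2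
      + f 0 0 0 + f 1 1 1 * x * y * z := by
    intro x y z; simp only [triq, biq, *]; ring
  by_cases d22 : f 0 2 2 = 0
  · by_cases d20 : f 0 2 0 = 0
    · by_cases d02 : f 0 0 2 = 0
      · exact ⟨0, f 1 1 1, f 0 0 0, by rw [b11]; ring, Or.inr (Or.inr (Or.inr fun x y z => by
          rw [hF, d22, d20, d02]; ring))⟩
      · have d00 : f 0 0 0 = 0 := e5.resolve_left d02
        exact ⟨0, f 1 1 1, f 0 0 2, by rw [b11]; ring, Or.inl fun x y z => by
          rw [hF, d22, d20, d00]; ring⟩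
    · have d00 : f 0 0 0 = 0 := e2.resolve_left d20
      have d02 : f 0 0 2 = 0 := by simpa [d22, d20] using e3
      exact ⟨0, f 1 1 1, f 0 2 0, by rw [b11]; ring, Or.inr (Or.inl fun x y z => by
        rw [hF, d22, d02, d00]; ring)⟩
  · have d02 : f 0 0 2 = 0 := e1.resolve_left d22
    have d20 : f 0 2 0 = 0 := e4.resolve_left d22
    have d00 : f 0 0 0 = 0 := by simpa [d22, d20] using e3
    exact ⟨f 0 2 2, f 1 1 1, 0, by rw [b11]; ring, Or.inr (Or.inr (Or.inl fun x y z => by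
      rw [hF, d20, d02, d00]; ring))⟩

/-- The leading coefficient is a multiple of y², which gives the first family. -/
theorem Sep.isTwoDouble_of_top_y_sq (h : Sep f (quart ![0, 0, 1, 0, 0]))
    (t22 : f 2 2 2 = 0) (t21 : f 2 2 1 = 0) (t12 : f 2 1 2 = 0)
    (t11 : f 2 1 1 = 0) (t10 : f 2 1 0 = 0) (t02 : f 2 0 2 = 0) (t01 : f 2 0 1 = 0)
    (t00 : f 2 0 0 = 0) (ha : f 2 2 0 ≠ 0) : IsTwoDouble f := by
  have hx := h.coeffs_x
  have hy := h.coeffs_y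
  have hz := h.coeffs_z
  have b22 : f 1 2 2 = 0 := by simpa [t22] using hx.c44
  have b12 : f 1 1 2 = 0 := by simpa [t22, t12, t02, b22] using hx.c24
  have b02 : f 1 0 2 = 0 := by simpa [t02] using hx.c04
  have b01 : f 1 0 1 = 0 := by simpa [t02, t01, t00, b02] using hx.c02
  have b00 : f 1 0 0 = 0 := by simpa [t00] using hx.c00
  have c10 := hx.c30
  have c01 := hx.c21
  have c02 := hx.c22
  have c12 := hx.c32
  have c11 := hx.c31
  have y13 := hy.c13
  have y12 := hy.c12
  have z11 := hz.c11
  simp [*] at c10 c01 c02 c12 c11 y13 y12 z11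
  -- Eliminating `f 0 1 2` leaves `f 1 2 1` times `f 1 1 1 ^ 2 - 4 * f 2 2 0 * f 0 0 2`, a factor
  -- equal to 1 by `c02`. The same elimination gives `b20` and `b10`.
  have b21 : f 1 2 1 = 0 := by
    linear_combination f 2 2 0 * y13 + f 1 1 1 / 2 * c12 - f 1 2 1 * c02
  have c12' : f 0 1 2 = 0 := by simpa [b21, ha] using c12
  simp only [b21, c12'] at y12 c11
  have b20 : f 1 2 0 = 0 := by
    linear_combination f 2 2 0 * y12 + f 1 1 1 / 2 * c11 - f 1 2 0 * c02
  have b10 : f 1 1 0 = 0 := by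
    linear_combination f 2 2 0 * z11 + f 1 1 1 / 2 * c01 - f 1 1 0 * c02
  have c11' : f 0 1 1 = 0 := by simpa [b20, b21, ha] using c11
  have c10' : f 0 1 0 = 0 := by simpa [b20, ha] using c10
  have c01' : f 0 0 1 = 0 := by simpa [b10, ha] using c01
  have c22' : f 0 2 2 = 0 := by simpa [*] using hx.c42
  have c21' : f 0 2 1 = 0 := by simpa [*] using hx.c41
  have c20' : f 0 2 0 = 0 := by simpa [*] using hx.c40
  have c00' : f 0 0 0 = 0 := by simpa [*] using hx.c20
  refine ⟨f 2 2 0, f 1 1 1, f 0 0 2, by linear_combination c02, Or.inl fun x y z => ?_⟩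
  simp only [triq, biq, *]
  ring

/-- The fourth family; the argument is that of `Sep.isTwoDouble_of_top_y_sq` with exponents k of z
replaced by 2 - k. -/
theorem Sep.isTwoDouble_of_top_yz_sq (h : Sep f (quart ![0, 0, 1, 0, 0]))
    (t21 : f 2 2 1 = 0) (t20 : f 2 2 0 = 0) (t12 : f 2 1 2 = 0)
    (t11 : f 2 1 1 = 0) (t10 : f 2 1 0 = 0) (t02 : f 2 0 2 = 0) (t01 : f 2 0 1 = 0)
    (t00 : f 2 0 0 = 0) (ha : f 2 2 2 ≠ 0) : IsTwoDouble f := by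
  have hx := h.coeffs_x
  have hy := h.coeffs_y
  have hz := h.coeffs_z
  have b00 : f 1 0 0 = 0 := by simpa [t00] using hx.c00
  have b02 : f 1 0 2 = 0 := by simpa [t02] using hx.c04
  have b20 : f 1 2 0 = 0 := by simpa [t20] using hx.c40
  have b01 : f 1 0 1 = 0 := by simpa [t00, t01, t02, b00] using hx.c02
  have b10 : f 1 1 0 = 0 := by simpa [t00, t10, t20, b00] using hx.c20
  have c10 := hx.c32
  have c00 := hx.c22
  have c11 := hx.c33
  have c01 := hx.c23
  have y11 := hy.c11
  have y12 := hy.c12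
  have z11 := hz.c11
  simp [*] at c10 c00 c11 c01 y11 y12 z11
  have b21 : f 1 2 1 = 0 := by
    linear_combination f 2 2 2 * y11 + f 1 1 1 / 2 * c10 - f 1 2 1 * c00
  have c10' : f 0 1 0 = 0 := by simpa [b21, ha] using c10
  simp only [b21, c10'] at y12 c11 z11
  have b22 : f 1 2 2 = 0 := by
    linear_combination f 2 2 2 * y12 + f 1 1 1 / 2 * c11 - f 1 2 2 * c00
  have b12 : f 1 1 2 = 0 := by
    linear_combination f 2 2 2 * z11 + f 1 1 1 / 2 * c01 - f 1 1 2 * c00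
  have c11' : f 0 1 1 = 0 := by simpa [b22, ha] using c11
  have c01' : f 0 0 1 = 0 := by simpa [b12, ha] using c01
  have c22' : f 0 2 2 = 0 := by simpa [*] using hx.c44
  have c21' : f 0 2 1 = 0 := by simpa [*] using hx.c43
  have c20' : f 0 2 0 = 0 := by simpa [*] using hx.c42
  have c12' : f 0 1 2 = 0 := by simpa [*] using hx.c34
  have c02' : f 0 0 2 = 0 := by simpa [*] using hx.c24
  refine ⟨f 2 2 2, f 1 1 1, f 0 0 0, by linear_combination c00,
    Or.inr (Or.inr (Or.inr fun x y z => ?_))⟩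
  simp only [triq, biq, *]
  ring

/-- The only finite double zero of t² is 0, so in the leading coefficient (αyz + βy + γz + δ)²
either α = β = 0 or γ = δ = 0. By symmetry in y and z, also α = γ = 0 or β = δ = 0. At most one of
the four coefficients survives, and it selects the family. -/
theorem Sep.isTwoDouble (h : Sep f (fun t => t ^ 2)) : IsTwoDouble f := by
  have h' : Sep f (quart ![0, 0, 1, 0, 0]) := by rwa [funext quart_sq]
  obtain ⟨α, β, γ, δ, q22, q21, q12, q11, q20, q02, q10, q01, q00⟩ := h'.top_sq rfl
  have key : ∀ α β γ δ : ℂ, (∀ z, α * z + β ≠ 0 → quart ![0, 0, 1, 0, 0] z ≠ 0 →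
      (0 : ℂ) = 1 * ((γ * z + δ) / (α * z + β)) ^ 2) → (α = 0 ∧ β = 0) ∨ (γ = 0 ∧ δ = 0) := by
    intro α β γ δ hz
    have hz' : ∀ z, z * (α * z + β) * (γ * z + δ) = 0 := by
      intro z
      by_contra hne
      simp only [mul_eq_zero, not_or] at hne
      have := hz z hne.1.2 (by rw [quart_sq]; exact pow_ne_zero 2 hne.1.1)
      rw [one_mul] at this
      exact pow_ne_zero 2 (div_ne_zero hne.2 hne.1.2) this.symm
    obtain ⟨-, k3, k2, k1, -⟩ := quartic_coeffs_eq_zero (a4 := 0) (a3 := α * γ)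
      (a2 := α * δ + β * γ) (a1 := β * δ) (a0 := 0) (fun z => by linear_combination hz' z)
    grind
  have hl := key α β γ δ fun z hl hP =>
    (h'.double_zero_of_top_sq rfl rfl q22 q21 q12 q11 q20 q02 q10 q01 q00 hl hP).2
  have hr := key α γ β δ fun z hl hP =>
    (h'.swap_yz.double_zero_of_top_sq rfl rfl q22 q12 q21 (q11.trans (by ring)) q02 q20 q01 q10
      q00 hl hP).2
  rcases hl with ⟨hα, hβ⟩ | ⟨hγ, hδ⟩
  · rcases hr with ⟨-, hγ⟩ | ⟨-, hδ⟩
    · subst hα hβ hγ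
      by_cases hδ : δ = 0
      · subst hδ
        exact h'.isTwoDouble_of_top_eq_zero fun j k => by
          fin_cases j <;> fin_cases k <;> simp [*]
      · apply h'.isTwoDouble_of_top_const <;> simp [*]
    · subst hα hβ hδ
      by_cases hγ : γ = 0
      · subst hγ
        exact h'.isTwoDouble_of_top_eq_zero fun j k => by
          fin_cases j <;> fin_cases k <;> simp [*]
      · apply IsTwoDouble.of_swap_yz
        apply h'.swap_yz.isTwoDouble_of_top_y_sq <;> simp [*]
  · rcases hr with ⟨hα, -⟩ | ⟨hβ, -⟩
    · subst hα hγ hδ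
      by_cases hβ : β = 0
      · subst hβ
        exact h'.isTwoDouble_of_top_eq_zero fun j k => by
          fin_cases j <;> fin_cases k <;> simp [*]
      · apply h'.isTwoDouble_of_top_y_sq <;> simp [*]
    · subst hβ hγ hδ
      by_cases hα : α = 0
      · subst hα
        exact h'.isTwoDouble_of_top_eq_zero fun j k => by
          fin_cases j <;> fin_cases k <;> simp [*]
      · apply h'.isTwoDouble_of_top_yz_sq <;> simp [*]

end DiscSep
end

/-! ### Cubic P, with a simple zero at infinity. -/

noncomputable section
namespace DiscSep

variable {f : Fin 3 → Fin 3 → Fin 3 → ℂ} {p : Fin 5 → ℂ}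

/-- If the Taylor expansion of `F` in `x` at a zero of the cubic `P` (possibly at infinity) begins
with `A`, and `A` vanishes at infinity, then `A` is a multiple of `(y - z) ^ 2`. -/
theorem eq_diagonal_sq {A B C : Fin 3 → Fin 3 → ℂ} {κ : ℂ} (h4 : p 4 = 0) (h3 : p 3 ≠ 0)
    (hκ : κ ≠ 0)
    (hx : ∀ y z, biq B y z ^ 2 - 4 * biq A y z * biq C y z = quart p y * quart p z)
    (hy : ∀ z, (A 1 2 * z ^ 2 + A 1 1 * z + A 1 0) ^ 2
      - 4 * (A 2 2 * z ^ 2 + A 2 1 * z + A 2 0) * (A 0 2 * z ^ 2 + A 0 1 * z + A 0 0) = 0)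
    (hz : ∀ y, (A 2 1 * y ^ 2 + A 1 1 * y + A 0 1) ^ 2
      - 4 * (A 2 2 * y ^ 2 + A 1 2 * y + A 0 2) * (A 2 0 * y ^ 2 + A 1 0 * y + A 0 0) = 0)
    (hy' : ∀ z, 2 * (A 1 2 * z ^ 2 + A 1 1 * z + A 1 0) * (B 1 2 * z ^ 2 + B 1 1 * z + B 1 0)
      - 4 * ((A 2 2 * z ^ 2 + A 2 1 * z + A 2 0) * (B 0 2 * z ^ 2 + B 0 1 * z + B 0 0)
        + (A 0 2 * z ^ 2 + A 0 1 * z + A 0 0) * (B 2 2 * z ^ 2 + B 2 1 * z + B 2 0))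
      = κ * quart p z)
    (hz' : ∀ y, 2 * (A 2 1 * y ^ 2 + A 1 1 * y + A 0 1) * (B 2 1 * y ^ 2 + B 1 1 * y + B 0 1)
      - 4 * ((A 2 2 * y ^ 2 + A 1 2 * y + A 0 2) * (B 2 0 * y ^ 2 + B 1 0 * y + B 0 0)
        + (A 2 0 * y ^ 2 + A 1 0 * y + A 0 0) * (B 2 2 * y ^ 2 + B 1 2 * y + B 0 2))
      = κ * quart p y)
    (h22 : A 2 2 = 0) :
    ∃ σ, σ ≠ 0 ∧ A 2 1 = 0 ∧ A 1 2 = 0 ∧ A 2 0 = σ ∧ A 1 1 = -2 * σ ∧ A 0 2 = σ ∧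
      A 1 0 = 0 ∧ A 0 1 = 0 ∧ A 0 0 = 0 := by
  obtain ⟨α, β, γ, δ, q22, q21, q12, q11, q20, q02, q10, q01, q00⟩ :=
    exists_sq_of_discr_eq_zero hy hz
  have hα : α = 0 := by simpa [h22] using q22.symm
  subst hα
  simp only [mul_zero, zero_mul, zero_add] at q22 q21 q12 q11
  have hd := discrCoeffs_of_forall hx
  have hne : ¬ ∀ z, κ * quart p z = 0 := fun h => by
    have h' : ∀ z, quart p z = 0 := fun z => by simpa [hκ] using h z
    exact h3 (quartic_coeffs_eq_zero h').2.1
  -- If β = 0, then A is free of y, and p₄ = 0 forces B to have no y²-term. The polarised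
  -- discriminant in y would be zero instead of κP.
  have hβ : β ≠ 0 := by
    rintro rfl
    have b22 : B 2 2 = 0 := by simpa [q22, h4] using hd.c44
    have b21 : B 2 1 = 0 := by simpa [q22, q21, q20, h4, b22] using hd.c42
    have b20 : B 2 0 = 0 := by simpa [q20, h4] using hd.c40
    exact hne fun z => by rw [← hy' z, q22, q21, q20, q12, q11, q10, b22, b21, b20]; ring
  have hγ : γ ≠ 0 := by
    rintro rfl
    have b22 : B 2 2 = 0 := by simpa [q22, h4] using hd.c44
    have b12 : B 1 2 = 0 := by simpa [q22, q12, q02, h4, b22] using hd.c24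
    have b02 : B 0 2 = 0 := by simpa [q02, h4] using hd.c04
    exact hne fun y => by rw [← hz' y, q22, q12, q02, q21, q11, q01, b22, b12, b02]; ring
  obtain ⟨s, hs⟩ : ∃ s, γ = -β * s := ⟨-γ / β, by field_simp⟩
  obtain ⟨t, ht⟩ : ∃ t, δ = -β * t := ⟨-δ / β, by field_simp⟩
  have hs0 : s ≠ 0 := by rintro rfl; simp [hs] at hγ
  -- A = β²(y - sz - t)², so both polarised discriminants evaluate B at the point (sz + t, z), up to
  -- the factors β² and β²s². Eliminating B gives a symmetry of P; its cubic and quadratic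
  -- coefficients force s = 1 and t = 0.
  have key : ∀ z, s ^ 2 * quart p z = quart p (s * z + t) := by
    intro z
    refine mul_left_cancel₀ hκ ?_
    rw [← hz', mul_left_comm, ← hy', q22, q21, q20, q12, q11, q10, q02, q01, q00, hs, ht]
    ring
  obtain ⟨-, k3, k2, -, -⟩ := quartic_coeffs_eq_zero (a4 := 0) (a3 := p 3 * s ^ 2 * (s - 1))
    (a2 := 3 * p 3 * s ^ 2 * t + p 2 * s ^ 2 - s ^ 2 * p 2)
    (a1 := 3 * p 3 * s * t ^ 2 + 2 * p 2 * s * t + p 1 * s - s ^ 2 * p 1)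
    (a0 := p 3 * t ^ 3 + p 2 * t ^ 2 + p 1 * t + p 0 - s ^ 2 * p 0)
    (fun z => by have := key z; simp only [quart, h4] at this; linear_combination -this)
  have hs1 : s = 1 := by simpa [h3, hs0, sub_eq_zero] using k3
  have k2' : 3 * p 3 * s ^ 2 * t = 0 := by linear_combination k2
  have ht0 : t = 0 := by simpa [h3, hs0] using k2'
  refine ⟨β ^ 2, pow_ne_zero 2 hβ, q21, q12, q20, ?_, ?_, ?_, ?_, ?_⟩ <;>
    simp [q11, q02, q10, q01, q00, hs, ht, hs1, ht0]
  ring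

/-- The expansion at the zero ∞: A is the x²-coefficient and κ = p₃, from the x³-coefficients of the
discriminants. -/
theorem Sep.top_eq_diagonal_sq (h : Sep f (quart p)) (h4 : p 4 = 0) (h3 : p 3 ≠ 0)
    (h222 : f 2 2 2 = 0) :
    ∃ σ, σ ≠ 0 ∧ f 2 2 1 = 0 ∧ f 2 1 2 = 0 ∧ f 2 2 0 = σ ∧ f 2 1 1 = -2 * σ ∧ f 2 0 2 = σ ∧
      f 2 1 0 = 0 ∧ f 2 0 1 = 0 ∧ f 2 0 0 = 0 := by
  have hy := h.coeffs_y
  have hz := h.coeffs_z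
  refine eq_diagonal_sq h4 h3 h3 h.discr_x (fun z => ?_) (fun z => ?_) (fun z => ?_) (fun z => ?_)
    h222
  · rw [← zero_mul (quart p z), ← h4, quart]
    linear_combination z ^ 4 * hy.c44 + z ^ 3 * hy.c43 + z ^ 2 * hy.c42 + z * hy.c41 + hy.c40
  · rw [← zero_mul (quart p z), ← h4, quart]
    linear_combination z ^ 4 * hz.c44 + z ^ 3 * hz.c43 + z ^ 2 * hz.c42 + z * hz.c41 + hz.c40
  · rw [quart]
    linear_combination z ^ 4 * hy.c34 + z ^ 3 * hy.c33 + z ^ 2 * hy.c32 + z * hy.c31 + hy.c30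
  · rw [quart]
    linear_combination z ^ 4 * hz.c34 + z ^ 3 * hz.c33 + z ^ 2 * hz.c32 + z * hz.c31 + hz.c30

/-- For a cubic `P` without multiple zeros, `F` vanishes at a diagonal point `(r, r, r)` over a
zero `r` of `P`, possibly at infinity. -/
theorem Sep.exists_diagonal_zero (h : Sep f (quart p)) (h4 : p 4 = 0) (h3 : p 3 ≠ 0)
    (hp : ∀ r, quart p r = 0 → 3 * p 3 * r ^ 2 + 2 * p 2 * r + p 1 ≠ 0) :
    f 2 2 2 = 0 ∨ ∃ r, quart p r = 0 ∧ triq f r r r = 0 := by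
  obtain ⟨α, β, γ, δ, q22, q21, q12, q11, q20, q02, q10, q01, q00⟩ := h.swap_xy.top_sq h4
  have hy := h.coeffs_y
  have hz := h.coeffs_z
  by_cases hα : α = 0
  · left; simp [q22, hα]
  -- The y²-coefficient of F is (αxz + βx + γz + δ)², so the coefficient of y²z² is α²(x - r)² and
  -- vanishes at x = r.
  obtain ⟨r, hr⟩ : ∃ r, γ = -α * r := ⟨-γ / α, by field_simp⟩
  have f12 : f 2 1 2 * r ^ 2 + f 1 1 2 * r + f 0 1 2 = 0 := by
    have e4 := hy.c44; have e3 := hy.c34; have e2 := hy.c24; have e1 := hy.c14; have e0 := hy.c04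
    simp only [h4, mul_zero, q22, q12, q02, hr] at e4 e3 e2 e1 e0
    refine pow_eq_zero_iff two_ne_zero |>.1 ?_
    linear_combination r ^ 4 * e4 + r ^ 3 * e3 + r ^ 2 * e2 + r * e1 + e0
  -- At x = r the coefficients of y²z², yz² and y²z all vanish, hence so does the y³-coefficient
  -- p₃P(r) of the discriminant in z.
  have hPr : quart p r = 0 := by
    have e4 := hz.c43; have e3 := hz.c33; have e2 := hz.c23; have e1 := hz.c13; have e0 := hz.c03
    simp only [q22, q21, q12, q11, q20, q02, q10, q01, q00, hr] at e4 e3 e2 e1 e0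
    refine mul_left_cancel₀ h3 ?_
    rw [quart]
    linear_combination -(r ^ 4 * e4 + r ^ 3 * e3 + r ^ 2 * e2 + r * e1 + e0)
      - 4 * (β * r + δ) ^ 2 * f12
  refine Or.inr ⟨r, hPr, ?_⟩
  have hP' := hp r hPr
  have h22 : f 2 2 2 * r ^ 2 + f 1 2 2 * r + f 0 2 2 = 0 := by
    rw [q22, q12, q02, hr]; ring
  -- The expansion at the finite zero r: A = F(r, y, z), B is the x-derivative there and κ = P'(r) ≠
  -- 0. So F(r, y, z) is a multiple of (y - z)², which vanishes at y = z = r.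
  obtain ⟨σ, -, a21, a12, a20, a11, a02, a10, a01, a00⟩ := eq_diagonal_sq
    (A := fun j k => f 2 j k * r ^ 2 + f 1 j k * r + f 0 j k)
    (B := fun j k => 2 * f 2 j k * r + f 1 j k) (C := fun j k => f 2 j k) h4 h3 hP'
    (fun y z => by
      rw [← h.discr_x y z]; simp only [biq]; ring)
    (fun z => by
      rw [← zero_mul (quart p z), ← hPr, ← h.discr_y r z]; simp only [biq]; ring)
    (fun z => by
      rw [← zero_mul (quart p z), ← hPr, ← h.discr_z r z]; simp only [biq]; ring)
    (fun z => by
      have hh := h.coeffs_y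
      rw [quart]
      linear_combination 4 * r ^ 3 * z ^ 4 * hh.c44 + 4 * r ^ 3 * z ^ 3 * hh.c43 + 4 * r ^ 3 * z ^ 2 * hh.c42 + 4
      * r ^ 3 * z * hh.c41 + 4 * r ^ 3 * hh.c40 + 3 * r ^ 2 * z ^ 4 * hh.c34 + 3 * r ^ 2 * z ^
      3 * hh.c33 + 3 * r ^ 2 * z ^ 2 * hh.c32 + 3 * r ^ 2 * z * hh.c31 + 3 * r ^ 2 * hh.c30 +
      2 * r * z ^ 4 * hh.c24 + 2 * r * z ^ 3 * hh.c23 + 2 * r * z ^ 2 * hh.c22 + 2 * r * z *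
      hh.c21 + 2 * r * hh.c20 + z ^ 4 * hh.c14 + z ^ 3 * hh.c13 + z ^ 2 * hh.c12 + z * hh.c11
      + z ^ 0 * hh.c10
        + 4 * r ^ 3 * (p 4 * z ^ 4 + p 3 * z ^ 3 + p 2 * z ^ 2 + p 1 * z + p 0) * h4)
    (fun z => by
      have hh := h.coeffs_z
      rw [quart]
      linear_combination 4 * r ^ 3 * z ^ 4 * hh.c44 + 4 * r ^ 3 * z ^ 3 * hh.c43 + 4 * r ^ 3 * z ^ 2 * hh.c42 + 4
      * r ^ 3 * z * hh.c41 + 4 * r ^ 3 * hh.c40 + 3 * r ^ 2 * z ^ 4 * hh.c34 + 3 * r ^ 2 * z ^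
      3 * hh.c33 + 3 * r ^ 2 * z ^ 2 * hh.c32 + 3 * r ^ 2 * z * hh.c31 + 3 * r ^ 2 * hh.c30 +
      2 * r * z ^ 4 * hh.c24 + 2 * r * z ^ 3 * hh.c23 + 2 * r * z ^ 2 * hh.c22 + 2 * r * z *
      hh.c21 + 2 * r * hh.c20 + z ^ 4 * hh.c14 + z ^ 3 * hh.c13 + z ^ 2 * hh.c12 + z * hh.c11
      + z ^ 0 * hh.c10
        + 4 * r ^ 3 * (p 4 * z ^ 4 + p 3 * z ^ 3 + p 2 * z ^ 2 + p 1 * z + p 0) * h4)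
    h22
  simp only [triq, biq]
  linear_combination r ^ 4 * h22 + r ^ 3 * (a21 + a12) + r ^ 2 * (a20 + a11 + a02)
    + r * (a10 + a01) + a00

/-- The polynomial with discriminants `P(xⱼ) P(xₖ)`, for a cubic `P`, that vanishes at the
point `(∞, ∞, ∞)`. -/
def cubicForm (p : Fin 5 → ℂ) (x y z : ℂ) : ℂ :=
  p 3 / 4 * (x ^ 2 * y ^ 2 + y ^ 2 * z ^ 2 + z ^ 2 * x ^ 2 - 2 * x * y * z * (x + y + z))
    - p 2 * x * y * z - p 1 / 2 * (x * y + y * z + z * x) - p 0 * (x + y + z)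
    + (p 1 ^ 2 / 4 - p 2 * p 0) / p 3

/-- `h222` says that F vanishes at (∞, ∞, ∞), so each of the three leading coefficients is σ times a
squared difference, with a common σ because they share coefficients. The equation 16σ² = p₃² gives σ
= εp₃/4, and the remaining coefficients follow after division by εp₃. -/
theorem Sep.eq_cubicForm (h : Sep f (quart p)) (h4 : p 4 = 0) (h3 : p 3 ≠ 0)
    (h222 : f 2 2 2 = 0) :
    ∃ ε : ℂ, ε ^ 2 = 1 ∧ ∀ x y z, triq f x y z = ε * cubicForm p x y z := by
  obtain ⟨σ, hσ, x21, x12, x20, x11, x02, x10, x01, x00⟩ := h.top_eq_diagonal_sq h4 h3 h222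
  obtain ⟨σ', -, -, y12, y20, y11, y02, y10, y01, y00⟩ := h.swap_xy.top_eq_diagonal_sq h4 h3 h222
  obtain ⟨σ'', -, -, -, z20, z11, -, z10, z01, z00⟩ :=
    h.swap_yz.swap_xy.top_eq_diagonal_sq h4 h3 h222
  obtain rfl : σ' = σ := y20.symm.trans x20
  obtain rfl : σ'' = σ' := z20.symm.trans x02
  have hx := h.coeffs_x
  have hy := h.coeffs_y
  obtain ⟨ε, hε⟩ : ∃ ε, σ'' = ε * p 3 / 4 := ⟨4 * σ'' / p 3, by field_simp⟩
  have hε2 : ε ^ 2 = 1 := by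
    have := hx.c33
    simp only [h222, x21, x12, x11, y12, y11, y02, y01, z11, z01, hε] at this
    refine mul_left_cancel₀ (pow_ne_zero 2 h3) ?_
    linear_combination this
  have hε0 : ε ≠ 0 := by rintro rfl; simp at hε2
  have hεp : ε * p 3 ≠ 0 := mul_ne_zero hε0 h3
  have e32 := hx.c32
  have e31 := hx.c31
  have e13 := hx.c13
  have e31' := hy.c31
  have e30 := hx.c30
  have e03 := hx.c03
  have e30' := hy.c30
  have e20 := hx.c20
  simp only [h222, x21, x12, x20, x11, x02, x10, x01, x00, y12, y11, y02, y10, y01, y00,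
    z11, z10, z01, z00, hε] at e32 e31 e13 e31' e30 e03 e30' e20
  have c111 : f 1 1 1 = -ε * p 2 := mul_left_cancel₀ hεp (by
    linear_combination -e32 + p 2 * p 3 * hε2)
  have c110 : f 1 1 0 = -ε * p 1 / 2 := mul_left_cancel₀ hεp (by
    linear_combination (-e31 + e13 - e31') / 2 + p 1 * p 3 / 2 * hε2)
  have c101 : f 1 0 1 = -ε * p 1 / 2 := mul_left_cancel₀ hεp (by
    linear_combination (e31 - e13 - e31') / 2 + p 1 * p 3 / 2 * hε2)
  have c011 : f 0 1 1 = -ε * p 1 / 2 := mul_left_cancel₀ hεp (by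
    linear_combination (-e31 - e13 + e31') / 2 + p 1 * p 3 / 2 * hε2)
  have c010 : f 0 1 0 = -ε * p 0 := mul_left_cancel₀ hεp (by
    linear_combination -e30 + p 0 * p 3 * hε2)
  have c001 : f 0 0 1 = -ε * p 0 := mul_left_cancel₀ hεp (by
    linear_combination -e03 + p 0 * p 3 * hε2)
  have c100 : f 1 0 0 = -ε * p 0 := mul_left_cancel₀ hεp (by
    linear_combination -e30' + p 0 * p 3 * hε2)
  have c000 : f 0 0 0 = ε * ((p 1 ^ 2 / 4 - p 2 * p 0) / p 3) := mul_left_cancel₀ hεp (by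
    rw [c110] at e20
    have e : ε * p 3 * (ε * ((p 1 ^ 2 / 4 - p 2 * p 0) / p 3)) =
        ε ^ 2 * (p 1 ^ 2 / 4 - p 2 * p 0) := by field_simp
    rw [e]
    linear_combination -e20 + p 2 * p 0 * hε2)
  refine ⟨ε, hε2, fun x y z => ?_⟩
  simp only [triq, biq, cubicForm, h222, x21, x12, x20, x11, x02, x10, x01, x00, y12, y11,
    y02, y10, y01, y00, z11, z10, z01, z00, hε, c111, c110, c101, c011, c010,
    c001, c100, c000]
  ring

end DiscSep
end

/-! ### The listed polynomials are strongly separable. -/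

noncomputable section
namespace DiscSep

theorem isStronglySeparable_FA (k : ℂ) : IsStronglySeparable (FA k) (PA k) := by
  refine (isStronglySeparable_iff (f := ![![![-1 / 2, 0, 1 / 2], ![0, 0, 0], ![1 / 2, 0, -k ^ 2 / 2]],
    ![![0, 0, 0], ![0, 1 - k ^ 2, 0], ![0, 0, 0]],
    ![![1 / 2, 0, -k ^ 2 / 2], ![0, 0, 0], ![-k ^ 2 / 2, 0, k ^ 2 / 2]]]) (fun v => ?_) _).2 ⟨?_, ?_, ?_⟩
  · simp [FA, triq, biq]; ring
  all_goals
    intro u w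
    simp [biq, PA]
    ring

theorem isStronglySeparable_FB (e : ℂ) : IsStronglySeparable (FB e) (PB e) := by
  refine (isStronglySeparable_iff (f := ![![![-e ^ 3 / 2, 0, e / 2], ![0, 0, 0], ![e / 2, 0, 0]],
    ![![0, 0, 0], ![0, 1, 0], ![0, 0, 0]],
    ![![e / 2, 0, 0], ![0, 0, 0], ![0, 0, 0]]]) (fun v => ?_) _).2 ⟨?_, ?_, ?_⟩
  · simp [FB, triq, biq]; ring
  all_goals
    intro u w
    simp [biq, PB]
    ring

theorem isStronglySeparable_FC1 {l m n : ℂ} (h : m ^ 2 - 4 * l * n = 1) : IsStronglySeparable (FC1 l m n) PC := by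
  refine (isStronglySeparable_iff (f := ![![![0, 0, n], ![0, 0, 0], ![0, 0, 0]],
    ![![0, 0, 0], ![0, m, 0], ![0, 0, 0]],
    ![![0, 0, 0], ![0, 0, 0], ![l, 0, 0]]]) (fun v => ?_) _).2 ⟨?_, ?_, ?_⟩
  · simp [FC1, triq, biq]; ring
  all_goals
    intro u w
    simp [biq, PC]
    linear_combination u ^ 2 * w ^ 2 * h

theorem isStronglySeparable_FC2 {l m n : ℂ} (h : m ^ 2 - 4 * l * n = 1) : IsStronglySeparable (FC2 l m n) PC := by
  refine (isStronglySeparable_iff (f := ![![![0, 0, 0], ![0, 0, 0], ![n, 0, 0]],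
    ![![0, 0, 0], ![0, m, 0], ![0, 0, 0]],
    ![![0, 0, l], ![0, 0, 0], ![0, 0, 0]]]) (fun v => ?_) _).2 ⟨?_, ?_, ?_⟩
  · simp [FC2, triq, biq]; ring
  all_goals
    intro u w
    simp [biq, PC]
    linear_combination u ^ 2 * w ^ 2 * h

theorem isStronglySeparable_FC3 {l m n : ℂ} (h : m ^ 2 - 4 * l * n = 1) : IsStronglySeparable (FC3 l m n) PC := by
  refine (isStronglySeparable_iff (f := ![![![0, 0, 0], ![0, 0, 0], ![0, 0, l]],
    ![![0, 0, 0], ![0, m, 0], ![0, 0, 0]],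
    ![![n, 0, 0], ![0, 0, 0], ![0, 0, 0]]]) (fun v => ?_) _).2 ⟨?_, ?_, ?_⟩
  · simp [FC3, triq, biq]; ring
  all_goals
    intro u w
    simp [biq, PC]
    linear_combination u ^ 2 * w ^ 2 * h

theorem isStronglySeparable_FC4 {l m n : ℂ} (h : m ^ 2 - 4 * l * n = 1) : IsStronglySeparable (FC4 l m n) PC := by
  refine (isStronglySeparable_iff (f := ![![![n, 0, 0], ![0, 0, 0], ![0, 0, 0]],
    ![![0, 0, 0], ![0, m, 0], ![0, 0, 0]],
    ![![0, 0, 0], ![0, 0, 0], ![0, 0, l]]]) (fun v => ?_) _).2 ⟨?_, ?_, ?_⟩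
  · simp [FC4, triq, biq]; ring
  all_goals
    intro u w
    simp [biq, PC]
    linear_combination u ^ 2 * w ^ 2 * h

theorem isStronglySeparable_FD : IsStronglySeparable FD PD := by
  refine (isStronglySeparable_iff (f := ![![![0, 0, 1 / 4], ![0, -1 / 2, 0], ![1 / 4, 0, 0]],
    ![![0, -1 / 2, 0], ![-1 / 2, 0, 0], ![0, 0, 0]],
    ![![1 / 4, 0, 0], ![0, 0, 0], ![0, 0, 0]]]) (fun v => ?_) _).2 ⟨?_, ?_, ?_⟩
  · simp [FD, triq, biq]; ring
  all_goals
    intro u w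
    simp [biq, PD]
    ring

theorem isStronglySeparable_FE1 {l m n : ℂ} (h : m ^ 2 - 4 * l * n = 1) : IsStronglySeparable (FE1 l m n) PE := by
  refine (isStronglySeparable_iff (f := ![![![n, m, l], ![m, 2 * l, 0], ![l, 0, 0]],
    ![![m, 2 * l, 0], ![2 * l, 0, 0], ![0, 0, 0]],
    ![![l, 0, 0], ![0, 0, 0], ![0, 0, 0]]]) (fun v => ?_) _).2 ⟨?_, ?_, ?_⟩
  · simp [FE1, triq, biq]; ring
  all_goals
    intro u w
    simp [biq, PE]
    linear_combination h

theorem isStronglySeparable_FE2 {l m n : ℂ} (h : m ^ 2 - 4 * l * n = 1) : IsStronglySeparable (FE2 l m n) PE := by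
  refine (isStronglySeparable_iff (f := ![![![n, m, l], ![m, 2 * l, 0], ![l, 0, 0]],
    ![![-m, -(2 * l), 0], ![-(2 * l), 0, 0], ![0, 0, 0]],
    ![![l, 0, 0], ![0, 0, 0], ![0, 0, 0]]]) (fun v => ?_) _).2 ⟨?_, ?_, ?_⟩
  · simp [FE2, triq, biq]; ring
  all_goals
    intro u w
    simp [biq, PE]
    linear_combination h

theorem isStronglySeparable_FE3 {l m n : ℂ} (h : m ^ 2 - 4 * l * n = 1) : IsStronglySeparable (FE3 l m n) PE := by
  refine (isStronglySeparable_iff (f := ![![![n, m, l], ![-m, -(2 * l), 0], ![l, 0, 0]],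
    ![![m, 2 * l, 0], ![-(2 * l), 0, 0], ![0, 0, 0]],
    ![![l, 0, 0], ![0, 0, 0], ![0, 0, 0]]]) (fun v => ?_) _).2 ⟨?_, ?_, ?_⟩
  · simp [FE3, triq, biq]; ring
  all_goals
    intro u w
    simp [biq, PE]
    linear_combination h

theorem isStronglySeparable_FE4 {l m n : ℂ} (h : m ^ 2 - 4 * l * n = 1) : IsStronglySeparable (FE4 l m n) PE := by
  refine (isStronglySeparable_iff (f := ![![![n, -m, l], ![m, -(2 * l), 0], ![l, 0, 0]],
    ![![m, -(2 * l), 0], ![2 * l, 0, 0], ![0, 0, 0]],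
    ![![l, 0, 0], ![0, 0, 0], ![0, 0, 0]]]) (fun v => ?_) _).2 ⟨?_, ?_, ?_⟩
  · simp [FE4, triq, biq]; ring
  all_goals
    intro u w
    simp [biq, PE]
    linear_combination h

end DiscSep
end

/-! ### Zeros on the projective line and their multiplicities. -/

noncomputable section
namespace DiscSep

open Polynomial

/-- The linear form `u X + v`. -/
def lin (u v : ℂ) : Polynomial ℂ := C u * X + C v

theorem eval_lin (u v t : ℂ) : (lin u v).eval t = u * t + v := by simp [lin]

/-- The linear form that vanishes at a given point of the projective line, `none` being the point
at infinity. -/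
def pointForm : Option ℂ → Polynomial ℂ
  | some s => X - C s
  | none => 1

open Classical in
-- Puts ∞ on the same footing as the finite zeros: among four points, `none` occurs 4 - deg P times,
-- and the `if` in `rootStructure` drops it when that number is zero.
theorem rootStructure_C_mul_prod {c : ℂ} (hc : c ≠ 0) {S : Multiset (Option ℂ)}
    (hS : Multiset.card S = 4) :
    rootStructure (C c * (S.map pointForm).prod) = S.dedup.map fun s => S.count s := by
  have hdecomp : ∀ S : Multiset (Option ℂ), S = (S.filterMap id).map some
      + Multiset.replicate (S.count none) none := by
    intro S
    induction S using Multiset.induction_on with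
    | empty => simp
    | cons s S ih =>
      rcases s with _ | s
      · rw [Multiset.filterMap_cons_none _ _ rfl, Multiset.count_cons_self,
          Multiset.replicate_succ, Multiset.add_cons, ← ih]
      · rw [Multiset.filterMap_cons_some id (some s) S rfl, Multiset.map_cons, Multiset.cons_add,
          Multiset.count_cons_of_ne (by simp), ← ih]
  obtain ⟨T, n, rfl⟩ : ∃ (T : Multiset ℂ) (n : ℕ), S = T.map some + Multiset.replicate n none :=
    ⟨_, _, hdecomp S⟩
  have hcard : Multiset.card T + n = 4 := by simpa using hS
  have hprod : ((T.map some + Multiset.replicate n none).map pointForm).prod =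
      (T.map fun a => X - C a).prod := by
    simp [pointForm, Function.comp_def]
  have hroots : (C c * (T.map fun a => X - C a).prod).roots = T := by
    rw [roots_C_mul _ hc, roots_multiset_prod_X_sub_C]
  have hdeg : (C c * (T.map fun a => X - C a).prod).natDegree = Multiset.card T := by
    rw [natDegree_C_mul hc, natDegree_multiset_prod_X_sub_C_eq_card]
  have hdedup : (T.map some + Multiset.replicate n none).dedup =
      T.dedup.map some + if n = 0 then 0 else {none} := by
    refine (Multiset.Nodup.ext (Multiset.nodup_dedup _) ?_).2 fun s => ?_
    · refine Multiset.nodup_add.2 ⟨(Multiset.nodup_dedup T).map (Option.some_injective _), ?_, ?_⟩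
      · split_ifs <;> simp
      · by_cases hn : n = 0 <;> simp [hn, Multiset.disjoint_left]
    · rcases s with _ | s
      · by_cases hn : n = 0 <;> simp [hn, Multiset.mem_replicate]
      · by_cases hn : n = 0 <;> simp [hn, Multiset.mem_replicate]
  rw [hprod, rootStructure, hdeg, hdedup, Multiset.map_add, Multiset.map_map,
    Multiset.toFinset_val, hroots]
  congr 1
  · refine Multiset.map_congr rfl fun z _ => ?_
    rw [← count_roots, hroots, Function.comp_apply, Multiset.count_add,
      Multiset.count_map_eq_count' _ _ (Option.some_injective _), Multiset.count_replicate]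
    simp
  · by_cases hn : n = 0
    · have : ¬ Multiset.card T < 4 := by omega
      simp [hn, this]
    · have : Multiset.card T < 4 := by omega
      rw [if_pos this, if_neg hn, Multiset.map_singleton, Multiset.count_add,
        Multiset.count_replicate_self]
      have h0 : Multiset.count (none : Option ℂ) (T.map some) = 0 := by simp
      rw [h0]
      congr 1
      omega

theorem exists_pointForm_prod {P : Polynomial ℂ} (hP : P ≠ 0) (hdeg : P.natDegree ≤ 4) :
    ∃ (c : ℂ) (S : Multiset (Option ℂ)), c ≠ 0 ∧ Multiset.card S = 4 ∧
      P = C c * (S.map pointForm).prod := by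
  have hs := IsAlgClosed.splits P
  have hcard : Multiset.card P.roots = P.natDegree := hs.natDegree_eq_card_roots.symm
  refine ⟨P.leadingCoeff, P.roots.map some + Multiset.replicate (4 - P.natDegree) none,
    leadingCoeff_ne_zero.2 hP, by simp [hcard]; omega, ?_⟩
  conv_lhs => rw [hs.eq_prod_roots]
  simp [pointForm, Function.comp_def]

theorem multiset_card_four_cases {α : Type*} {S : Multiset α} (hS : Multiset.card S = 4) :
    (∃ a b c d, a ≠ b ∧ a ≠ c ∧ a ≠ d ∧ b ≠ c ∧ b ≠ d ∧ c ≠ d ∧ S = {a, b, c, d}) ∨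
    (∃ a b c, a ≠ b ∧ a ≠ c ∧ b ≠ c ∧ S = {a, a, b, c}) ∨
    (∃ a b, a ≠ b ∧ S = {a, a, b, b}) ∨ (∃ a b, a ≠ b ∧ S = {a, a, a, b}) ∨
    (∃ a, S = {a, a, a, a}) := by
  classical
  obtain ⟨a, b, c, d, rfl⟩ := Multiset.card_eq_four.1 hS
  have hperm : ∀ {a b c d a' b' c' d' : α}, [a, b, c, d].Perm [a', b', c', d'] →
      ({a, b, c, d} : Multiset α) = {a', b', c', d'} := fun h => Multiset.coe_eq_coe.2 h
  by_cases hab : a = b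
  · subst hab
    by_cases hac : a = c
    · subst hac
      by_cases had : a = d
      · subst had; exact Or.inr (Or.inr (Or.inr (Or.inr ⟨a, rfl⟩)))
      · exact Or.inr (Or.inr (Or.inr (Or.inl ⟨a, d, had, rfl⟩)))
    · by_cases had : a = d
      · subst had
        exact Or.inr (Or.inr (Or.inr (Or.inl ⟨a, c, hac, hperm (by grind)⟩)))
      · by_cases hcd : c = d
        · subst hcd; exact Or.inr (Or.inr (Or.inl ⟨a, c, hac, rfl⟩))
        · exact Or.inr (Or.inl ⟨a, c, d, hac, had, hcd, rfl⟩)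
  · by_cases hac : a = c
    · subst hac
      by_cases had : a = d
      · subst had
        exact Or.inr (Or.inr (Or.inr (Or.inl ⟨a, b, hab, hperm (by grind)⟩)))
      · by_cases hbd : b = d
        · subst hbd
          exact Or.inr (Or.inr (Or.inl ⟨a, b, hab, hperm (by grind)⟩))
        · exact Or.inr (Or.inl ⟨a, b, d, hab, had, hbd, hperm (by grind)⟩)
    · by_cases had : a = d
      · subst had
        by_cases hbc : b = c
        · subst hbc
          exact Or.inr (Or.inr (Or.inl ⟨a, b, hab, hperm (by grind)⟩))
        · exact Or.inr (Or.inl ⟨a, b, c, hab, hac, hbc, hperm (by grind)⟩)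
      · by_cases hbc : b = c
        · subst hbc
          by_cases hbd : b = d
          · subst hbd
            exact Or.inr (Or.inr (Or.inr (Or.inl ⟨b, a, Ne.symm hab, hperm (by grind)⟩)))
          · exact Or.inr (Or.inl ⟨b, a, d, Ne.symm hab, hbd, had, hperm (by grind)⟩)
        · by_cases hbd : b = d
          · subst hbd
            exact Or.inr (Or.inl ⟨b, a, c, Ne.symm hab, hbc, hac, hperm (by grind)⟩)
          · by_cases hcd : c = d
            · subst hcd
              exact Or.inr (Or.inl ⟨c, a, b, Ne.symm hac, Ne.symm hbc, hab, hperm (by grind)⟩)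
            · exact Or.inl ⟨a, b, c, d, hab, hac, had, hbc, hbd, hcd, rfl⟩

section patterns

variable {c : ℂ} {s t u v : Option ℂ}

theorem rootStructure_of_distinct (hc : c ≠ 0) (h1 : s ≠ t) (h2 : s ≠ u) (h3 : s ≠ v)
    (h4 : t ≠ u) (h5 : t ≠ v) (h6 : u ≠ v) :
    rootStructure (C c * (pointForm s * pointForm t * pointForm u * pointForm v))
      = {1, 1, 1, 1} := by
  classical
  have := rootStructure_C_mul_prod hc (S := {s, t, u, v}) (by simp)
  rw [show ((({s, t, u, v} : Multiset (Option ℂ)).map pointForm).prod) =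
    pointForm s * pointForm t * pointForm u * pointForm v by simp; ring] at this
  rw [this, Multiset.dedup_eq_self.2 (by simp [*])]
  simp [Multiset.count_cons, Multiset.count_singleton, *, Ne.symm h1, Ne.symm h2, Ne.symm h3,
    Ne.symm h4, Ne.symm h5, Ne.symm h6]

theorem rootStructure_of_one_double (hc : c ≠ 0) (h1 : s ≠ t) (h2 : s ≠ u) (h3 : t ≠ u) :
    rootStructure (C c * (pointForm s * pointForm s * pointForm t * pointForm u))
      = {2, 1, 1} := by
  classical
  have := rootStructure_C_mul_prod hc (S := {s, s, t, u}) (by simp)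
  rw [show ((({s, s, t, u} : Multiset (Option ℂ)).map pointForm).prod) =
    pointForm s * pointForm s * pointForm t * pointForm u by simp; ring] at this
  have hd : ({s, s, t, u} : Multiset (Option ℂ)).dedup = {s, t, u} := by
    rw [Multiset.insert_eq_cons, Multiset.dedup_cons_of_mem (by simp),
      Multiset.dedup_eq_self.2 (by simp [*])]
  rw [this, hd]
  simp [Multiset.count_cons, Multiset.count_singleton, *, Ne.symm h1, Ne.symm h2, Ne.symm h3]

theorem rootStructure_of_two_double (hc : c ≠ 0) (h1 : s ≠ t) :
    rootStructure (C c * (pointForm s * pointForm s * pointForm t * pointForm t))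
      = {2, 2} := by
  classical
  have := rootStructure_C_mul_prod hc (S := {s, s, t, t}) (by simp)
  rw [show ((({s, s, t, t} : Multiset (Option ℂ)).map pointForm).prod) =
    pointForm s * pointForm s * pointForm t * pointForm t by simp; ring] at this
  have hd : ({s, s, t, t} : Multiset (Option ℂ)).dedup = {s, t} := by
    rw [Multiset.insert_eq_cons, Multiset.dedup_cons_of_mem (by simp), Multiset.insert_eq_cons,
      Multiset.dedup_cons_of_notMem (by simp [*]), Multiset.insert_eq_cons,
      Multiset.dedup_cons_of_mem (by simp), Multiset.dedup_singleton]
    rfl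
  rw [this, hd]
  simp [Multiset.count_cons, Multiset.count_singleton, *, Ne.symm h1]

theorem rootStructure_of_triple (hc : c ≠ 0) (h1 : s ≠ t) :
    rootStructure (C c * (pointForm s * pointForm s * pointForm s * pointForm t))
      = {3, 1} := by
  classical
  have := rootStructure_C_mul_prod hc (S := {s, s, s, t}) (by simp)
  rw [show ((({s, s, s, t} : Multiset (Option ℂ)).map pointForm).prod) =
    pointForm s * pointForm s * pointForm s * pointForm t by simp; ring] at this
  have hd : ({s, s, s, t} : Multiset (Option ℂ)).dedup = {s, t} := by
    rw [Multiset.insert_eq_cons, Multiset.dedup_cons_of_mem (by simp), Multiset.insert_eq_cons,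
      Multiset.dedup_cons_of_mem (by simp), Multiset.dedup_eq_self.2 (by simp [*])]
  rw [this, hd]
  simp [Multiset.count_cons, Multiset.count_singleton, *, Ne.symm h1]

theorem rootStructure_of_quadruple (hc : c ≠ 0) :
    rootStructure (C c * (pointForm s * pointForm s * pointForm s * pointForm s))
      = {4} := by
  classical
  have := rootStructure_C_mul_prod hc (S := {s, s, s, s}) (by simp)
  rw [show ((({s, s, s, s} : Multiset (Option ℂ)).map pointForm).prod) =
    pointForm s * pointForm s * pointForm s * pointForm s by simp; ring] at this
  have hd : ({s, s, s, s} : Multiset (Option ℂ)).dedup = {s} := by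
    rw [Multiset.insert_eq_cons, Multiset.dedup_cons_of_mem (by simp), Multiset.insert_eq_cons,
      Multiset.dedup_cons_of_mem (by simp), Multiset.insert_eq_cons,
      Multiset.dedup_cons_of_mem (by simp), Multiset.dedup_singleton]
  rw [this, hd]
  simp [Multiset.count_cons, Multiset.count_singleton]

end patterns

theorem rootStructure_PA {k : ℂ} (hk : k ≠ 0) (hk1 : k ^ 2 ≠ 1) :
    rootStructure (PA k) = {1, 1, 1, 1} := by
  have h1 : k ≠ 1 := by rintro rfl; simp at hk1
  have h2 : k ≠ -1 := by rintro rfl; simp at hk1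
  have h3 : k⁻¹ ≠ 1 := by simpa using h1
  have h4 : k⁻¹ ≠ -1 := by rw [Ne, inv_eq_iff_eq_inv]; simpa [inv_neg] using h2
  rw [← rootStructure_of_distinct (c := k ^ 2) (s := some 1) (t := some (-1)) (u := some k⁻¹)
    (v := some (-k⁻¹)) (pow_ne_zero 2 hk)]
  · congr 1
    refine Polynomial.funext fun t => ?_
    simp [PA, pointForm]
    field_simp
    ring
  · norm_num
  · simpa using h3.symm
  · simpa [eq_neg_iff_add_eq_zero, add_comm] using fun h => h4 (by linear_combination h)
  · simpa using h4.symm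
  · simpa using h3.symm
  · simp [eq_neg_iff_add_eq_zero, ← two_mul, hk]

theorem rootStructure_PB {e : ℂ} (he : e ≠ 0) : rootStructure (PB e) = {2, 1, 1} := by
  rw [← rootStructure_of_one_double (c := 1) (s := none) (t := some e) (u := some (-e))
    one_ne_zero (by simp) (by simp) (by simp [eq_neg_iff_add_eq_zero, ← two_mul, he])]
  congr 1
  refine Polynomial.funext fun t => ?_
  simp [PB, pointForm]
  ring

theorem rootStructure_PC : rootStructure PC = {2, 2} := by
  rw [← rootStructure_of_two_double (c := 1) (s := none) (t := some 0) one_ne_zero (by simp)]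
  congr 1
  simp [PC, pointForm, sq]

theorem rootStructure_PD : rootStructure PD = {3, 1} := by
  rw [← rootStructure_of_triple (c := 1) (s := none) (t := some 0) one_ne_zero (by simp)]
  congr 1
  simp [PD, pointForm]

theorem rootStructure_PE : rootStructure PE = {4} := by
  rw [← rootStructure_of_quadruple (c := 1) (s := none) one_ne_zero]
  congr 1
  simp [PE, pointForm]

/-- The coefficients of `pointForm`. -/
def pointCoord : Option ℂ → ℂ × ℂ
  | some s => (1, -s)
  | none => (0, 1)

/-- The five root structures of a nonzero binary quartic, with corresponding factorizations into
linear forms. -/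
theorem rootStructure_cases {P : Polynomial ℂ} (hP : P ≠ 0) (hdeg : P.natDegree ≤ 4) :
    (rootStructure P = {1, 1, 1, 1} ∧ ∃ c u1 v1 u2 v2 u3 v3 u4 v4 : ℂ, c ≠ 0 ∧
      u1 * v2 - u2 * v1 ≠ 0 ∧ u1 * v3 - u3 * v1 ≠ 0 ∧ u1 * v4 - u4 * v1 ≠ 0 ∧
      u2 * v3 - u3 * v2 ≠ 0 ∧ u2 * v4 - u4 * v2 ≠ 0 ∧ u3 * v4 - u4 * v3 ≠ 0 ∧
      P = C c * (lin u1 v1 * lin u2 v2 * lin u3 v3 * lin u4 v4)) ∨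
    (rootStructure P = {2, 1, 1} ∧ ∃ c u1 v1 u2 v2 u3 v3 : ℂ, c ≠ 0 ∧
      u1 * v2 - u2 * v1 ≠ 0 ∧ u1 * v3 - u3 * v1 ≠ 0 ∧ u2 * v3 - u3 * v2 ≠ 0 ∧
      P = C c * (lin u1 v1 * lin u1 v1 * lin u2 v2 * lin u3 v3)) ∨
    (rootStructure P = {2, 2} ∧ ∃ c u1 v1 u2 v2 : ℂ, c ≠ 0 ∧ u1 * v2 - u2 * v1 ≠ 0 ∧
      P = C c * (lin u1 v1 * lin u1 v1 * lin u2 v2 * lin u2 v2)) ∨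
    (rootStructure P = {3, 1} ∧ ∃ c u1 v1 u2 v2 : ℂ, c ≠ 0 ∧ u1 * v2 - u2 * v1 ≠ 0 ∧
      P = C c * (lin u1 v1 * lin u1 v1 * lin u1 v1 * lin u2 v2)) ∨
    (rootStructure P = {4} ∧ ∃ c u1 v1 : ℂ, c ≠ 0 ∧ (u1 ≠ 0 ∨ v1 ≠ 0) ∧
      P = C c * (lin u1 v1 * lin u1 v1 * lin u1 v1 * lin u1 v1)) := by
  obtain ⟨c, S, hc, hS, rfl⟩ := exists_pointForm_prod hP hdeg
  have hcross : ∀ {s t : Option ℂ}, s ≠ t →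
      (pointCoord s).1 * (pointCoord t).2
      - (pointCoord t).1 * (pointCoord s).2
        ≠ 0 := by
    intro s t hst
    rcases s with _ | s <;> rcases t with _ | t
    · exact absurd rfl hst
    · simp [pointCoord]
    · simp [pointCoord]
    · intro h
      simp [pointCoord] at h
      exact hst (congrArg some (by linear_combination h))
  have hpf : ∀ s : Option ℂ, pointForm s = lin (pointCoord s).1
      (pointCoord s).2 := by
    intro s
    rcases s with _ | r
    · simp [pointForm, lin, pointCoord]
    · simp [pointForm, lin, pointCoord, sub_eq_add_neg]
  have hprod : ∀ a b d e : Option ℂ, (({a, b, d, e} : Multiset (Option ℂ)).map pointForm).prod =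
      pointForm a * pointForm b * pointForm d * pointForm e := by
    intro a b d e; simp; ring
  rcases multiset_card_four_cases hS with ⟨s, t, u, v, h1, h2, h3, h4, h5, h6, rfl⟩ |
    ⟨s, t, u, h1, h2, h3, rfl⟩ | ⟨s, t, h1, rfl⟩ | ⟨s, t, h1, rfl⟩ | ⟨s, rfl⟩
  · refine Or.inl ⟨?_, c, _, _, _, _, _, _, _, _, hc, hcross h1, hcross h2, hcross h3, hcross h4,
      hcross h5, hcross h6, ?_⟩
    · rw [hprod]; exact rootStructure_of_distinct hc h1 h2 h3 h4 h5 h6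
    · rw [hprod, hpf s, hpf t, hpf u, hpf v]
  · refine Or.inr (Or.inl ⟨?_, c, _, _, _, _, _, _, hc, hcross h1, hcross h2, hcross h3, ?_⟩)
    · rw [hprod]; exact rootStructure_of_one_double hc h1 h2 h3
    · rw [hprod, hpf s, hpf t, hpf u]
  · refine Or.inr (Or.inr (Or.inl ⟨?_, c, _, _, _, _, hc, hcross h1, ?_⟩))
    · rw [hprod]; exact rootStructure_of_two_double hc h1
    · rw [hprod, hpf s, hpf t]
  · refine Or.inr (Or.inr (Or.inr (Or.inl ⟨?_, c, _, _, _, _, hc, hcross h1, ?_⟩)))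
    · rw [hprod]; exact rootStructure_of_triple hc h1
    · rw [hprod, hpf s, hpf t]
  · refine Or.inr (Or.inr (Or.inr (Or.inr ⟨?_, c, (pointCoord s).1, (pointCoord s).2, hc, ?_, ?_⟩)))
    · rw [hprod]; exact rootStructure_of_quadruple hc
    · rcases s with _ | r <;> simp [pointCoord]
    · rw [hprod, hpf s]

end DiscSep
end

/-! ### Canonical forms of P under fractional-linear maps. -/

noncomputable section
namespace DiscSep

open Polynomial

theorem exists_GL {a b c d : ℂ} (h : a * d - b * c ≠ 0) :
    ∃ M : GL (Fin 2) ℂ, M 0 0 = a ∧ M 0 1 = b ∧ M 1 0 = c ∧ M 1 1 = d := by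
  refine ⟨Matrix.GeneralLinearGroup.mkOfDetNeZero !![a, b; c, d] ?_, rfl, rfl, rfl, rfl⟩
  rwa [Matrix.det_fin_two_of]

/-- There is a matrix that takes two independent rows to two given independent rows. -/
theorem exists_GL_rows {u1 v1 u2 v2 g1 h1 g2 h2 : ℂ} (hw : u1 * v2 - u2 * v1 ≠ 0)
    (hg : g1 * h2 - g2 * h1 ≠ 0) :
    ∃ M : GL (Fin 2) ℂ, u1 * M 0 0 + v1 * M 1 0 = g1 ∧ u1 * M 0 1 + v1 * M 1 1 = h1 ∧
      u2 * M 0 0 + v2 * M 1 0 = g2 ∧ u2 * M 0 1 + v2 * M 1 1 = h2 := by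
  set D := u1 * v2 - u2 * v1 with hD
  obtain ⟨M, h00, h01, h10, h11⟩ := exists_GL (a := (v2 * g1 - v1 * g2) / D)
    (b := (v2 * h1 - v1 * h2) / D) (c := (u1 * g2 - u2 * g1) / D) (d := (u1 * h2 - u2 * h1) / D) (by
      have : (v2 * g1 - v1 * g2) / D * ((u1 * h2 - u2 * h1) / D)
          - (v2 * h1 - v1 * h2) / D * ((u1 * g2 - u2 * g1) / D) = (g1 * h2 - g2 * h1) / D := by
        field_simp
        rw [hD]; ring
      rw [this]
      exact div_ne_zero hg hw)
  refine ⟨M, ?_, ?_, ?_, ?_⟩ <;> simp only [h00, h01, h10, h11] <;> field_simp <;> rw [hD] <;> ring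

theorem natDegree_lin_prod_le (c u1 v1 u2 v2 u3 v3 u4 v4 : ℂ) :
    (C c * (lin u1 v1 * lin u2 v2 * lin u3 v3 * lin u4 v4)).natDegree ≤ 4 := by
  refine (natDegree_C_mul_le _ _).trans ?_
  have h : ∀ u v, (lin u v).natDegree ≤ 1 := fun u v => natDegree_linear_le
  exact natDegree_mul_le_of_le (natDegree_mul_le_of_le (natDegree_mul_le_of_le (h _ _) (h _ _))
    (h _ _)) (h _ _)

/-- On a product of linear forms the action multiplies each row (u, v) by M, so moving zeros becomes
linear algebra on rows. -/
theorem mobius1_lin_prod (M : GL (Fin 2) ℂ) (c u1 v1 u2 v2 u3 v3 u4 v4 : ℂ) :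
    mobius1 M (C c * (lin u1 v1 * lin u2 v2 * lin u3 v3 * lin u4 v4)) =
      C ((M 0 0 * M 1 1 - M 0 1 * M 1 0) * c) *
        (lin (u1 * M 0 0 + v1 * M 1 0) (u1 * M 0 1 + v1 * M 1 1) *
        lin (u2 * M 0 0 + v2 * M 1 0) (u2 * M 0 1 + v2 * M 1 1) *
        lin (u3 * M 0 0 + v3 * M 1 0) (u3 * M 0 1 + v3 * M 1 1) *
        lin (u4 * M 0 0 + v4 * M 1 0) (u4 * M 0 1 + v4 * M 1 1)) := by
  refine polynomial_ext_of_generic (den_ne_zero M) fun t ht => ?_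
  rw [eval_mobius1 (natDegree_lin_prod_le _ _ _ _ _ _ _ _ _) M ht]
  simp only [eval_mul, eval_C, eval_lin, moebius]
  rw [eval_den] at ht ⊢
  field_simp
  ring

/-- The scalar matrix with entry `t`. -/
theorem exists_scalar {t : ℂ} (ht : t ≠ 0) :
    ∃ N : GL (Fin 2) ℂ, N 0 0 = t ∧ N 0 1 = 0 ∧ N 1 0 = 0 ∧ N 1 1 = t :=
  exists_GL (by simpa using ht)

/-- The exponent is 2 from the determinant plus 4 from the denominator. It agrees with the three
squared denominators in `mobius3_scalar`. -/
theorem mobius1_scalar {P : Polynomial ℂ} (hP : P.natDegree ≤ 4) {N : GL (Fin 2) ℂ} {t : ℂ}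
    (ht : t ≠ 0) (hN : N 0 0 = t ∧ N 0 1 = 0 ∧ N 1 0 = 0 ∧ N 1 1 = t) :
    mobius1 N P = C (t ^ 6) * P := by
  obtain ⟨h00, h01, h10, h11⟩ := hN
  refine polynomial_ext_of_generic (den_ne_zero N) fun x hx => ?_
  rw [eval_mobius1 hP N hx, moebius, eval_den, h00, h01, h10, h11, eval_mul, eval_C]
  rw [show (t * x + 0) / (0 * x + t) = x by rw [add_zero, zero_mul, zero_add]; field_simp]
  ring

theorem mobius3_scalar {F : Poly3} (hF : ∀ i, F.degreeOf i ≤ 2) {N : GL (Fin 2) ℂ} {t : ℂ}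
    (ht : t ≠ 0) (hN : N 0 0 = t ∧ N 0 1 = 0 ∧ N 1 0 = 0 ∧ N 1 1 = t) :
    mobius3 N F = MvPolynomial.C (t ^ 6) * F := by
  obtain ⟨h00, h01, h10, h11⟩ := hN
  refine mvPolynomial_ext_of_generic (den_ne_zero N) fun v hv => ?_
  have hm : ∀ x, moebius N x = x := fun x => by
    rw [moebius, h00, h01, h10, h11, add_zero, zero_mul, zero_add]; field_simp
  rw [eval_mobius3 hF N hv, Fin.prod_univ_three]
  simp only [hm, eval_den, h10, h11, map_mul, MvPolynomial.eval_C]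
  ring

/-- A nonzero constant factor can be removed by a scalar matrix. -/
theorem exists_mobius1_eq_of_C_mul {P Q : Polynomial ℂ} (hP : P.natDegree ≤ 4)
    {M : GL (Fin 2) ℂ} {κ : ℂ} (hκ : κ ≠ 0) (h : mobius1 M P = C κ * Q) :
    ∃ (M' : GL (Fin 2) ℂ) (t : ℂ), mobius1 M' P = Q ∧ M' 0 0 = M 0 0 * t ∧ M' 0 1 = M 0 1 * t ∧
      M' 1 0 = M 1 0 * t ∧ M' 1 1 = M 1 1 * t := by
  obtain ⟨t, ht⟩ : ∃ t : ℂ, t ^ 6 = κ⁻¹ :=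
    ⟨_, Complex.cpow_nat_inv_pow κ⁻¹ (by norm_num : (6 : ℕ) ≠ 0)⟩
  have ht0 : t ≠ 0 := by
    rintro rfl
    exact hκ (by simpa using ht.symm)
  obtain ⟨N, hN⟩ := exists_scalar ht0
  refine ⟨M * N, t, ?_, ?_, ?_, ?_, ?_⟩
  · rw [← mobius1_mobius1 hP, mobius1_scalar (natDegree_mobius1_le hP M) ht0 hN, h, ht, ← mul_assoc,
      ← C_mul, inv_mul_cancel₀ hκ, C_1, one_mul]
  all_goals
    rw [mul_entries]
    simp [hN]

theorem exists_comb {u1 v1 u2 v2 : ℂ} (h : u1 * v2 - u2 * v1 ≠ 0) (u v : ℂ) :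
    ∃ α β : ℂ, u = α * u1 + β * u2 ∧ v = α * v1 + β * v2 ∧
      α * (u1 * v2 - u2 * v1) = u * v2 - u2 * v ∧ β * (u1 * v2 - u2 * v1) = u1 * v - u * v1 := by
  set D := u1 * v2 - u2 * v1 with hD
  refine ⟨(u * v2 - u2 * v) / D, (u1 * v - u * v1) / D, ?_, ?_,
    div_mul_cancel₀ _ h, div_mul_cancel₀ _ h⟩
  · field_simp; rw [hD]; ring
  · field_simp; rw [hD]; ring

/-- Four distinct points are carried to the zeros of some `PA k`, the first one to `-1`. -/
theorem exists_mobius1_eq_PA {c u1 v1 u2 v2 u3 v3 u4 v4 : ℂ} (hc : c ≠ 0)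
    (h12 : u1 * v2 - u2 * v1 ≠ 0) (h13 : u1 * v3 - u3 * v1 ≠ 0) (h14 : u1 * v4 - u4 * v1 ≠ 0)
    (h23 : u2 * v3 - u3 * v2 ≠ 0) (h24 : u2 * v4 - u4 * v2 ≠ 0) (h34 : u3 * v4 - u4 * v3 ≠ 0) :
    ∃ (M : GL (Fin 2) ℂ) (k : ℂ), k ≠ 0 ∧ k ^ 2 ≠ 1 ∧
      mobius1 M (C c * (lin u1 v1 * lin u2 v2 * lin u3 v3 * lin u4 v4)) = PA k ∧
      u1 * M 0 0 + v1 * M 1 0 = u1 * M 0 1 + v1 * M 1 1 := by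
  obtain ⟨β, α, hu3, hv3, hβ, hα⟩ := exists_comb h12 u3 v3
  obtain ⟨δ, γ, hu4, hv4, hδ, hγ⟩ := exists_comb h12 u4 v4
  have hβ0 : β ≠ 0 := by rintro rfl; exact h23 (by linear_combination hβ)
  have hα0 : α ≠ 0 := by rintro rfl; exact h13 (by linear_combination -hα)
  have hδ0 : δ ≠ 0 := by rintro rfl; exact h24 (by linear_combination hδ)
  have hγ0 : γ ≠ 0 := by rintro rfl; exact h14 (by linear_combination -hγ)
  have hne : β * γ ≠ α * δ := by
    intro h
    apply h34
    rw [hu3, hv3, hu4, hv4]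
    linear_combination (u1 * v2 - u2 * v1) * h
  -- With forms l₃ = βl₁ + αl₂ and l₄ = δl₁ + γl₂, send l₁ to τ(x + 1) and l₂ to x - 1. The images
  -- of l₃ and l₄ are proportional to kx + 1 and kx - 1 for a common k exactly when τ²βδ = αγ.
  obtain ⟨τ, hτ⟩ : ∃ τ : ℂ, τ ^ 2 = α * γ / (β * δ) :=
    ⟨_, Complex.cpow_nat_inv_pow _ two_ne_zero⟩
  have hτ' : τ ^ 2 * (β * δ) = α * γ := by rw [hτ]; field_simp
  have hτ0 : τ ≠ 0 := by
    rintro rfl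
    exact mul_ne_zero hα0 hγ0 (by linear_combination -hτ')
  have hm : β * τ - α ≠ 0 := by
    intro h
    apply hne
    refine mul_left_cancel₀ hα0 ?_
    linear_combination -β * hτ' + δ * (β * τ + α) * h
  have hp : β * τ + α ≠ 0 := by
    intro h
    apply hne
    refine mul_left_cancel₀ hα0 ?_
    linear_combination -β * hτ' + δ * (β * τ - α) * h
  have hm' : γ - δ * τ ≠ 0 := by
    intro h
    apply hne
    refine mul_left_cancel₀ hγ0 ?_
    linear_combination δ * hτ' + β * (γ + δ * τ) * h
  have hk : (β * τ + α) * (γ - δ * τ) = (γ + δ * τ) * (β * τ - α) := by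
    linear_combination -2 * hτ'
  obtain ⟨M, m1, m2, m3, m4⟩ := exists_GL_rows (g1 := τ) (h1 := τ) (g2 := 1) (h2 := -1) h12 (by
    rw [show τ * -1 - 1 * τ = -2 * τ by ring]
    exact mul_ne_zero (by norm_num) hτ0)
  set k := (β * τ + α) / (β * τ - α) with hkdef
  have m5 : u3 * M 0 0 + v3 * M 1 0 = k * (β * τ - α) := by
    rw [hkdef, div_mul_cancel₀ _ hm, hu3, hv3]; linear_combination β * m1 + α * m3
  have m6 : u3 * M 0 1 + v3 * M 1 1 = β * τ - α := by
    rw [hu3, hv3]; linear_combination β * m2 + α * m4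
  have m7 : u4 * M 0 0 + v4 * M 1 0 = k * (γ - δ * τ) := by
    rw [hkdef, div_mul_eq_mul_div, hk, mul_div_cancel_right₀ _ hm, hu4, hv4]
    linear_combination δ * m1 + γ * m3
  have m8 : u4 * M 0 1 + v4 * M 1 1 = -(γ - δ * τ) := by
    rw [hu4, hv4]; linear_combination δ * m2 + γ * m4
  obtain ⟨M', t, hM', e00, e01, e10, e11⟩ := exists_mobius1_eq_of_C_mul (Q := PA k)
    (natDegree_lin_prod_le c u1 v1 u2 v2 u3 v3 u4 v4) (M := M)
    (κ := (M 0 0 * M 1 1 - M 0 1 * M 1 0) * c * τ * (β * τ - α) * (γ - δ * τ))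
    (mul_ne_zero (mul_ne_zero (mul_ne_zero (mul_ne_zero (det_ne_zero M) hc) hτ0) hm) hm') (by
      rw [mobius1_lin_prod, m1, m2, m3, m4, m5, m6, m7, m8]
      refine Polynomial.funext fun x => ?_
      simp only [eval_mul, eval_C, eval_lin, PA, eval_sub, eval_pow, eval_X, eval_one]
      ring)
  refine ⟨M', k, div_ne_zero hp hm, ?_, hM', ?_⟩
  · intro h1
    rw [hkdef, div_pow, div_eq_one_iff_eq (pow_ne_zero 2 hm)] at h1
    have : 4 * (α * β * τ) = 0 := by linear_combination h1
    simp [hα0, hβ0, hτ0] at this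
  · rw [e00, e01, e10, e11]
    linear_combination t * (m1 - m2)

theorem exists_mobius1_eq_PB {c u1 v1 u2 v2 u3 v3 : ℂ} (hc : c ≠ 0)
    (h12 : u1 * v2 - u2 * v1 ≠ 0) (h13 : u1 * v3 - u3 * v1 ≠ 0) (h23 : u2 * v3 - u3 * v2 ≠ 0) :
    ∃ M : GL (Fin 2) ℂ,
      mobius1 M (C c * (lin u1 v1 * lin u1 v1 * lin u2 v2 * lin u3 v3)) = PB 1 := by
  obtain ⟨α, β, hu3, hv3, hα, hβ⟩ := exists_comb h12 u3 v3
  have hα0 : α ≠ 0 := by rintro rfl; exact h23 (by linear_combination hα)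
  have hβ0 : β ≠ 0 := by rintro rfl; exact h13 (by linear_combination -hβ)
  -- The double zero goes to ∞ and l₂ to x - 1; the constant 2β/α turns l₃ = αl₁ + βl₂ into β(x +
  -- 1).
  obtain ⟨M, m1, m2, m3, m4⟩ := exists_GL_rows (g1 := 0) (h1 := 2 * β / α) (g2 := 1) (h2 := -1)
    h12 (by simp [hα0, hβ0])
  have m5 : u3 * M 0 0 + v3 * M 1 0 = β := by
    rw [hu3, hv3]; linear_combination α * m1 + β * m3
  have m6 : u3 * M 0 1 + v3 * M 1 1 = β := by
    have : α * (2 * β / α) = 2 * β := by field_simp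
    rw [hu3, hv3]; linear_combination α * m2 + β * m4 + this
  obtain ⟨M', t, hM', -⟩ := exists_mobius1_eq_of_C_mul (Q := PB 1)
    (natDegree_lin_prod_le c u1 v1 u1 v1 u2 v2 u3 v3) (M := M)
    (κ := (M 0 0 * M 1 1 - M 0 1 * M 1 0) * c * (2 * β / α) ^ 2 * β)
    (mul_ne_zero (mul_ne_zero (mul_ne_zero (det_ne_zero M) hc) (by simp [hα0, hβ0])) hβ0) (by
      rw [mobius1_lin_prod, m1, m2, m3, m4, m5, m6]
      refine Polynomial.funext fun x => ?_
      simp only [eval_mul, eval_C, eval_lin, PB, eval_sub, eval_pow, eval_X]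
      ring)
  exact ⟨M', hM'⟩

theorem exists_mobius1_eq_PC {c u1 v1 u2 v2 : ℂ} (hc : c ≠ 0) (h12 : u1 * v2 - u2 * v1 ≠ 0) :
    ∃ M : GL (Fin 2) ℂ,
      mobius1 M (C c * (lin u1 v1 * lin u1 v1 * lin u2 v2 * lin u2 v2)) = PC := by
  obtain ⟨M, m1, m2, m3, m4⟩ := exists_GL_rows (g1 := 0) (h1 := 1) (g2 := 1) (h2 := 0)
    h12 (by simp)
  obtain ⟨M', t, hM', -⟩ := exists_mobius1_eq_of_C_mul (Q := PC)
    (natDegree_lin_prod_le c u1 v1 u1 v1 u2 v2 u2 v2) (M := M)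
    (κ := (M 0 0 * M 1 1 - M 0 1 * M 1 0) * c) (mul_ne_zero (det_ne_zero M) hc) (by
      rw [mobius1_lin_prod, m1, m2, m3, m4]
      refine Polynomial.funext fun x => ?_
      simp only [eval_mul, eval_C, eval_lin, PC, eval_pow, eval_X]
      ring)
  exact ⟨M', hM'⟩

theorem exists_mobius1_eq_PD {c u1 v1 u2 v2 : ℂ} (hc : c ≠ 0) (h12 : u1 * v2 - u2 * v1 ≠ 0) :
    ∃ M : GL (Fin 2) ℂ,
      mobius1 M (C c * (lin u1 v1 * lin u1 v1 * lin u1 v1 * lin u2 v2)) = PD := by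
  obtain ⟨M, m1, m2, m3, m4⟩ := exists_GL_rows (g1 := 0) (h1 := 1) (g2 := 1) (h2 := 0)
    h12 (by simp)
  obtain ⟨M', t, hM', -⟩ := exists_mobius1_eq_of_C_mul (Q := PD)
    (natDegree_lin_prod_le c u1 v1 u1 v1 u1 v1 u2 v2) (M := M)
    (κ := (M 0 0 * M 1 1 - M 0 1 * M 1 0) * c) (mul_ne_zero (det_ne_zero M) hc) (by
      rw [mobius1_lin_prod, m1, m2, m3, m4]
      refine Polynomial.funext fun x => ?_
      simp only [eval_mul, eval_C, eval_lin, PD, eval_X]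
      ring)
  exact ⟨M', hM'⟩

theorem exists_mobius1_eq_PE {c u1 v1 : ℂ} (hc : c ≠ 0) (h1 : u1 ≠ 0 ∨ v1 ≠ 0) :
    ∃ M : GL (Fin 2) ℂ,
      mobius1 M (C c * (lin u1 v1 * lin u1 v1 * lin u1 v1 * lin u1 v1)) = PE := by
  obtain ⟨u2, v2, h12⟩ : ∃ u2 v2 : ℂ, u1 * v2 - u2 * v1 ≠ 0 := by
    rcases h1 with h | h
    · exact ⟨0, 1, by simpa using h⟩
    · exact ⟨1, 0, by simpa using h⟩
  obtain ⟨M, m1, m2, -, -⟩ := exists_GL_rows (g1 := 0) (h1 := 1) (g2 := 1) (h2 := 0)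
    h12 (by simp)
  obtain ⟨M', t, hM', -⟩ := exists_mobius1_eq_of_C_mul (Q := PE)
    (natDegree_lin_prod_le c u1 v1 u1 v1 u1 v1 u1 v1) (M := M)
    (κ := (M 0 0 * M 1 1 - M 0 1 * M 1 0) * c) (mul_ne_zero (det_ne_zero M) hc) (by
      rw [mobius1_lin_prod, m1, m2]
      refine Polynomial.funext fun x => ?_
      simp only [eval_mul, eval_C, eval_lin, PE, eval_one]
      ring)
  exact ⟨M', hM'⟩

end DiscSep
end

/-! ### Four simple zeros: normalising the diagonal zero. -/

noncomputable section
namespace DiscSep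

theorem poly3_ext_triq {F G : Poly3} {f : Fin 3 → Fin 3 → Fin 3 → ℂ} {g : ℂ → ℂ → ℂ → ℂ}
    (hF : ∀ v : Fin 3 → ℂ, MvPolynomial.eval v F = triq f (v 0) (v 1) (v 2))
    (hf : ∀ x y z, triq f x y z = g x y z)
    (hG : ∀ v : Fin 3 → ℂ, MvPolynomial.eval v G = g (v 0) (v 1) (v 2)) : F = G :=
  MvPolynomial.funext fun v => by rw [hF, hf, hG]

theorem mobius3_C_mul {F : Poly3} (hF : ∀ i, F.degreeOf i ≤ 2) (M : GL (Fin 2) ℂ) (a : ℂ) :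
    mobius3 M (MvPolynomial.C a * F) = MvPolynomial.C a * mobius3 M F := by
  refine mvPolynomial_ext_of_generic (den_ne_zero M) fun v hv => ?_
  rw [eval_mobius3 (fun i => (MvPolynomial.degreeOf_C_mul_le _ _ _).trans (hF i)) M hv,
    map_mul, map_mul, eval_mobius3 hF M hv, MvPolynomial.eval_C, MvPolynomial.eval_C]
  ring

/-- The value of a transformed polynomial at a point that is carried to `(∞, ∞, ∞)`. -/
theorem eval_mobius3_of_den_eq_zero {F : Poly3} {f : Fin 3 → Fin 3 → Fin 3 → ℂ}
    (hF : ∀ v : Fin 3 → ℂ, MvPolynomial.eval v F = triq f (v 0) (v 1) (v 2))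
    (M : GL (Fin 2) ℂ) {t : ℂ} (ht : (den M).eval t = 0) :
    MvPolynomial.eval (fun _ => t) (mobius3 M F) = f 2 2 2 * (M 0 0 * t + M 0 1) ^ 6 := by
  -- `eval_mobius3` is silent where a denominator vanishes. In the expanded sum only the term i = j
  -- = k = 2, free of denominators, survives there.
  have key : mobius3 M F = ∑ i : Fin 3, ∑ j : Fin 3, ∑ k : Fin 3, MvPolynomial.C (f i j k) *
      ∏ l : Fin 3, ((MvPolynomial.C (M 0 0) * MvPolynomial.X l + MvPolynomial.C (M 0 1)) ^
          ((![i, j, k] l : Fin 3) : ℕ) *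
        (MvPolynomial.C (M 1 0) * MvPolynomial.X l + MvPolynomial.C (M 1 1)) ^
          (2 - ((![i, j, k] l : Fin 3) : ℕ))) := by
    refine mvPolynomial_ext_of_generic (den_ne_zero M) fun v hv => ?_
    rw [eval_mobius3 (degreeOf_le_of_eval_eq_triq hF) M hv, hF]
    have h0 := hv 0
    have h1 := hv 1
    have h2 := hv 2
    simp only [eval_den] at h0 h1 h2
    simp only [triq, biq, moebius, Fin.prod_univ_three, eval_den, Fin.sum_univ_three, map_add,
      map_mul, map_pow, MvPolynomial.eval_C, MvPolynomial.eval_X, Matrix.cons_val,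
      Fin.val_zero, Fin.val_one, Fin.val_two]
    field_simp
    ring
  rw [eval_den] at ht
  rw [key]
  simp [Fin.sum_univ_three, Fin.prod_univ_three, ht]
  left
  ring

theorem eq_one_or_eq_neg_one {ε : ℂ} (hε : ε ^ 2 = 1) : ε = 1 ∨ ε = -1 := by
  have : (ε - 1) * (ε + 1) = 0 := by linear_combination hε
  exact (mul_eq_zero.1 this).imp sub_eq_zero.1 eq_neg_of_add_eq_zero_left

/-- A sign can be removed by a scalar matrix. -/
theorem exists_carries_of_sq_eq_one {F G : Poly3} {P Q : Polynomial ℂ} {M : GL (Fin 2) ℂ} {ε : ℂ}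
    (hF : ∀ i, F.degreeOf i ≤ 2) (hP : P.natDegree ≤ 4) (hε : ε ^ 2 = 1)
    (h3 : mobius3 M F = MvPolynomial.C ε * G) (h1 : mobius1 M P = Q) :
    ∃ M' : GL (Fin 2) ℂ, Carries M' F P G Q := by
  rcases eq_one_or_eq_neg_one hε with rfl | rfl
  · exact ⟨M, by simpa using h3, Or.inl h1⟩
  -- As I⁶ = -1, the scalar I changes the sign of both F and P; this is where the second alternative
  -- of `Carries` enters.
  · obtain ⟨N, hN⟩ := exists_scalar Complex.I_ne_zero
    have hI : Complex.I ^ 6 = -1 := by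
      rw [show Complex.I ^ 6 = (Complex.I ^ 2) ^ 3 by ring, Complex.I_sq]; norm_num
    refine ⟨M * N, ?_, Or.inr ?_⟩
    · rw [← mobius3_mobius3 hF, mobius3_scalar (degreeOf_mobius3_le hF M) Complex.I_ne_zero hN, hI,
        h3, ← mul_assoc, ← MvPolynomial.C_mul]
      simp
    · rw [← mobius1_mobius1 hP, mobius1_scalar (natDegree_mobius1_le hP M) Complex.I_ne_zero hN,
        hI, h1]
      simp

theorem PA_eq (k : ℂ) :
    PA k = Polynomial.C 1 * (lin k (-1) * lin k 1 * lin 1 (-1) * lin 1 1) := by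
  refine Polynomial.funext fun x => ?_
  simp only [Polynomial.eval_mul, Polynomial.eval_C, eval_lin, PA, Polynomial.eval_sub,
    Polynomial.eval_pow, Polynomial.eval_X, Polynomial.eval_one]
  ring

/-- Both G and `FA k` vanish at (-1, -1, -1). When the zero -1 of `PA k` is moved to ∞, each becomes
± the same `cubicForm`. -/
theorem eq_FA_of_diagonal_zero {G : Poly3} {k : ℂ} (hk : k ^ 2 ≠ 1)
    (h : IsStronglySeparable G (PA k)) (h0 : MvPolynomial.eval (fun _ => -1) G = 0) :
    ∃ ε : ℂ, ε ^ 2 = 1 ∧ G = MvPolynomial.C ε * FA k := by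
  -- N is the map x ↦ -x/(x + 1), which takes ∞ to -1. N' = -N, and N·N' = -1 acts trivially because
  -- (-1)⁶ = 1.
  obtain ⟨N, n00, n01, n10, n11⟩ := exists_GL (a := -1) (b := 0) (c := 1) (d := 1) (by norm_num)
  obtain ⟨N', n00', n01', n10', n11'⟩ := exists_GL (a := 1) (b := 0) (c := -1) (d := -1)
    (by norm_num)
  have hinv : ∀ H : Poly3, (∀ i, H.degreeOf i ≤ 2) → mobius3 N' (mobius3 N H) = H := by
    intro H hH
    rw [mobius3_mobius3 hH, mobius3_scalar (t := -1) hH (by norm_num)]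
    · norm_num
    · simp [mul_entries, n00, n01, n10, n11, n00', n01', n10', n11']
  have hnorm : ∀ H : Poly3, IsStronglySeparable H (PA k) →
      MvPolynomial.eval (fun _ => -1) H = 0 → ∃ ε : ℂ, ε ^ 2 = 1 ∧ ∀ v : Fin 3 → ℂ,
        MvPolynomial.eval v (mobius3 N H) =
          ε * cubicForm ![-1, -4, k ^ 2 - 5, 2 * (k ^ 2 - 1), 0] (v 0) (v 1) (v 2) := by
    intro H hH hH0
    obtain ⟨f, hf⟩ := exists_triq_of_degreeOf_le (degreeOf_mobius3_le hH.degree_le N)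
    have hs := (isStronglySeparable_iff hf _).1 (sep_mobius hH N)
    have hq : (fun t => (mobius1 N (PA k)).eval t) =
        quart ![-1, -4, k ^ 2 - 5, 2 * (k ^ 2 - 1), 0] := by
      funext t
      rw [PA_eq, mobius1_lin_prod, n00, n01, n10, n11]
      simp [eval_lin, quart]
      ring
    rw [hq] at hs
    have hd := eval_mobius3_of_den_eq_zero hf N' (t := -1) (by
      rw [eval_den, n10', n11']; norm_num)
    rw [hinv H hH.degree_le, hH0, n00', n01'] at hd
    obtain ⟨ε, hε, he⟩ := hs.eq_cubicForm rfl
      (mul_ne_zero two_ne_zero (sub_ne_zero.2 hk)) (by simpa using hd.symm)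
    exact ⟨ε, hε, fun v => by rw [hf, he]⟩
  have hFA := isStronglySeparable_FA k
  obtain ⟨ε, hε, hG⟩ := hnorm G h h0
  obtain ⟨ε', hε', hF⟩ := hnorm (FA k) hFA (by simp [FA]; ring)
  refine ⟨ε * ε', by rw [mul_pow, hε, hε', one_mul], ?_⟩
  have hNG : mobius3 N G = MvPolynomial.C (ε * ε') * mobius3 N (FA k) := by
    refine MvPolynomial.funext fun v => ?_
    rw [map_mul, MvPolynomial.eval_C, hG, hF]
    linear_combination -ε * cubicForm ![-1, -4, k ^ 2 - 5, 2 * (k ^ 2 - 1), 0] (v 0) (v 1) (v 2)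
      * hε'
  rw [← hinv G h.degree_le, hNG, mobius3_C_mul (degreeOf_mobius3_le hFA.degree_le N),
    hinv _ hFA.degree_le]

/-- If `M` carries `-1` to a zero `r` of `F` on the diagonal, then the transformed polynomial
vanishes at `(-1, -1, -1)`. -/
theorem eval_mobius3_eq_zero {F : Poly3} {f : Fin 3 → Fin 3 → Fin 3 → ℂ}
    (hF : ∀ v : Fin 3 → ℂ, MvPolynomial.eval v F = triq f (v 0) (v 1) (v 2))
    {M : GL (Fin 2) ℂ} {u r : ℂ} (hu : u ≠ 0) (hr : triq f r r r = 0)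
    (hM : u * M 0 0 + -(u * r) * M 1 0 = u * M 0 1 + -(u * r) * M 1 1) :
    MvPolynomial.eval (fun _ => -1) (mobius3 M F) = 0 := by
  have hM' : -M 0 0 + M 0 1 = r * (-M 1 0 + M 1 1) := by
    refine mul_left_cancel₀ hu ?_
    linear_combination -hM
  have hden : (den M).eval (-1) ≠ 0 := by
    rw [eval_den]
    intro h
    apply det_ne_zero M
    linear_combination M 0 1 * h - M 1 1 * (hM' + r * h)
  have hm : moebius M (-1) = r := by
    rw [eval_den] at hden
    rw [moebius, div_eq_iff hden]
    linear_combination hM'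
  rw [eval_mobius3 (degreeOf_le_of_eval_eq_triq hF) M fun _ => hden, hm, hF, hr, mul_zero]

/-- The three factors have distinct zeros, so the derivative is nonzero at each: the condition
required by `Sep.exists_diagonal_zero`. -/
theorem cubic_simple_zeros {κ a3 b3 a4 b4 : ℂ} (hκ : κ ≠ 0) (h3 : b3 ≠ 0) (h4 : b4 ≠ 0)
    (h34 : a3 * b4 - a4 * b3 ≠ 0) {r : ℂ} (hr : κ * (r * ((a3 * r + b3) * (a4 * r + b4))) = 0) :
    3 * (κ * (a3 * a4)) * r ^ 2 + 2 * (κ * (a3 * b4 + b3 * a4)) * r + κ * (b3 * b4) ≠ 0 := by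
  intro h
  simp only [mul_eq_zero, hκ, false_or] at hr
  rcases hr with rfl | hr | hr
  · simp [hκ, h3, h4] at h
  · refine mul_ne_zero (mul_ne_zero hκ h3) h34 ?_
    linear_combination -a3 * h + κ * (3 * a4 * (a3 * r - b3) + 2 * (a3 * b4 + b3 * a4)) * hr
  · refine mul_ne_zero (mul_ne_zero hκ h4) h34 ?_
    linear_combination a4 * h - κ * (3 * a3 * (a4 * r - b4) + 2 * (a3 * b4 + b3 * a4)) * hr

/-- A polynomial with separating cubic `κ x (a₃ x + b₃) (a₄ x + b₄)` can be transformed so that it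
vanishes at `(-1, -1, -1)` and the cubic becomes some `PA k`. -/
theorem exists_mobius_diagonal_zero_of_cubic {F : Poly3} {κ a3 b3 a4 b4 : ℂ} (hκ : κ ≠ 0)
    (ha3 : a3 ≠ 0) (ha4 : a4 ≠ 0) (hb3 : b3 ≠ 0) (hb4 : b4 ≠ 0) (h34 : a3 * b4 - a4 * b3 ≠ 0)
    (h : IsStronglySeparable F (Polynomial.C κ * (lin 0 1 * lin 1 0 * lin a3 b3 * lin a4 b4))) :
    ∃ (M : GL (Fin 2) ℂ) (k : ℂ), k ≠ 0 ∧ k ^ 2 ≠ 1 ∧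
      mobius1 M (Polynomial.C κ * (lin 0 1 * lin 1 0 * lin a3 b3 * lin a4 b4)) = PA k ∧
      MvPolynomial.eval (fun _ => -1) (mobius3 M F) = 0 := by
  obtain ⟨f, hf⟩ := exists_triq_of_degreeOf_le h.degree_le
  have hs := (isStronglySeparable_iff hf _).1 h
  set p : Fin 5 → ℂ := ![0, κ * (b3 * b4), κ * (a3 * b4 + b3 * a4), κ * (a3 * a4), 0] with hp
  have hq : ∀ t, quart p t = κ * (t * ((a3 * t + b3) * (a4 * t + b4))) := by
    intro t
    simp [quart, hp]
    ring
  have hq' : (fun t => (Polynomial.C κ * (lin 0 1 * lin 1 0 * lin a3 b3 * lin a4 b4)).eval t) =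
      quart p := by
    funext t
    rw [hq]
    simp only [Polynomial.eval_mul, Polynomial.eval_C, eval_lin]
    ring
  rw [hq'] at hs
  -- The diagonal zero lies over ∞, 0, -b₃/a₃ or -b₄/a₄. The corresponding factor is listed first in
  -- `exists_mobius1_eq_PA`, whose M carries -1 to the zero of the first factor.
  rcases hs.exists_diagonal_zero rfl (mul_ne_zero hκ (mul_ne_zero ha3 ha4)) fun r hr =>
      cubic_simple_zeros hκ hb3 hb4 h34 ((hq r).symm.trans hr) with h222 | ⟨r, hr, hrr⟩
  · obtain ⟨M, k, hk, hk1, hM1, hM⟩ := exists_mobius1_eq_PA (u1 := 0) (v1 := 1) (u2 := 1) (v2 := 0)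
      (u3 := a3) (v3 := b3) (u4 := a4) (v4 := b4) hκ (by simp) (by simpa using ha3)
      (by simpa using ha4) (by simpa using hb3) (by simpa using hb4) h34
    refine ⟨M, k, hk, hk1, hM1, ?_⟩
    rw [eval_mobius3_of_den_eq_zero hf M (by rw [eval_den]; linear_combination -hM), h222, zero_mul]
  · rw [hq] at hr
    simp only [mul_eq_zero, hκ, false_or] at hr
    rcases hr with rfl | hr | hr
    · obtain ⟨M, k, hk, hk1, hM1, hM⟩ := exists_mobius1_eq_PA (u1 := 1) (v1 := 0) (u2 := 0)
        (v2 := 1) (u3 := a3) (v3 := b3) (u4 := a4) (v4 := b4) hκ (by simp) (by simpa using hb3)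
        (by simpa using hb4) (by simpa using ha3) (by simpa using ha4) h34
      refine ⟨M, k, hk, hk1, ?_, eval_mobius3_eq_zero hf one_ne_zero hrr (by simpa using hM)⟩
      rw [← hM1, mul_comm (lin 0 1)]
    · obtain ⟨M, k, hk, hk1, hM1, hM⟩ := exists_mobius1_eq_PA (u1 := a3) (v1 := b3) (u2 := 0)
        (v2 := 1) (u3 := 1) (v3 := 0) (u4 := a4) (v4 := b4) hκ (by simpa using ha3)
        (by simpa using hb3) h34 (by simp) (by simpa using ha4) (by simpa using hb4)
      have hb : b3 = -(a3 * r) := by linear_combination hr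
      refine ⟨M, k, hk, hk1, ?_, eval_mobius3_eq_zero hf ha3 hrr (by rw [← hb]; exact hM)⟩
      rw [← hM1, mul_assoc (lin a3 b3), mul_comm (lin a3 b3)]
    · obtain ⟨M, k, hk, hk1, hM1, hM⟩ := exists_mobius1_eq_PA (u1 := a4) (v1 := b4) (u2 := 0)
        (v2 := 1) (u3 := 1) (v3 := 0) (u4 := a3) (v4 := b3) hκ (by simpa using ha4)
        (by simpa using hb4) (by intro h0; apply h34; linear_combination -h0) (by simp)
        (by simpa using ha3) (by simpa using hb3)
      have hb : b4 = -(a4 * r) := by linear_combination hr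
      refine ⟨M, k, hk, hk1, ?_, eval_mobius3_eq_zero hf ha4 hrr (by rw [← hb]; exact hM)⟩
      rw [← hM1, mul_assoc (lin a4 b4), mul_assoc (lin a4 b4), mul_comm (lin a4 b4)]

theorem exists_mobius_diagonal_zero {F : Poly3} {c u1 v1 u2 v2 u3 v3 u4 v4 : ℂ} (hc : c ≠ 0)
    (h12 : u1 * v2 - u2 * v1 ≠ 0) (h13 : u1 * v3 - u3 * v1 ≠ 0) (h14 : u1 * v4 - u4 * v1 ≠ 0)
    (h23 : u2 * v3 - u3 * v2 ≠ 0) (h24 : u2 * v4 - u4 * v2 ≠ 0) (h34 : u3 * v4 - u4 * v3 ≠ 0)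
    (h : IsStronglySeparable F (Polynomial.C c * (lin u1 v1 * lin u2 v2 * lin u3 v3 * lin u4 v4))) :
    ∃ (M : GL (Fin 2) ℂ) (k : ℂ), k ≠ 0 ∧ k ^ 2 ≠ 1 ∧
      mobius1 M (Polynomial.C c * (lin u1 v1 * lin u2 v2 * lin u3 v3 * lin u4 v4)) = PA k ∧
      MvPolynomial.eval (fun _ => -1) (mobius3 M F) = 0 := by
  have hdeg := natDegree_lin_prod_le c u1 v1 u2 v2 u3 v3 u4 v4
  set P := Polynomial.C c * (lin u1 v1 * lin u2 v2 * lin u3 v3 * lin u4 v4) with hP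
  obtain ⟨N, n1, n2, n3, n4⟩ := exists_GL_rows (g1 := 0) (h1 := 1) (g2 := 1) (h2 := 0)
    h12 (by simp)
  have hN := det_ne_zero N
  obtain ⟨a3, ha3⟩ : ∃ a, a = u3 * N 0 0 + v3 * N 1 0 := ⟨_, rfl⟩
  obtain ⟨b3, hb3⟩ : ∃ a, a = u3 * N 0 1 + v3 * N 1 1 := ⟨_, rfl⟩
  obtain ⟨a4, ha4⟩ : ∃ a, a = u4 * N 0 0 + v4 * N 1 0 := ⟨_, rfl⟩
  obtain ⟨b4, hb4⟩ : ∃ a, a = u4 * N 0 1 + v4 * N 1 1 := ⟨_, rfl⟩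
  -- N sends the first zero to ∞ and the second to 0. It multiplies the 2×2 determinants of pairs of
  -- forms by det N, so the zeros remain distinct.
  have k13 : a3 ≠ 0 := by
    intro h0
    refine mul_ne_zero h13 hN ?_
    linear_combination b3 * n1 - a3 * n2 - h0 + (u1 * N 0 0 + v1 * N 1 0) * (-hb3)
      + (u1 * N 0 1 + v1 * N 1 1) * ha3
  have k14 : a4 ≠ 0 := by
    intro h0
    refine mul_ne_zero h14 hN ?_
    linear_combination b4 * n1 - a4 * n2 - h0 + (u1 * N 0 0 + v1 * N 1 0) * (-hb4)
      + (u1 * N 0 1 + v1 * N 1 1) * ha4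
  have k23 : b3 ≠ 0 := by
    intro h0
    refine mul_ne_zero h23 hN ?_
    linear_combination b3 * n3 - a3 * n4 + h0 + (u2 * N 0 0 + v2 * N 1 0) * (-hb3)
      + (u2 * N 0 1 + v2 * N 1 1) * ha3
  have k24 : b4 ≠ 0 := by
    intro h0
    refine mul_ne_zero h24 hN ?_
    linear_combination b4 * n3 - a4 * n4 + h0 + (u2 * N 0 0 + v2 * N 1 0) * (-hb4)
      + (u2 * N 0 1 + v2 * N 1 1) * ha4
  have k34 : a3 * b4 - a4 * b3 ≠ 0 := by
    rw [ha3, hb3, ha4, hb4]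
    intro h0
    refine mul_ne_zero h34 hN ?_
    linear_combination h0
  obtain ⟨κ, hκ⟩ : ∃ κ, κ = (N 0 0 * N 1 1 - N 0 1 * N 1 0) * c := ⟨_, rfl⟩
  have hκ0 : κ ≠ 0 := by rw [hκ]; exact mul_ne_zero hN hc
  have hQ : mobius1 N P = Polynomial.C κ * (lin 0 1 * lin 1 0 * lin a3 b3 * lin a4 b4) := by
    rw [hP, mobius1_lin_prod, n1, n2, n3, n4, ha3, hb3, ha4, hb4, hκ]
  have hs := sep_mobius h N
  rw [hQ] at hs
  obtain ⟨M, k, hk, hk1, hM1, hM3⟩ :=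
    exists_mobius_diagonal_zero_of_cubic hκ0 k13 k14 k23 k24 k34 hs
  rw [← hQ, mobius1_mobius1 hdeg] at hM1
  rw [mobius3_mobius3 h.degree_le] at hM3
  exact ⟨N * M, k, hk, hk1, hM1, hM3⟩

end DiscSep
end

/-! ### Assembling the classification. -/

noncomputable section
namespace DiscSep

theorem classification_of_simple {F : Poly3} {P : Polynomial ℂ} (h : IsStronglySeparable F P)
    (hdeg : P.natDegree ≤ 4) {M : GL (Fin 2) ℂ} {k : ℂ} (hk1 : k ^ 2 ≠ 1)
    (hM1 : mobius1 M P = PA k) (hM3 : MvPolynomial.eval (fun _ => -1) (mobius3 M F) = 0) :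
    ∃ M' : GL (Fin 2) ℂ, Carries M' F P (FA k) (PA k) := by
  have hs := sep_mobius h M
  rw [hM1] at hs
  obtain ⟨ε, hε, hG⟩ := eq_FA_of_diagonal_zero hk1 hs hM3
  exact exists_carries_of_sq_eq_one h.degree_le hdeg hε hG hM1

theorem classification_of_one_double {F : Poly3} {P : Polynomial ℂ} (h : IsStronglySeparable F P)
    (hdeg : P.natDegree ≤ 4) {M : GL (Fin 2) ℂ} {e : ℂ} (he : e ≠ 0) (hM1 : mobius1 M P = PB e) :
    ∃ (M' : GL (Fin 2) ℂ) (e' : ℂ), e' ≠ 0 ∧ Carries M' F P (FB e') (PB e') := by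
  have hs := sep_mobius h M
  rw [hM1] at hs
  obtain ⟨f, hf⟩ := exists_triq_of_degreeOf_le hs.degree_le
  have hsep := (isStronglySeparable_iff hf _).1 hs
  simp only [PB, Polynomial.eval_sub, Polynomial.eval_pow, Polynomial.eval_X,
    Polynomial.eval_C] at hsep
  obtain ⟨e', ε, he', hε, hF⟩ := hsep.eq_of_two_simple he
  have hG : mobius3 M F = MvPolynomial.C ε * FB e' :=
    poly3_ext_triq hf hF fun v => by simp [FB]
  -- Only the square of e enters P_B, so the possible change of sign from e to e' does not affect
  -- it.
  have hPB : mobius1 M P = PB e' := by rw [hM1, PB, PB, he']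
  obtain ⟨M', hM'⟩ := exists_carries_of_sq_eq_one h.degree_le hdeg hε hG hPB
  refine ⟨M', e', ?_, hM'⟩
  rintro rfl
  exact pow_ne_zero 2 he (by rw [← he']; simp)

theorem classification_of_two_double {F : Poly3} {P : Polynomial ℂ} (h : IsStronglySeparable F P)
    {M : GL (Fin 2) ℂ} (hM1 : mobius1 M P = PC) :
    ∃ (M : GL (Fin 2) ℂ) (l m n : ℂ), m ^ 2 - 4 * l * n = 1 ∧
      (Carries M F P (FC1 l m n) PC ∨ Carries M F P (FC2 l m n) PC ∨
        Carries M F P (FC3 l m n) PC ∨ Carries M F P (FC4 l m n) PC) := by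
  have hs := sep_mobius h M
  rw [hM1] at hs
  obtain ⟨f, hf⟩ := exists_triq_of_degreeOf_le hs.degree_le
  have hsep := (isStronglySeparable_iff hf _).1 hs
  simp only [PC, Polynomial.eval_pow, Polynomial.eval_X] at hsep
  obtain ⟨l, m, n, hlmn, hF⟩ := hsep.isTwoDouble
  refine ⟨M, l, m, n, hlmn, ?_⟩
  rcases hF with hF | hF | hF | hF
  · exact Or.inl ⟨poly3_ext_triq hf hF fun v => by simp [FC1], Or.inl hM1⟩
  · exact Or.inr (Or.inl ⟨poly3_ext_triq hf hF fun v => by simp [FC2], Or.inl hM1⟩)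
  · exact Or.inr (Or.inr (Or.inl ⟨poly3_ext_triq hf hF fun v => by simp [FC3], Or.inl hM1⟩))
  · exact Or.inr (Or.inr (Or.inr ⟨poly3_ext_triq hf hF fun v => by simp [FC4], Or.inl hM1⟩))

theorem classification_of_triple {F : Poly3} {P : Polynomial ℂ} (h : IsStronglySeparable F P)
    (hdeg : P.natDegree ≤ 4) {M : GL (Fin 2) ℂ} (hM1 : mobius1 M P = PD) :
    ∃ M' : GL (Fin 2) ℂ, Carries M' F P FD PD := by
  have hs := sep_mobius h M
  rw [hM1] at hs
  obtain ⟨f, hf⟩ := exists_triq_of_degreeOf_le hs.degree_le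
  have hsep := (isStronglySeparable_iff hf _).1 hs
  simp only [PD, Polynomial.eval_X] at hsep
  obtain ⟨ε, hε, hF⟩ := hsep.eq_of_triple
  have hG : mobius3 M F = MvPolynomial.C ε * FD :=
    poly3_ext_triq hf hF fun v => by simp [FD]
  exact exists_carries_of_sq_eq_one h.degree_le hdeg hε hG hM1

theorem classification_of_quadruple {F : Poly3} {P : Polynomial ℂ} (h : IsStronglySeparable F P)
    {M : GL (Fin 2) ℂ} (hM1 : mobius1 M P = PE) :
    ∃ (M : GL (Fin 2) ℂ) (l m n : ℂ), m ^ 2 - 4 * l * n = 1 ∧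
      (Carries M F P (FE1 l m n) PE ∨ Carries M F P (FE2 l m n) PE ∨
        Carries M F P (FE3 l m n) PE ∨ Carries M F P (FE4 l m n) PE) := by
  have hs := sep_mobius h M
  rw [hM1] at hs
  obtain ⟨f, hf⟩ := exists_triq_of_degreeOf_le hs.degree_le
  have hsep := (isStronglySeparable_iff hf _).1 hs
  simp only [PE, Polynomial.eval_one] at hsep
  obtain ⟨l, m, n, s, t, hlmn, hs1, ht1, hF⟩ := hsep.eq_of_quadruple
  -- For s = t = -1 the linear form is x - y - z = -(y + z - x), and m changes sign.
  have hlmn' : (-m) ^ 2 - 4 * l * n = 1 := by rw [neg_sq]; exact hlmn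
  rcases eq_one_or_eq_neg_one hs1 with rfl | rfl <;> rcases eq_one_or_eq_neg_one ht1 with rfl | rfl
  · exact ⟨M, l, m, n, hlmn, Or.inl ⟨poly3_ext_triq hf hF fun v => by simp [FE1], Or.inl hM1⟩⟩
  · exact ⟨M, l, m, n, hlmn, Or.inr (Or.inr (Or.inr ⟨poly3_ext_triq hf hF fun v => by
      simp [FE4]; ring, Or.inl hM1⟩))⟩
  · exact ⟨M, l, m, n, hlmn, Or.inr (Or.inr (Or.inl ⟨poly3_ext_triq hf hF fun v => by
      simp [FE3]; ring, Or.inl hM1⟩))⟩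
  · exact ⟨M, l, -m, n, hlmn', Or.inr (Or.inl ⟨poly3_ext_triq hf hF fun v => by
      simp [FE2]; ring, Or.inl hM1⟩)⟩

theorem classification {F : Poly3} {P : Polynomial ℂ} (hP : P ≠ 0) (h : IsStronglySeparable F P) :
    (rootStructure P = {1, 1, 1, 1} ∧
      ∃ (M : GL (Fin 2) ℂ) (k : ℂ), k ≠ 0 ∧ k ^ 2 ≠ 1 ∧ Carries M F P (FA k) (PA k)) ∨
    (rootStructure P = {2, 1, 1} ∧
      ∃ (M : GL (Fin 2) ℂ) (e : ℂ), e ≠ 0 ∧ Carries M F P (FB e) (PB e)) ∨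
    (rootStructure P = {2, 2} ∧
      ∃ (M : GL (Fin 2) ℂ) (l m n : ℂ), m ^ 2 - 4 * l * n = 1 ∧
        (Carries M F P (FC1 l m n) PC ∨ Carries M F P (FC2 l m n) PC ∨
          Carries M F P (FC3 l m n) PC ∨ Carries M F P (FC4 l m n) PC)) ∨
    (rootStructure P = {3, 1} ∧ ∃ M : GL (Fin 2) ℂ, Carries M F P FD PD) ∨
    (rootStructure P = {4} ∧
      ∃ (M : GL (Fin 2) ℂ) (l m n : ℂ), m ^ 2 - 4 * l * n = 1 ∧
        (Carries M F P (FE1 l m n) PE ∨ Carries M F P (FE2 l m n) PE ∨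
          Carries M F P (FE3 l m n) PE ∨ Carries M F P (FE4 l m n) PE)) := by
  obtain ⟨f, hf⟩ := exists_triq_of_degreeOf_le h.degree_le
  have hdeg := ((isStronglySeparable_iff hf P).1 h).natDegree_le
  rcases rootStructure_cases hP hdeg with
    ⟨hr, c, u1, v1, u2, v2, u3, v3, u4, v4, hc, h12, h13, h14, h23, h24, h34, rfl⟩ |
    ⟨hr, c, u1, v1, u2, v2, u3, v3, hc, h12, h13, h23, rfl⟩ |
    ⟨hr, c, u1, v1, u2, v2, hc, h12, rfl⟩ | ⟨hr, c, u1, v1, u2, v2, hc, h12, rfl⟩ |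
    ⟨hr, c, u1, v1, hc, h1, rfl⟩
  · obtain ⟨M, k, hk, hk1, hM1, hM3⟩ :=
      exists_mobius_diagonal_zero hc h12 h13 h14 h23 h24 h34 h
    obtain ⟨M', hM'⟩ := classification_of_simple h hdeg hk1 hM1 hM3
    exact Or.inl ⟨hr, M', k, hk, hk1, hM'⟩
  · obtain ⟨M, hM⟩ := exists_mobius1_eq_PB hc h12 h13 h23
    exact Or.inr (Or.inl ⟨hr, classification_of_one_double h hdeg one_ne_zero hM⟩)
  · obtain ⟨M, hM⟩ := exists_mobius1_eq_PC hc h12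
    exact Or.inr (Or.inr (Or.inl ⟨hr, classification_of_two_double h hM⟩))
  · obtain ⟨M, hM⟩ := exists_mobius1_eq_PD hc h12
    exact Or.inr (Or.inr (Or.inr (Or.inl ⟨hr, classification_of_triple h hdeg hM⟩)))
  · obtain ⟨M, hM⟩ := exists_mobius1_eq_PE hc h1
    exact Or.inr (Or.inr (Or.inr (Or.inr ⟨hr, classification_of_quadruple h hM⟩)))

theorem exists_canonical_form {P : Polynomial ℂ} (hP : P ≠ 0) (hdeg : P.natDegree ≤ 4) :
    (rootStructure P = {1, 1, 1, 1} →
      ∃ (M : GL (Fin 2) ℂ) (k : ℂ), k ≠ 0 ∧ k ^ 2 ≠ 1 ∧ mobius1 M P = PA k) ∧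
    (rootStructure P = {2, 1, 1} →
      ∃ (M : GL (Fin 2) ℂ) (e : ℂ), e ≠ 0 ∧ mobius1 M P = PB e) ∧
    (rootStructure P = {2, 2} → ∃ M : GL (Fin 2) ℂ, mobius1 M P = PC) ∧
    (rootStructure P = {3, 1} → ∃ M : GL (Fin 2) ℂ, mobius1 M P = PD) ∧
    (rootStructure P = {4} → ∃ M : GL (Fin 2) ℂ, mobius1 M P = PE) := by
  rcases rootStructure_cases hP hdeg with
    ⟨hr, c, u1, v1, u2, v2, u3, v3, u4, v4, hc, h12, h13, h14, h23, h24, h34, rfl⟩ |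
    ⟨hr, c, u1, v1, u2, v2, u3, v3, hc, h12, h13, h23, rfl⟩ |
    ⟨hr, c, u1, v1, u2, v2, hc, h12, rfl⟩ | ⟨hr, c, u1, v1, u2, v2, hc, h12, rfl⟩ |
    ⟨hr, c, u1, v1, hc, h1, rfl⟩ <;> rw [hr]
  · refine ⟨fun _ => ?_, fun h => absurd h (by decide), fun h => absurd h (by decide),
      fun h => absurd h (by decide), fun h => absurd h (by decide)⟩
    obtain ⟨M, k, hk, hk1, hM1, -⟩ := exists_mobius1_eq_PA hc h12 h13 h14 h23 h24 h34
    exact ⟨M, k, hk, hk1, hM1⟩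
  · refine ⟨fun h => absurd h (by decide), fun _ => ?_, fun h => absurd h (by decide),
      fun h => absurd h (by decide), fun h => absurd h (by decide)⟩
    obtain ⟨M, hM⟩ := exists_mobius1_eq_PB hc h12 h13 h23
    exact ⟨M, 1, one_ne_zero, hM⟩
  · exact ⟨fun h => absurd h (by decide), fun h => absurd h (by decide),
      fun _ => exists_mobius1_eq_PC hc h12, fun h => absurd h (by decide),
      fun h => absurd h (by decide)⟩
  · exact ⟨fun h => absurd h (by decide), fun h => absurd h (by decide),
      fun h => absurd h (by decide), fun _ => exists_mobius1_eq_PD hc h12,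
      fun h => absurd h (by decide)⟩
  · exact ⟨fun h => absurd h (by decide), fun h => absurd h (by decide),
      fun h => absurd h (by decide), fun h => absurd h (by decide),
      fun _ => exists_mobius1_eq_PE hc h1⟩

end DiscSep
end

theorem theorem1 :
    -- Simultaneous fractional-linear transformations act on strongly discriminantly separable
    -- polynomials.
    (∀ (M : GL (Fin 2) ℂ) (F : DiscSep.Poly3) (P : Polynomial ℂ), DiscSep.IsStronglySeparable F P →
      DiscSep.IsStronglySeparable (DiscSep.mobius3 M F) (DiscSep.mobius1 M P)) ∧
    -- Exhaustion: every strongly discriminantly separable polynomial is in the list, up to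
    -- simultaneous fractional-linear transformations, according to the root structure of `P`.
    (∀ (F : DiscSep.Poly3) (P : Polynomial ℂ), P ≠ 0 → DiscSep.IsStronglySeparable F P →
      (DiscSep.rootStructure P = {1, 1, 1, 1} ∧
        ∃ (M : GL (Fin 2) ℂ) (k : ℂ), k ≠ 0 ∧ k ^ 2 ≠ 1 ∧
          DiscSep.Carries M F P (DiscSep.FA k) (DiscSep.PA k)) ∨
      (DiscSep.rootStructure P = {2, 1, 1} ∧
        ∃ (M : GL (Fin 2) ℂ) (e : ℂ), e ≠ 0 ∧
          DiscSep.Carries M F P (DiscSep.FB e) (DiscSep.PB e)) ∨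
      (DiscSep.rootStructure P = {2, 2} ∧
        ∃ (M : GL (Fin 2) ℂ) (l m n : ℂ), m ^ 2 - 4 * l * n = 1 ∧
          (DiscSep.Carries M F P (DiscSep.FC1 l m n) DiscSep.PC ∨
            DiscSep.Carries M F P (DiscSep.FC2 l m n) DiscSep.PC ∨
            DiscSep.Carries M F P (DiscSep.FC3 l m n) DiscSep.PC ∨
            DiscSep.Carries M F P (DiscSep.FC4 l m n) DiscSep.PC)) ∨
      (DiscSep.rootStructure P = {3, 1} ∧
        ∃ M : GL (Fin 2) ℂ, DiscSep.Carries M F P DiscSep.FD DiscSep.PD) ∨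
      (DiscSep.rootStructure P = {4} ∧
        ∃ (M : GL (Fin 2) ℂ) (l m n : ℂ), m ^ 2 - 4 * l * n = 1 ∧
          (DiscSep.Carries M F P (DiscSep.FE1 l m n) DiscSep.PE ∨
            DiscSep.Carries M F P (DiscSep.FE2 l m n) DiscSep.PE ∨
            DiscSep.Carries M F P (DiscSep.FE3 l m n) DiscSep.PE ∨
            DiscSep.Carries M F P (DiscSep.FE4 l m n) DiscSep.PE))) ∧
    -- Canonical forms: the root structure determines the canonical form of `P`.
    (∀ P : Polynomial ℂ, P ≠ 0 → P.natDegree ≤ 4 →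
      (DiscSep.rootStructure P = {1, 1, 1, 1} →
        ∃ (M : GL (Fin 2) ℂ) (k : ℂ), k ≠ 0 ∧ k ^ 2 ≠ 1 ∧ DiscSep.mobius1 M P = DiscSep.PA k) ∧
      (DiscSep.rootStructure P = {2, 1, 1} →
        ∃ (M : GL (Fin 2) ℂ) (e : ℂ), e ≠ 0 ∧ DiscSep.mobius1 M P = DiscSep.PB e) ∧
      (DiscSep.rootStructure P = {2, 2} →
        ∃ M : GL (Fin 2) ℂ, DiscSep.mobius1 M P = DiscSep.PC) ∧
      (DiscSep.rootStructure P = {3, 1} →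
        ∃ M : GL (Fin 2) ℂ, DiscSep.mobius1 M P = DiscSep.PD) ∧
      (DiscSep.rootStructure P = {4} →
        ∃ M : GL (Fin 2) ℂ, DiscSep.mobius1 M P = DiscSep.PE)) ∧
    -- The canonical polynomials `P` have the stated root structures, and all the listed
    -- polynomials are strongly discriminantly separable with the corresponding `P`.
    (∀ k : ℂ, k ≠ 0 → k ^ 2 ≠ 1 →
      DiscSep.rootStructure (DiscSep.PA k) = {1, 1, 1, 1} ∧
        DiscSep.IsStronglySeparable (DiscSep.FA k) (DiscSep.PA k)) ∧
    (∀ e : ℂ, e ≠ 0 →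
      DiscSep.rootStructure (DiscSep.PB e) = {2, 1, 1} ∧
        DiscSep.IsStronglySeparable (DiscSep.FB e) (DiscSep.PB e)) ∧
    (DiscSep.rootStructure DiscSep.PC = {2, 2} ∧
      ∀ l m n : ℂ, m ^ 2 - 4 * l * n = 1 →
        DiscSep.IsStronglySeparable (DiscSep.FC1 l m n) DiscSep.PC ∧
        DiscSep.IsStronglySeparable (DiscSep.FC2 l m n) DiscSep.PC ∧
        DiscSep.IsStronglySeparable (DiscSep.FC3 l m n) DiscSep.PC ∧
        DiscSep.IsStronglySeparable (DiscSep.FC4 l m n) DiscSep.PC) ∧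
    (DiscSep.rootStructure DiscSep.PD = {3, 1} ∧
      DiscSep.IsStronglySeparable DiscSep.FD DiscSep.PD) ∧
    (DiscSep.rootStructure DiscSep.PE = {4} ∧
      ∀ l m n : ℂ, m ^ 2 - 4 * l * n = 1 →
        DiscSep.IsStronglySeparable (DiscSep.FE1 l m n) DiscSep.PE ∧
        DiscSep.IsStronglySeparable (DiscSep.FE2 l m n) DiscSep.PE ∧
        DiscSep.IsStronglySeparable (DiscSep.FE3 l m n) DiscSep.PE ∧
        DiscSep.IsStronglySeparable (DiscSep.FE4 l m n) DiscSep.PE) := by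
  exact ⟨fun M _ _ h => DiscSep.sep_mobius h M, fun _ _ => DiscSep.classification,
    fun _ => DiscSep.exists_canonical_form,
    fun k hk hk1 => ⟨DiscSep.rootStructure_PA hk hk1, DiscSep.isStronglySeparable_FA k⟩,
    fun e he => ⟨DiscSep.rootStructure_PB he, DiscSep.isStronglySeparable_FB e⟩,
    ⟨DiscSep.rootStructure_PC, fun _ _ _ h => ⟨DiscSep.isStronglySeparable_FC1 h,
      DiscSep.isStronglySeparable_FC2 h, DiscSep.isStronglySeparable_FC3 h,
      DiscSep.isStronglySeparable_FC4 h⟩⟩,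
    ⟨DiscSep.rootStructure_PD, DiscSep.isStronglySeparable_FD⟩,
    ⟨DiscSep.rootStructure_PE, fun _ _ _ h => ⟨DiscSep.isStronglySeparable_FE1 h,
      DiscSep.isStronglySeparable_FE2 h, DiscSep.isStronglySeparable_FE3 h,
      DiscSep.isStronglySeparable_FE4 h⟩⟩⟩
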